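/- **Setting.** Let $\mathbb T^2=(\mathbb R/\mathbb Z)^2$ with normalised Haar measure, $L=-\Delta$, with modes $e_k$, $k\in\mathbb Z^2$, of frequency $\xi=2\pi k$. Fix an even integer $b=2n\ge4$ and put, for $c\ge1$, $$P^{(c)}_t=\Big(\sum_{i<c}\tfrac{(tL)^i}{i!}\Big)e^{-tL},\qquad P_t=P_t^{(b)},\qquad Q_t=\tfrac{(tL)^b}{(b-1)!}e^{-tL}.$$ A standard Gaussian operator with cancellation of order $|I|+2j$ is $(\sqrt t\,\partial)^I(tL)^jP^{(c)}_t$, $1\le c\le b$. For $\gamma\in\mathbb R$, $$\|f\|_{\mathcal C^\gamma}=\|e^{-L}f\|_{L^\infty}+\sup_{G}\sup_{0<t\le1}t^{-\gamma/2}\|G_tf\|_{L^\infty},$$ where $G$ runs over the standard Gaussian operators with cancellation of order in $(|\gamma|,2b]$. Also $\|f\|_{\mathcal H^2}=\|(1-\Delta)f\|_{L^2}$ and $\Delta^{-1}:=-\int_0^1e^{t\Delta}\,dt$. *Paraproducts.* In the identity $$fg=\int_0^1\{Q_t(P_tf\cdot P_tg)+P_t(Q_tf\cdot P_tg)+P_t(P_tf\cdot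 Q_tg)\}\tfrac{dt}t+P_1(P_1f\cdot P_1g),$$ write each $Q_t$ as $(tL)^{n}\,\tfrac{(tL)^{n}}{(b-1)!}e^{-tL}$ and move the factor $(tL)^n$ to the two other operators by the Leibniz rule. Let $\mathsf P_fg$ collect from the third term the terms $\int_0^1Q^1_t(P'_tf\cdot Q^2_tg)\frac{dt}t$ in which at least $n$ derivatives fall on the outer operator, and from the first term those in which fewer than $n$ of the $2n$ moved derivatives fall on $f$, together with half of those in which exactly $n$ do. Define $\mathsf P_gf$ symmetrically, and let $\mathsf\Pi(f,g)$ be the rest, including $P_1(P_1f\cdot P_1g)$; thus $fg=\mathsf P_fg+\mathsf P_gf+\mathsf\Pi(f,g)$. For $s\in(0,1]$, $\mathsf P^s$ is $\mathsf P$ with $\int_0^1$ replaced by $\int_0^s$, and $\widetilde{\mathsf P}^s_fg=L^{-1}\mathsf P^s_f(Lg)$ with zero mean; $\widetilde{\mathsf P}=\widetilde{\mathsf P}^1$. *Operator.* Let $\alpha\in(\frac23,1)$ and let $\mathbf A=(A,A^2)$ be real-valued distributions, $A=(A_1,A_2)\in\mathcal C^{\alpha-1}(\mathbb T^2,\mathbb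 R^2)$, $A^2\in\mathcal C^{2\alpha-2}(\mathbb T^2,\mathbb R)$ ($A^2$ is a given datum), with $$\|\mathbf A\|=\|\mathbf A\|_{\mathcal X^\alpha}=\|A_1\|_{\mathcal C^{\alpha-1}}+\|A_2\|_{\mathcal C^{\alpha-1}}+\|A^2\|_{\mathcal C^{2\alpha-2}}.$$ Put $X_1=\Delta^{-1}(A^2)$, $X_2=\Delta^{-1}(2iA)$, $$\Phi^s(u)=u-\widetilde{\mathsf P}^s_uX_1-\widetilde{\mathsf P}^s_{\nabla u}X_2,\quad \Phi=\Phi^1,\quad \mathcal D_{\mathbf A}=\{u\in L^2:\Phi(u)\in\mathcal H^2\},$$ $$Hu=-\Delta\Phi(u)+\mathsf P_{2iA}\nabla u+\mathsf\Pi(\nabla u,2iA)+\mathsf P_{A^2}u+\mathsf\Pi(u,A^2),\qquad u\in\mathcal D_{\mathbf A},$$ where a vector-valued index means the sum over components. *Constants.* Let $\beta=\frac12(\frac43+2\alpha)$, $\beta^*=2\alpha-\beta$ (since $\beta\ge1$), and, for $m,k>0$, $$s_\beta(\mathbf A)=\Big(\frac{\beta^*}{m\|\mathbf A\|}\Big)^{\frac4{2\alpha-\beta}}\quad(=\infty\text{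 if }\mathbf A=0),$$ $$m_\delta^2(\mathbf A,s)=ks^{\frac{\alpha-2}2}\|\mathbf A\|+k\delta^{-\frac\beta{2-\beta}}\left(\frac{\|\mathbf A\|}{1-m\frac{s^{(2\alpha-\beta)/4}}{\beta^*}\|\mathbf A\|}\right)^{\frac2{2-\beta}}\big(1+s^{\frac\alpha2}\|\mathbf A\|\big).$$ **Proposition.** There are a constant $m>0$ depending only on $b$ and, for every $\alpha\in(\frac23,1)$, a constant $k>0$ depending only on $b$ and $\alpha$, such that for every such $\mathbf A$ the following holds. $H$ is a well-defined linear operator from the subspace $\mathcal D_{\mathbf A}\subset L^2$ to $L^2$, and it is closed. For every $s\in(0,1)$ with $s<s_\beta(\mathbf A)$ and every $u\in\mathcal D_{\mathbf A}$, $u_s^\sharp:=\Phi^s(u)$ belongs to $\mathcal H^2$, and for every $\delta>0$ $$(1-\delta)\|\Delta u_s^\sharp\|_{L^2}\le\|Hu\|_{L^2}+m_\delta^2(\mathbf A,s)\|u\|_{L^2},\qquad \|Hu\|_{L^2}\le(1+\delta)\|\Delta u_s^\sharp\|_{L^2}+m_\delta^2(\mathbf A,s)\|u\|_{L^2},$$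 and, for the full norm of $\mathcal H^2$, $$(1-\delta)\|u_s^\sharp\|_{\mathcal H^2}\le\|Hu\|_{L^2}+\big(k+m_\delta^2(\mathbf A,s)\big)\|u\|_{L^2},\qquad \|Hu\|_{L^2}\le(1+\delta)\|u_s^\sharp\|_{\mathcal H^2}+m_\delta^2(\mathbf A,s)\|u\|_{L^2}.$$ In particular, for such $s$ the graph norm $(\|u\|_{L^2}^2+\|Hu\|_{L^2}^2)^{1/2}$ and the norm $(\|u\|_{L^2}^2+\|\Phi^s(u)\|_{\mathcal H^2}^2)^{1/2}$ are equivalent on $\mathcal D_{\mathbf A}$. -/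

import Mathlib

open MeasureTheory Set
open scoped ENNReal

noncomputable section

namespace MagneticLaplacian

/-! ### Functions and distributions on the torus `𝕋² = (ℝ/ℤ)²` -/

/-- The two-dimensional torus, with its normalised Haar measure below. -/
abbrev Torus : Type := UnitAddTorus (Fin 2)

/-- Indices of the Fourier modes of the torus. -/
abbrev Freq : Type := Fin 2 → ℤ

/-- The normalised Haar measure of the torus. -/
abbrev torusMeasure : Measure Torus := Measure.pi fun _ : Fin 2 => AddCircle.haarAddCircle

/-- The Hilbert space `L²(𝕋², ℂ)`. -/
abbrev L2T : Type := Lp ℂ 2 torusMeasure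

/-- The frequency vector `ξ = 2πk` of the mode `e_k(x) = exp(2πi k·x)`. -/
def xi (k : Freq) (i : Fin 2) : ℝ := 2 * Real.pi * (k i : ℝ)

/-- `|ξ|²`, the eigenvalue of `L = -Δ` on `e_k`. -/
def xiSq (k : Freq) : ℝ := xi k 0 ^ 2 + xi k 1 ^ 2

/-- Fourier coefficients of a square integrable function. -/
def coeff (u : L2T) : Freq → ℂ := fun k => UnitAddTorus.mFourierCoeff (u : Torus → ℂ) k

/-- A family of Fourier coefficients is that of a distribution on the torus iff it has
at most polynomial growth. -/
def IsDistribution (f : Freq → ℂ) : Prop :=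
  ∃ (C : ℝ) (N : ℕ), ∀ k, ‖f k‖ ≤ C * (1 + xiSq k) ^ N

/-- The distribution with these Fourier coefficients is real-valued. -/
def IsRealValued (f : Freq → ℂ) : Prop := ∀ k, f (-k) = (starRingEnd ℂ) (f k)

/-- The sum of the Fourier series (used for smooth functions only, where it converges
absolutely). -/
def toFun (f : Freq → ℂ) (x : Torus) : ℂ := ∑' k, f k * UnitAddTorus.mFourier k x

/-- Fourier coefficients of the pointwise product of two smooth functions. -/
def prodCoeff (f g : Freq → ℂ) : Freq → ℂ :=
  fun k => UnitAddTorus.mFourierCoeff (fun x => toFun f x * toFun g x) k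

/-- The partial derivative `∂_j`. -/
def partialD (j : Fin 2) (f : Freq → ℂ) : Freq → ℂ := fun k => Complex.I * (xi k j : ℂ) * f k

/-- The Laplacian `Δ`. -/
def lap (f : Freq → ℂ) : Freq → ℂ := fun k => -(xiSq k : ℂ) * f k

/-- `Δ⁻¹ := -∫₀¹ e^{tΔ} dt`, an inverse of `Δ` up to the smoothing operator `e^Δ`. -/
def invLap (f : Freq → ℂ) : Freq → ℂ :=
  fun k => -((∫ t in (0 : ℝ)..1, Real.exp (-t * xiSq k) : ℝ) : ℂ) * f k

/-- Membership in `L²`, on the Fourier side. -/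
def MemL2 (f : Freq → ℂ) : Prop := Summable fun k => ‖f k‖ ^ 2

/-- The `L²` norm, on the Fourier side. -/
def l2Norm (f : Freq → ℂ) : ℝ := Real.sqrt (∑' k, ‖f k‖ ^ 2)

/-- The Sobolev space `𝓗²`. -/
def MemH2 (f : Freq → ℂ) : Prop := MemL2 (f - lap f)

/-- The norm `‖f‖_{𝓗²} = ‖(1 - Δ) f‖_{L²}`. -/
def h2Norm (f : Freq → ℂ) : ℝ := l2Norm (f - lap f)

/-! ### Gaussian operators and Besov–Hölder norms -/

/-- Multiplier of `P_t^{(c)} = p_c(tL) e^{-tL}` with `p_c(x) = ∑_{i < c} xⁱ / i!`, so that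
`-t ∂_t P_t^{(c)} = (tL)^c e^{-tL} / (c-1)!` and `P_0^{(c)} = Id`, for `c ≥ 1`. -/
def heatP (c : ℕ) (t : ℝ) (k : Freq) : ℝ :=
  (∑ i ∈ Finset.range c, (t * xiSq k) ^ i / (i.factorial : ℝ)) * Real.exp (-t * xiSq k)

/-- Multiplier of `(√t ∂₁)^{I₁} (√t ∂₂)^{I₂} (tL)^j P_t^{(c)}`, a standard Gaussian operator
with cancellation of order `I₁ + I₂ + 2j`. -/
def gauss (I : Fin 2 → ℕ) (j c : ℕ) (t : ℝ) : Freq → ℂ := fun k =>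
  (Complex.I * ((Real.sqrt t * xi k 0 : ℝ) : ℂ)) ^ I 0 *
    (Complex.I * ((Real.sqrt t * xi k 1 : ℝ) : ℂ)) ^ I 1 *
    (((t * xiSq k) ^ j * heatP c t k : ℝ) : ℂ)

/-- The `L^∞` norm of a smooth function given by its Fourier coefficients. -/
def supNorm (f : Freq → ℂ) : ℝ≥0∞ := ⨆ x : Torus, ‖toFun f x‖ₑ

/-- The norm of `𝓒^γ = B^γ_{∞,∞}`:
`‖e^{-L} f‖_{L^∞} + sup_Q sup_{0 < t ≤ 1} t^{-γ/2} ‖Q_t f‖_{L^∞}`, where `Q` runs over the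
standard Gaussian operators with cancellation of order in `(|γ|, 2b]`. -/
def holderNorm (b : ℕ) (γ : ℝ) (f : Freq → ℂ) : ℝ≥0∞ :=
  supNorm (gauss 0 0 1 1 * f) +
    ⨆ (I : Fin 2 → ℕ) (j : ℕ) (c : ℕ)
      (_ : |γ| < ((I 0 + I 1 + 2 * j : ℕ) : ℝ) ∧ I 0 + I 1 + 2 * j ≤ 2 * b ∧ 1 ≤ c ∧ c ≤ b)
      (t : ℝ) (_ : t ∈ Ioc (0 : ℝ) 1),
      ENNReal.ofReal (t ^ (-γ / 2)) * supNorm (gauss I j c t * f)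

/-! ### Paraproducts

The integer `b = 2n` is the cancellation parameter. Writing `Q_t = (tL)^b e^{-tL} / (b-1)!`
and `P_t = P_t^{(b)}`, one starts from
`fg = ∫₀¹ {Q_t(P_t f · P_t g) + P_t(Q_t f · P_t g) + P_t(P_t f · Q_t g)} dt/t + P_1(P_1 f · P_1 g)`
and uses the Leibniz rule to move the derivatives of one factor `(tL)^n` in each `Q_t`. -/

/-- `∫₀ˢ Q¹_t (Q²_t f · Q³_t g) dt/t` for three families of Fourier multipliers. -/
def block (s : ℝ) (σ₁ σ₂ σ₃ : ℝ → Freq → ℂ) (f g : Freq → ℂ) : Freq → ℂ := fun k =>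
  ∫ t in (0 : ℝ)..s, (t : ℂ)⁻¹ * (σ₁ t k * prodCoeff (σ₂ t * f) (σ₃ t * g) k)

/-- `(tL)^n e^{-tL} / (2n-1)!`, what remains of `Q_t^{(2n)}` after removing `(tL)^n`. -/
def halfQ (n : ℕ) (t : ℝ) : Freq → ℂ := fun k =>
  (((2 * n - 1).factorial : ℕ) : ℂ)⁻¹ * gauss 0 n 1 t k

/-- The coefficient of `(√t∂₁F)^p (√t∂₂F)^q (√t∂₁G)^{2j-p} (√t∂₂G)^{2(n-j)-q}` (derivatives of
orders `p`, `q`, …) in the Leibniz expansion of `(tL)^n (F G)`. -/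
def leibniz (n j p q : ℕ) : ℂ :=
  (-1) ^ n * (n.choose j * (2 * j).choose p * (2 * (n - j)).choose q : ℕ)

/-- The weight of the part of `Q_t(P_t f · P_t g)` with `r` derivatives on `f` and `2n - r` on `g`
that is counted in `P_f g`. -/
def weight (n r : ℕ) : ℂ := if r < n then 1 else if r = n then 1 / 2 else 0

/-- The paraproduct `P_f g`, with integral over `t ∈ (0, s)`; the untruncated one is `s = 1`.
Outer operators, and operators acting on `g`, have cancellation of order at least `b/2 = n`. -/
def para (n : ℕ) (s : ℝ) (f g : Freq → ℂ) : Freq → ℂ :=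
  ∑ j ∈ Finset.range (n + 1), ∑ p ∈ Finset.range (2 * j + 1),
    ∑ q ∈ Finset.range (2 * (n - j) + 1),
      leibniz n j p q •
        ((if n ≤ p + q then (-1 : ℂ) ^ (p + q) else 0) •
            block s (gauss ![p, q] 0 (2 * n)) (gauss ![2 * j - p, 2 * (n - j) - q] 0 (2 * n))
              (halfQ n) f g +
          weight n (p + q) •
            block s (halfQ n) (gauss ![p, q] 0 (2 * n))
              (gauss ![2 * j - p, 2 * (n - j) - q] 0 (2 * n)) f g)

/-- The resonant term `Π(f, g)`, so that `f g = P_f g + P_g f + Π(f, g)`. -/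
def reso (n : ℕ) (f g : Freq → ℂ) : Freq → ℂ :=
  (∑ j ∈ Finset.range (n + 1), ∑ p ∈ Finset.range (2 * j + 1),
    ∑ q ∈ Finset.range (2 * (n - j) + 1),
      (leibniz n j p q * if p + q < n then (-1 : ℂ) ^ (p + q) else 0) •
        (block 1 (gauss ![p, q] 0 (2 * n)) (gauss ![2 * j - p, 2 * (n - j) - q] 0 (2 * n))
            (halfQ n) f g +
          block 1 (gauss ![p, q] 0 (2 * n)) (halfQ n)
            (gauss ![2 * j - p, 2 * (n - j) - q] 0 (2 * n)) f g)) +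
    gauss 0 0 (2 * n) 1 * prodCoeff (gauss 0 0 (2 * n) 1 * f) (gauss 0 0 (2 * n) 1 * g)

/-- The intertwined (truncated) paraproduct `L⁻¹ P_f^s (L g)`: in each integral the outer operator
`Q¹_t` becomes `(tL)⁻¹ Q¹_t` and the operator `Q²_t` on `g` becomes `(tL) Q²_t`. At the zero
frequency, which is not in the range of `P_f`, the coefficient is `0`. -/
def tpara (n : ℕ) (s : ℝ) (f g : Freq → ℂ) : Freq → ℂ := fun k =>
  ((xiSq k : ℂ))⁻¹ * para n s f (fun l => (xiSq l : ℂ) * g l) k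

/-! ### The operator -/

/-- An enhanced potential `(A, A²)`: real-valued distributions `A₁, A₂` and `A²`. -/
structure EnhancedPotential where
  pot : Fin 2 → Freq → ℂ
  sq : Freq → ℂ
  pot_dist : ∀ j, IsDistribution (pot j)
  sq_dist : IsDistribution sq
  pot_real : ∀ j, IsRealValued (pot j)
  sq_real : IsRealValued sq

/-- `‖A‖_{𝓒^{α-1}} + ‖A²‖_{𝓒^{2α-2}}`, with `𝓒`-norms built with `b = 2n`;
the potential belongs to `𝓧^α` iff this is finite. -/
def EnhancedPotential.xNorm (n : ℕ) (α : ℝ) (A : EnhancedPotential) : ℝ≥0∞ :=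
  (∑ j, holderNorm (2 * n) (α - 1) (A.pot j)) + holderNorm (2 * n) (2 * α - 2) A.sq

/-- `2i A_j`. -/
def EnhancedPotential.twoI (A : EnhancedPotential) (j : Fin 2) : Freq → ℂ :=
  (2 * Complex.I) • A.pot j

/-- `X₁ = Δ⁻¹(A²)`. -/
def EnhancedPotential.X₁ (A : EnhancedPotential) : Freq → ℂ := invLap A.sq

/-- The components of `X₂ = Δ⁻¹(2iA)`. -/
def EnhancedPotential.X₂ (A : EnhancedPotential) (j : Fin 2) : Freq → ℂ := invLap (A.twoI j)

/-- `Φˢ(u) = u - P̃ˢ_u X₁ - P̃ˢ_{∇u} X₂`; `Φ = Φ¹`. -/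
def Phi (n : ℕ) (A : EnhancedPotential) (s : ℝ) (u : L2T) : Freq → ℂ :=
  coeff u - tpara n s (coeff u) A.X₁ - ∑ j, tpara n s (partialD j (coeff u)) (A.X₂ j)

/-- The domain `𝓓_A = {u ∈ L² : Φ(u) ∈ 𝓗²}`. -/
def domain (n : ℕ) (A : EnhancedPotential) : Set L2T := {u | MemH2 (Phi n A 1 u)}

/-- `R(u) = P_{2iA} ∇u + Π(∇u, 2iA) + P_{A²} u + Π(u, A²)`. -/
def remainder (n : ℕ) (A : EnhancedPotential) (u : L2T) : Freq → ℂ :=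
  (∑ j, (para n 1 (A.twoI j) (partialD j (coeff u)) + reso n (partialD j (coeff u)) (A.twoI j))) +
    para n 1 A.sq (coeff u) + reso n (coeff u) A.sq

/-- `H` is the unbounded operator in `L²` with domain `𝓓_A` and `Hu = -Δ Φ(u) + R(u)`. These two
conditions determine `H`. -/
def IsMagneticLaplacian (n : ℕ) (A : EnhancedPotential) (H : L2T →ₗ.[ℂ] L2T) : Prop :=
  (H.domain : Set L2T) = domain n A ∧
    ∀ u : H.domain, coeff (H u) = -lap (Phi n A 1 (u : L2T)) + remainder n A (u : L2T)

/-- The graph norm `(‖u‖² + ‖Hu‖²)^{1/2}`. -/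
def graphNorm (H : L2T →ₗ.[ℂ] L2T) (u : H.domain) : ℝ :=
  Real.sqrt (‖(u : L2T)‖ ^ 2 + ‖H u‖ ^ 2)

/-- The norm `(‖u‖² + ‖Φˢ(u)‖²_{𝓗²})^{1/2}` of the domain. -/
def domainNorm (n : ℕ) (A : EnhancedPotential) (s : ℝ) (u : L2T) : ℝ :=
  Real.sqrt (‖u‖ ^ 2 + h2Norm (Phi n A s u) ^ 2)

/-! ### The constants -/

/-- `β = (4/3 + 2α)/2`. -/
def betaOf (α : ℝ) : ℝ := (4 / 3 + 2 * α) / 2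

/-- `β* = 1 - β` for `β < 1`, and `β* = 2α - β` otherwise. -/
def betaStar (α β : ℝ) : ℝ := if β < 1 then 1 - β else 2 * α - β

/-- `s_β(A) = (β* / (m ‖A‖_{𝓧^α}))^{4/(2α-β)}`, which is `∞` when `A = 0`. -/
def sThreshold (n : ℕ) (m α β : ℝ) (A : EnhancedPotential) : ℝ≥0∞ :=
  (ENNReal.ofReal (betaStar α β) / (ENNReal.ofReal m * A.xNorm n α)) ^ (4 / (2 * α - β))

/-- The constant `m_δ²(A, s)`, where `N = ‖A‖_{𝓧^α}`. -/
def mDeltaSq (m k α δ s N : ℝ) : ℝ :=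
  k * s ^ ((α - 2) / 2) * N +
    k * δ ^ (-(betaOf α / (2 - betaOf α))) *
      (N / (1 - m * (s ^ ((2 * α - betaOf α) / 4) / betaStar α (betaOf α)) * N)) ^
        (2 / (2 - betaOf α)) * (1 + s ^ (α / 2) * N)

end MagneticLaplacian

end

/-!
The proof is carried out on the side of Fourier coefficients, where `L²` and Sobolev bounds are
bounds on weighted `ℓ²` sums (`L2Bd`, `HBd`).

Every paraproduct and resonant term is a finite sum of blocks `∫ Q¹_t(Q²_t f · Q³_t g) dt/t`. All
exponents that occur are away from the critical ones, so each block is estimated by Minkowski's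
inequality: `Q³_t g` is measured in `L^∞`, where it is `O(t^{γ/2})` for `g ∈ 𝓒^γ`, `Q²_t f` is
measured in `L²`, where it is `O(t^{ρ/2})` for `f ∈ H^ρ`, and the outer operator is a Fourier
multiplier. No almost orthogonality is needed. This gives two estimates. The first
(`goodPara_para`, `exists_pert_bd`) is for the intertwined paraproducts: `P̃ˢ_u X₁ + P̃ˢ_{∇u} X₂` is
`O(s^{α/2})` in `L²`, it is `O(s^{(2α-β)/4}/β*)` on `H^β` with a constant that depends only on `b`,
and removing the times below `s` leaves a function in `H²`. The second (`goodRem_para`,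
`goodRem_reso`, `exists_remPart_bd`) is for the remainder, which maps `H^β` to `L²` since
`β + α > 2`.

A function `u` in the domain belongs to `H^β` by bootstrapping the first estimate from `L²` to
`H^{β/2}` and from there to `H^β` (`exists_hBd_betaOf`). For `s` below the threshold, the
contraction gives `‖u‖_{H^β} ≤ 2 ‖Φˢ(u)‖_{H^β}`. Since `Hu + ΔΦˢ(u)` consists of the remainder and of
the part of the paraproducts with `t > s`, the comparison of `Hu` with `ΔΦˢ(u)` follows from
interpolating `H^β` between `L²` and `H²`, which is Young's inequality at each frequency
(`mul_hNorm_le`, `exists_opSeq_bounds`). The zero mode is kept apart there: it is the same for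
`Φˢ(u)` and `u`, and its contribution carries no power of `δ`.

The graph norm is therefore equivalent to `‖u‖ + ‖Φˢ(u)‖_{𝓗²}`, and since `Φˢ` is continuous on `L²`
the operator is closed (`isClosed_of_bounds`).
-/

noncomputable section

namespace MagneticLaplacian

/-! ### Bounds in weighted `ℓ²` spaces -/

/-- The sequence `f` has `ℓ²` norm at most `C`. Bounding finite sums includes summability. -/
def L2Bd (f : Freq → ℂ) (C : ℝ) : Prop :=
  0 ≤ C ∧ ∀ S : Finset Freq, ∑ k ∈ S, ‖f k‖ ^ 2 ≤ C ^ 2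

/-- The distribution `f` has norm at most `F` in the Sobolev space `H^ρ` with weight
`(1 + |ξ|²)^{ρ/2}`. -/
def HBd (ρ : ℝ) (f : Freq → ℂ) (F : ℝ) : Prop :=
  L2Bd (fun k => (((1 + xiSq k) ^ (ρ / 2) : ℝ) : ℂ) * f k) F

lemma xiSq_nonneg (k : Freq) : 0 ≤ xiSq k := by unfold xiSq; positivity

lemma one_le_one_add_xiSq (k : Freq) : 1 ≤ 1 + xiSq k := by linarith [xiSq_nonneg k]

lemma one_add_xiSq_pos (k : Freq) : 0 < 1 + xiSq k := by linarith [xiSq_nonneg k]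

@[simp] lemma xiSq_zero : xiSq 0 = 0 := by simp [xiSq, xi]

lemma xiSq_eq (k : Freq) : xiSq k = (2 * Real.pi) ^ 2 * ((k 0 : ℝ) ^ 2 + (k 1 : ℝ) ^ 2) := by
  unfold xiSq xi; ring

lemma one_le_two_pi_sq : (1 : ℝ) ≤ (2 * Real.pi) ^ 2 := by
  nlinarith [Real.pi_gt_three]

lemma norm_sq_le_xiSq (k : Freq) : ‖k‖ ^ 2 ≤ xiSq k := by
  have h : ‖k‖ ^ 2 ≤ (k 0 : ℝ) ^ 2 + (k 1 : ℝ) ^ 2 := by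
    obtain ⟨i, hi⟩ : ∃ i, ‖k‖ = ‖k i‖ := by
      obtain ⟨i, -, hi⟩ := Finset.exists_mem_eq_sup' (s := (Finset.univ : Finset (Fin 2)))
        ⟨0, Finset.mem_univ _⟩ (fun i => ‖k i‖₊)
      refine ⟨i, ?_⟩
      rw [Pi.norm_def, ← Finset.sup'_eq_sup ⟨0, Finset.mem_univ _⟩, hi]
      rfl
    rw [hi, Int.norm_eq_abs, sq_abs]
    fin_cases i
    · simpa using sq_nonneg _
    · simpa using sq_nonneg _
  rw [xiSq_eq]
  nlinarith [one_le_two_pi_sq, sq_nonneg (k 0 : ℝ), sq_nonneg (k 1 : ℝ)]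

lemma one_le_norm {k : Freq} (hk : k ≠ 0) : 1 ≤ ‖k‖ := by
  obtain ⟨i, hi⟩ := Function.ne_iff.mp hk
  have h1 : (1 : ℝ) ≤ ‖k i‖ := by
    rw [Int.norm_eq_abs]
    exact_mod_cast Int.one_le_abs hi
  exact h1.trans (norm_le_pi_norm k i)

lemma one_le_xiSq {k : Freq} (hk : k ≠ 0) : 1 ≤ xiSq k :=
  (one_le_pow₀ (one_le_norm hk)).trans (norm_sq_le_xiSq k)

/-- By comparison with `‖k‖⁻³`, which is summable over `ℤ²`. -/
lemma summable_one_add_xiSq : Summable fun k : Freq => ((1 + xiSq k) ^ 2)⁻¹ := by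
  have h3 := (EisensteinSeries.summable_one_div_norm_rpow (k := 3) (by norm_num))
  have h0 : Summable fun k : Freq => if k = 0 then (1 : ℝ) else 0 :=
    summable_of_hasFiniteSupport ((Set.finite_singleton (0 : Freq)).subset (by
      intro k hk; by_contra h; simp_all))
  refine Summable.of_nonneg_of_le (fun k => by positivity) (fun k => ?_) (h3.add h0)
  by_cases hk : k = 0
  · subst hk; simp
  · have hn : 1 ≤ ‖k‖ := one_le_norm hk
    have h2 := norm_sq_le_xiSq k
    simp only [if_neg hk, add_zero]
    rw [Real.rpow_neg (norm_nonneg _)]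
    apply inv_anti₀ (by positivity)
    rw [show (3 : ℝ) = ((3 : ℕ) : ℝ) by norm_num, Real.rpow_natCast]
    calc ‖k‖ ^ 3 ≤ ‖k‖ ^ 4 := pow_le_pow_right₀ hn (by norm_num)
      _ = (‖k‖ ^ 2) ^ 2 := by ring
      _ ≤ (1 + xiSq k) ^ 2 := by gcongr; linarith

namespace L2Bd

variable {f g : Freq → ℂ} {C D : ℝ}

lemma nonneg (h : L2Bd f C) : 0 ≤ C := h.1

lemma weaken (h : L2Bd f C) (hCD : C ≤ D) : L2Bd f D :=
  ⟨h.1.trans hCD, fun S => (h.2 S).trans (by have := h.1; gcongr)⟩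

lemma of_le (h : L2Bd f C) {a : ℝ} (ha : 0 ≤ a) (hle : ∀ k, ‖g k‖ ≤ a * ‖f k‖) :
    L2Bd g (a * C) := by
  refine ⟨mul_nonneg ha h.1, fun S => ?_⟩
  calc ∑ k ∈ S, ‖g k‖ ^ 2 ≤ ∑ k ∈ S, a ^ 2 * ‖f k‖ ^ 2 := by
        refine Finset.sum_le_sum fun k _ => ?_
        rw [← mul_pow]; gcongr; exact hle k
    _ = a ^ 2 * ∑ k ∈ S, ‖f k‖ ^ 2 := by rw [Finset.mul_sum]
    _ ≤ a ^ 2 * C ^ 2 := by gcongr; exact h.2 S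
    _ = (a * C) ^ 2 := by ring

lemma mono (h : L2Bd f C) (hle : ∀ k, ‖g k‖ ≤ ‖f k‖) : L2Bd g C := by
  simpa using h.of_le zero_le_one (by simpa using hle)

lemma apply_le (h : L2Bd f C) (k : Freq) : ‖f k‖ ≤ C := by
  have := h.2 {k}
  rw [Finset.sum_singleton] at this
  exact (pow_le_pow_iff_left₀ (norm_nonneg _) h.1 two_ne_zero).mp this

/-- The restriction of a sequence to a finite set, as a Euclidean vector. -/
def restrict (S : Finset Freq) (f : Freq → ℂ) : EuclideanSpace ℂ S :=
  WithLp.toLp 2 fun k => f k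

lemma norm_restrict (S : Finset Freq) (f : Freq → ℂ) :
    ‖restrict S f‖ = Real.sqrt (∑ k ∈ S, ‖f k‖ ^ 2) := by
  rw [EuclideanSpace.norm_eq, ← Finset.sum_coe_sort S fun k => ‖f k‖ ^ 2]
  rfl

lemma iff_norm_restrict : L2Bd f C ↔ 0 ≤ C ∧ ∀ S, ‖restrict S f‖ ≤ C := by
  refine and_congr_right fun hC => forall_congr' fun S => ?_
  rw [norm_restrict, Real.sqrt_le_left hC]

lemma add (hf : L2Bd f C) (hg : L2Bd g D) : L2Bd (f + g) (C + D) := by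
  rw [iff_norm_restrict] at *
  refine ⟨add_nonneg hf.1 hg.1, fun S => ?_⟩
  have : restrict S (f + g) = restrict S f + restrict S g := rfl
  rw [this]
  exact (norm_add_le _ _).trans (add_le_add (hf.2 S) (hg.2 S))

lemma zero : L2Bd 0 0 := ⟨le_rfl, by simp⟩

lemma smul (c : ℂ) (hf : L2Bd f C) : L2Bd (c • f) (‖c‖ * C) :=
  hf.of_le (norm_nonneg c) fun k => by simp

lemma neg (hf : L2Bd f C) : L2Bd (-f) C := hf.mono fun k => by simp

lemma sub (hf : L2Bd f C) (hg : L2Bd g D) : L2Bd (f - g) (C + D) := by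
  rw [sub_eq_add_neg]; exact hf.add hg.neg

lemma sum {ι : Type*} (s : Finset ι) {f : ι → Freq → ℂ} {C : ι → ℝ}
    (h : ∀ i ∈ s, L2Bd (f i) (C i)) : L2Bd (∑ i ∈ s, f i) (∑ i ∈ s, C i) := by
  classical
  induction s using Finset.induction_on with
  | empty => simpa using zero
  | insert a s ha ih =>
    rw [Finset.sum_insert ha, Finset.sum_insert ha]
    exact (h a (by simp)).add (ih fun i hi => h i (by simp [hi]))

lemma memL2 (h : L2Bd f C) : MemL2 f :=
  summable_of_sum_le (fun _ => by positivity) h.2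

lemma l2Norm_le (h : L2Bd f C) : l2Norm f ≤ C := by
  rw [l2Norm, Real.sqrt_le_left h.1]
  exact h.memL2.tsum_le_of_sum_le h.2

lemma of_memL2 (h : MemL2 f) : L2Bd f (l2Norm f) := by
  refine ⟨Real.sqrt_nonneg _, fun S => ?_⟩
  rw [l2Norm, Real.sq_sqrt (tsum_nonneg fun _ => by positivity)]
  exact h.sum_le_tsum S fun _ _ => by positivity

/-- Minkowski's inequality for integrals. -/
lemma integral {h : ℝ → Freq → ℂ} {a : ℝ → ℝ} {s₁ s₂ : ℝ} (hs : s₁ ≤ s₂)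
    (hh : ∀ k, IntervalIntegrable (fun t => h t k) volume s₁ s₂)
    (ha : IntervalIntegrable a volume s₁ s₂) (hb : ∀ t ∈ Ioc s₁ s₂, L2Bd (h t) (a t)) :
    L2Bd (fun k => ∫ t in s₁..s₂, h t k) (∫ t in s₁..s₂, a t) := by
  rw [iff_norm_restrict]
  have hint : 0 ≤ ∫ t in s₁..s₂, a t := by
    rw [intervalIntegral.integral_of_le hs]
    exact setIntegral_nonneg measurableSet_Ioc fun t ht => (hb t ht).1
  refine ⟨hint, fun S => ?_⟩
  have hI : ∀ k, IntegrableOn (fun t => h t k) (Ioc s₁ s₂) := fun k =>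
    (intervalIntegrable_iff_integrableOn_Ioc_of_le hs).mp (hh k)
  have hpi : Integrable (fun t (k : S) => h t k) (volume.restrict (Ioc s₁ s₂)) :=
    Integrable.of_eval fun k => hI k
  have heq : restrict S (fun k => ∫ t in s₁..s₂, h t k) =
      ∫ t in Ioc s₁ s₂, restrict S (h t) := by
    have := ((EuclideanSpace.equiv S ℂ).symm : (S → ℂ) →L[ℂ] EuclideanSpace ℂ S).integral_comp_comm
      hpi
    refine Eq.trans ?_ this.symm
    refine congrArg (WithLp.toLp 2) ?_
    funext k
    rw [eval_integral (f := fun t (k : S) => h t k) fun k => hI k]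
    exact intervalIntegral.integral_of_le hs
  rw [heq, intervalIntegral.integral_of_le hs]
  refine norm_integral_le_of_norm_le ((intervalIntegrable_iff_integrableOn_Ioc_of_le hs).mp ha) ?_
  filter_upwards [ae_restrict_mem measurableSet_Ioc] with t ht
  exact (iff_norm_restrict.mp (hb t ht)).2 S

end L2Bd

namespace HBd

variable {f g : Freq → ℂ} {F G ρ ρ' : ℝ}

lemma nonneg (h : HBd ρ f F) : 0 ≤ F := h.1

lemma weaken (h : HBd ρ f F) (hFG : F ≤ G) : HBd ρ f G := L2Bd.weaken h hFG

lemma mono (h : HBd ρ f F) (hρ : ρ' ≤ ρ) : HBd ρ' f F := by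
  refine L2Bd.mono h fun k => ?_
  rw [norm_mul, norm_mul, Complex.norm_real, Complex.norm_real]
  refine mul_le_mul_of_nonneg_right ?_ (norm_nonneg _)
  have h1 := one_le_one_add_xiSq k
  rw [Real.norm_of_nonneg (by positivity), Real.norm_of_nonneg (by positivity)]
  exact Real.rpow_le_rpow_of_exponent_le h1 (by linarith)

lemma add (hf : HBd ρ f F) (hg : HBd ρ g G) : HBd ρ (f + g) (F + G) := by
  have := L2Bd.add hf hg
  refine this.mono fun k => le_of_eq ?_
  simp [mul_add]

lemma neg (hf : HBd ρ f F) : HBd ρ (-f) F := L2Bd.mono hf fun k => by simp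

lemma sub (hf : HBd ρ f F) (hg : HBd ρ g G) : HBd ρ (f - g) (F + G) := by
  rw [sub_eq_add_neg]; exact hf.add hg.neg

lemma smul (c : ℂ) (hf : HBd ρ f F) : HBd ρ (c • f) (‖c‖ * F) :=
  L2Bd.of_le hf (norm_nonneg c) fun k => le_of_eq (by simp; ring)

lemma zero : HBd ρ 0 0 := ⟨le_rfl, by simp⟩

lemma sum {ι : Type*} (s : Finset ι) {f : ι → Freq → ℂ} {C : ι → ℝ}
    (h : ∀ i ∈ s, HBd ρ (f i) (C i)) : HBd ρ (∑ i ∈ s, f i) (∑ i ∈ s, C i) := by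
  classical
  induction s using Finset.induction_on with
  | empty => simpa using zero
  | insert a s ha ih =>
    rw [Finset.sum_insert ha, Finset.sum_insert ha]
    exact (h a (by simp)).add (ih fun i hi => h i (by simp [hi]))

lemma zero_iff : HBd 0 f F ↔ L2Bd f F := by simp [HBd]

lemma apply_le (h : HBd ρ f F) (k : Freq) : ‖f k‖ ≤ F * (1 + xiSq k) ^ (-ρ / 2) := by
  have h1 := L2Bd.apply_le h k
  have h0 := one_add_xiSq_pos k
  rw [norm_mul, Complex.norm_real, Real.norm_of_nonneg (by positivity)] at h1
  rw [neg_div, Real.rpow_neg h0.le, ← div_eq_mul_inv, le_div_iff₀ (Real.rpow_pos_of_pos h0 _)]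
  linarith

lemma isDistribution (h : HBd ρ f F) : IsDistribution f := by
  obtain ⟨N, hN⟩ := exists_nat_ge (-ρ / 2)
  refine ⟨F, N, fun k => (h.apply_le k).trans ?_⟩
  have := h.nonneg
  refine mul_le_mul_of_nonneg_left ?_ this
  rw [← Real.rpow_natCast]
  exact Real.rpow_le_rpow_of_exponent_le (one_le_one_add_xiSq k) hN

lemma partialD (h : HBd ρ f F) (j : Fin 2) : HBd (ρ - 1) (partialD j f) F := by
  refine L2Bd.mono h fun k => ?_
  have h0 := one_add_xiSq_pos k
  have hx : |xi k j| ≤ (1 + xiSq k) ^ (1 / 2 : ℝ) := by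
    rw [← Real.sqrt_eq_rpow]
    apply Real.abs_le_sqrt
    unfold xiSq
    fin_cases j
    · simp only [Fin.zero_eta]; nlinarith [sq_nonneg (xi k 1)]
    · simp only [Fin.mk_one]; nlinarith [sq_nonneg (xi k 0)]
  simp only [MagneticLaplacian.partialD, norm_mul, Complex.norm_real, Complex.norm_I, one_mul]
  rw [Real.norm_of_nonneg (Real.rpow_nonneg h0.le _),
    Real.norm_of_nonneg (Real.rpow_nonneg h0.le _), ← mul_assoc]
  refine mul_le_mul_of_nonneg_right ?_ (norm_nonneg _)
  rw [show ρ / 2 = (ρ - 1) / 2 + 1 / 2 by ring, Real.rpow_add h0]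
  exact mul_le_mul_of_nonneg_left hx (Real.rpow_nonneg h0.le _)

end HBd

/-! ### Families of multipliers with Gaussian decay -/

/-- A family `σ_t` of Fourier multipliers with cancellation of order `N` that, as a function of
`x = t|ξ|²`, vanishes like `x^{N/2}` at `0` and decays faster than any power at infinity. -/
structure IsMult (N : ℕ) (σ : ℝ → Freq → ℂ) : Prop where
  cont : ∀ k, Continuous fun t => σ t k
  decay : ∀ M : ℕ, ∃ C, 0 ≤ C ∧ ∀ t, 0 < t → ∀ k,
    ‖σ t k‖ * (1 + t * xiSq k) ^ M ≤ C * Real.sqrt (t * xiSq k) ^ N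

lemma exists_pow_mul_exp_le (M : ℕ) :
    ∃ C : ℝ, 0 ≤ C ∧ ∀ x : ℝ, 0 ≤ x → (1 + x) ^ M * Real.exp (-x / 2) ≤ C := by
  refine ⟨2 ^ M * M.factorial * Real.exp (1 / 2), by positivity, fun x hx => ?_⟩
  have h := Real.pow_div_factorial_le_exp ((1 + x) / 2) (by positivity) M
  rw [div_pow, div_div, div_le_iff₀ (by positivity)] at h
  calc (1 + x) ^ M * Real.exp (-x / 2)
      ≤ (Real.exp ((1 + x) / 2) * (2 ^ M * M.factorial)) * Real.exp (-x / 2) := by gcongr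
    _ = 2 ^ M * M.factorial * (Real.exp ((1 + x) / 2) * Real.exp (-x / 2)) := by ring
    _ = 2 ^ M * M.factorial * Real.exp (1 / 2) := by
      rw [← Real.exp_add]; congr 2; ring

lemma heatP_nonneg (c : ℕ) {t : ℝ} (ht : 0 < t) (k : Freq) : 0 ≤ heatP c t k := by
  have := xiSq_nonneg k
  unfold heatP
  positivity

/-- Half of the Gaussian decay absorbs the polynomial factor of `P_t^{(c)}`. -/
lemma heatP_le (c : ℕ) {t : ℝ} (ht : 0 < t) (k : Freq) :
    heatP c t k ≤ 2 ^ c * Real.exp (-(t * xiSq k) / 2) := by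
  have hx : 0 ≤ t * xiSq k := mul_nonneg ht.le (xiSq_nonneg k)
  unfold heatP
  rw [neg_mul]
  set x := t * xiSq k
  have h1 : ∑ i ∈ Finset.range c, x ^ i / (i.factorial : ℝ) ≤ 2 ^ c * Real.exp (x / 2) := by
    refine le_trans ?_ (mul_le_mul_of_nonneg_left
      (Real.sum_le_exp_of_nonneg (by positivity : 0 ≤ x / 2) c) (by positivity))
    rw [Finset.mul_sum]
    refine Finset.sum_le_sum fun i hi => ?_
    have : (2 : ℝ) ^ i ≤ 2 ^ c := pow_le_pow_right₀ (by norm_num) (Finset.mem_range.mp hi).le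
    rw [div_pow, ← mul_div_assoc]
    gcongr
    rw [← mul_div_assoc, le_div_iff₀ (by positivity)]
    nlinarith [pow_nonneg hx i]
  calc _ ≤ (2 ^ c * Real.exp (x / 2)) * Real.exp (-x) := by gcongr
    _ = 2 ^ c * Real.exp (-x / 2) := by
      rw [mul_assoc, ← Real.exp_add]; congr 2; ring

lemma norm_gauss_le (I : Fin 2 → ℕ) (j c : ℕ) {t : ℝ} (ht : 0 < t) (k : Freq) :
    ‖gauss I j c t k‖ ≤ √(t * xiSq k) ^ (I 0 + I 1 + 2 * j) *
      (2 ^ c * Real.exp (-(t * xiSq k) / 2)) := by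
  have hx : 0 ≤ t * xiSq k := mul_nonneg ht.le (xiSq_nonneg k)
  have hi : ∀ i, √t * |xi k i| ≤ √(t * xiSq k) := by
    intro i
    rw [Real.sqrt_mul ht.le]
    gcongr
    apply Real.abs_le_sqrt
    unfold xiSq
    fin_cases i
    · simp only [Fin.zero_eta]; nlinarith [sq_nonneg (xi k 1)]
    · simp only [Fin.mk_one]; nlinarith [sq_nonneg (xi k 0)]
  have hP := heatP_nonneg c ht k
  refine le_trans ?_ (mul_le_mul_of_nonneg_left (heatP_le c ht k) (by positivity))
  unfold gauss
  rw [norm_mul, norm_mul, norm_pow, norm_pow, norm_mul, norm_mul, Complex.norm_I,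
    Complex.norm_real, Complex.norm_real, Complex.norm_real, one_mul, one_mul,
    norm_mul (√t), norm_mul (√t), Real.norm_of_nonneg (Real.sqrt_nonneg t),
    norm_mul _ (heatP c t k), Real.norm_of_nonneg hP, Real.norm_eq_abs, Real.norm_eq_abs,
    pow_add, pow_add, pow_mul, Real.sq_sqrt hx, Real.norm_of_nonneg (pow_nonneg hx j), ← mul_assoc]
  gcongr
  · exact hi 0
  · exact hi 1

lemma gauss_isMult (I : Fin 2 → ℕ) (j c : ℕ) : IsMult (I 0 + I 1 + 2 * j) (gauss I j c) := by
  constructor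
  · intro k
    unfold gauss heatP
    fun_prop
  · intro M
    obtain ⟨C, hC, h⟩ := exists_pow_mul_exp_le M
    refine ⟨2 ^ c * C, by positivity, fun t ht k => ?_⟩
    have hx : 0 ≤ t * xiSq k := mul_nonneg ht.le (xiSq_nonneg k)
    calc ‖gauss I j c t k‖ * (1 + t * xiSq k) ^ M
        ≤ (√(t * xiSq k) ^ (I 0 + I 1 + 2 * j) *
            (2 ^ c * Real.exp (-(t * xiSq k) / 2))) * (1 + t * xiSq k) ^ M := by
          gcongr
          exact norm_gauss_le I j c ht k
      _ = √(t * xiSq k) ^ (I 0 + I 1 + 2 * j) *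
            (2 ^ c * ((1 + t * xiSq k) ^ M * Real.exp (-(t * xiSq k) / 2))) := by ring
      _ ≤ √(t * xiSq k) ^ (I 0 + I 1 + 2 * j) * (2 ^ c * C) := by
          gcongr
          exact h _ hx
      _ = _ := by ring

namespace IsMult

variable {N : ℕ} {σ : ℝ → Freq → ℂ}

lemma mono (h : IsMult N σ) {N' : ℕ} (hN : N' ≤ N) : IsMult N' σ := by
  refine ⟨h.cont, fun M => ?_⟩
  obtain ⟨C, hC, hd⟩ := h.decay (M + N)
  refine ⟨C, hC, fun t ht k => ?_⟩
  have hx : 0 ≤ t * xiSq k := mul_nonneg ht.le (xiSq_nonneg k)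
  have h1 := hd t ht k
  have hs : Real.sqrt (t * xiSq k) ≤ 1 + t * xiSq k := by
    rw [Real.sqrt_le_left (by positivity)]; nlinarith
  have h2 : Real.sqrt (t * xiSq k) ^ (N - N') ≤ (1 + t * xiSq k) ^ N :=
    (pow_le_pow_left₀ (Real.sqrt_nonneg _) hs _).trans
      (pow_le_pow_right₀ (by linarith) (Nat.sub_le _ _))
  refine le_of_mul_le_mul_right ?_ (by positivity : 0 < (1 + t * xiSq k) ^ N)
  calc _ = ‖σ t k‖ * (1 + t * xiSq k) ^ (M + N) := by rw [pow_add]; ring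
    _ ≤ C * Real.sqrt (t * xiSq k) ^ N := h1
    _ = C * Real.sqrt (t * xiSq k) ^ N' * Real.sqrt (t * xiSq k) ^ (N - N') := by
        rw [mul_assoc, ← pow_add, Nat.add_sub_cancel' hN]
    _ ≤ _ := by gcongr

lemma smul (h : IsMult N σ) (c : ℂ) : IsMult N fun t k => c * σ t k := by
  refine ⟨fun k => continuous_const.mul (h.cont k), fun M => ?_⟩
  obtain ⟨C, hC, hd⟩ := h.decay M
  refine ⟨‖c‖ * C, by positivity, fun t ht k => ?_⟩
  rw [norm_mul, mul_assoc, mul_assoc]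
  exact mul_le_mul_of_nonneg_left (hd t ht k) (norm_nonneg c)

lemma apply_zero (h : IsMult N σ) (hN : 1 ≤ N) {t : ℝ} (ht : 0 < t) : σ t 0 = 0 := by
  obtain ⟨C, hC, hd⟩ := h.decay 0
  have := hd t ht 0
  rw [xiSq_zero, mul_zero, Real.sqrt_zero, zero_pow (by omega), mul_zero, pow_zero, mul_one] at this
  simpa using this

lemma exists_le (h : IsMult N σ) : ∃ C, 0 ≤ C ∧ ∀ t, 0 < t → ∀ k, ‖σ t k‖ ≤ C := by
  obtain ⟨C, hC, hd⟩ := (h.mono (Nat.zero_le N)).decay 0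
  exact ⟨C, hC, fun t ht k => by simpa using hd t ht k⟩

/-- Without cancellation, `σ_t` maps `H^ρ` to `L²` with norm `O(t^{ρ/2})` for `ρ ≤ 0`. -/
lemma exists_le_of_nonpos (h : IsMult N σ) : ∃ C, 0 ≤ C ∧ ∀ ρ t : ℝ, -1 ≤ ρ → ρ ≤ 0 → 0 < t →
    t ≤ 1 → ∀ k, ‖σ t k‖ ≤ C * (t ^ (ρ / 2) * (1 + xiSq k) ^ (ρ / 2)) := by
  obtain ⟨C, hC, hd⟩ := (h.mono (Nat.zero_le N)).decay 1
  refine ⟨C, hC, fun ρ t hρ hρ' ht ht' k => ?_⟩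
  have hk := xiSq_nonneg k
  have h1 := hd t ht k
  rw [pow_one, pow_zero, mul_one] at h1
  rw [← Real.mul_rpow ht.le (by positivity)]
  have hpos : 0 < t * (1 + xiSq k) := by positivity
  have hle : (t * (1 + xiSq k)) ^ (-(ρ / 2)) ≤ 1 + t * xiSq k := by
    calc (t * (1 + xiSq k)) ^ (-(ρ / 2)) ≤ (1 + t * xiSq k) ^ (-(ρ / 2)) := by
          apply Real.rpow_le_rpow hpos.le _ (by linarith)
          nlinarith
      _ ≤ (1 + t * xiSq k) ^ (1 : ℝ) :=
          Real.rpow_le_rpow_of_exponent_le (by nlinarith) (by linarith)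
      _ = _ := Real.rpow_one _
  rw [Real.rpow_neg hpos.le, inv_le_iff_one_le_mul₀' (Real.rpow_pos_of_pos hpos _)] at hle
  calc ‖σ t k‖ = ‖σ t k‖ * 1 := (mul_one _).symm
    _ ≤ ‖σ t k‖ * ((t * (1 + xiSq k)) ^ (ρ / 2) * (1 + t * xiSq k)) := by gcongr
    _ = (‖σ t k‖ * (1 + t * xiSq k)) * (t * (1 + xiSq k)) ^ (ρ / 2) := by ring
    _ ≤ _ := by gcongr

/-- With cancellation of order at least `2`, the multiplier is at most `x^e`, `x = t|ξ|²`, for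
every `0 ≤ e ≤ 1`. -/
lemma exists_le_rpow (h : IsMult N σ) (hN : 2 ≤ N) : ∃ C, 0 ≤ C ∧ ∀ e t : ℝ, 0 ≤ e → e ≤ 1 →
    0 < t → ∀ k, ‖σ t k‖ ≤ C * (t * xiSq k) ^ e := by
  obtain ⟨C, hC, hd⟩ := (h.mono hN).decay 1
  refine ⟨C, hC, fun e t he he' ht k => ?_⟩
  have hx : 0 ≤ t * xiSq k := mul_nonneg ht.le (xiSq_nonneg k)
  have h1 := hd t ht k
  rw [Real.sq_sqrt hx, pow_one] at h1
  generalize t * xiSq k = x at *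
  have hle : x ≤ x ^ e * (1 + x) := by
    rcases hx.eq_or_lt with rfl | hx'
    · simpa using Real.rpow_nonneg le_rfl e
    rcases le_total x 1 with h | h
    · have : x ≤ x ^ e := by
        simpa using Real.rpow_le_rpow_of_exponent_ge hx' h he'
      nlinarith [Real.rpow_nonneg hx e]
    · have : 1 ≤ x ^ e := Real.one_le_rpow h he
      nlinarith
  refine le_of_mul_le_mul_right (h1.trans ?_) (by positivity : 0 < 1 + x)
  rw [mul_assoc]
  gcongr

/-- With cancellation of order at least `2`, `σ_t` maps `H^ρ` to `L²` with norm `O(t^{ρ/2})` for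
`0 ≤ ρ ≤ 2`. -/
lemma exists_le_of_nonneg (h : IsMult N σ) (hN : 2 ≤ N) : ∃ C, 0 ≤ C ∧ ∀ ρ t : ℝ, 0 ≤ ρ → ρ ≤ 2 →
    0 < t → ∀ k, ‖σ t k‖ ≤ C * (t ^ (ρ / 2) * (1 + xiSq k) ^ (ρ / 2)) := by
  obtain ⟨C, hC, hd⟩ := h.exists_le_rpow hN
  refine ⟨C, hC, fun ρ t hρ hρ' ht k => (hd (ρ / 2) t (by linarith) (by linarith) ht k).trans ?_⟩
  have hk := xiSq_nonneg k
  rw [Real.mul_rpow ht.le hk]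
  gcongr
  linarith

/-- With cancellation of order at least `2`, `L⁻¹ σ_t` maps `L²` to `H^ρ` with norm
`O(t^{1-ρ/2})` for `0 ≤ ρ ≤ 2`. -/
lemma exists_inv_le (h : IsMult N σ) (hN : 2 ≤ N) : ∃ C, 0 ≤ C ∧ ∀ ρ t : ℝ, 0 ≤ ρ → ρ ≤ 2 →
    0 < t → ∀ k, (1 + xiSq k) ^ (ρ / 2) * ((xiSq k)⁻¹ * ‖σ t k‖) ≤ C * t ^ (1 - ρ / 2) := by
  obtain ⟨C, hC, hd⟩ := h.exists_le_rpow hN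
  refine ⟨2 * C, by positivity, fun ρ t hρ hρ' ht k => ?_⟩
  by_cases hk : k = 0
  · subst hk
    simp only [xiSq_zero, inv_zero, zero_mul, mul_zero]
    positivity
  have h1 := one_le_xiSq hk
  have h0 : 0 < xiSq k := by linarith
  have h2 := hd (1 - ρ / 2) t (by linarith) (by linarith) ht k
  have h3 : (1 + xiSq k) ^ (ρ / 2) ≤ 2 * xiSq k ^ (ρ / 2) := by
    calc (1 + xiSq k) ^ (ρ / 2) ≤ (2 * xiSq k) ^ (ρ / 2) :=
          Real.rpow_le_rpow (by positivity) (by linarith) (by linarith)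
      _ = 2 ^ (ρ / 2) * xiSq k ^ (ρ / 2) := Real.mul_rpow (by norm_num) h0.le
      _ ≤ 2 ^ (1 : ℝ) * xiSq k ^ (ρ / 2) := by
          gcongr
          · norm_num
          · linarith
      _ = _ := by rw [Real.rpow_one]
  calc _ ≤ (2 * xiSq k ^ (ρ / 2)) * ((xiSq k)⁻¹ * (C * (t * xiSq k) ^ (1 - ρ / 2))) := by gcongr
    _ = 2 * C * t ^ (1 - ρ / 2) *
        (xiSq k ^ (ρ / 2) * xiSq k ^ (1 - ρ / 2) * (xiSq k)⁻¹) := by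
        rw [Real.mul_rpow ht.le h0.le]; ring
    _ = _ := by
        rw [← Real.rpow_add h0, show ρ / 2 + (1 - ρ / 2) = 1 by ring, Real.rpow_one,
          mul_inv_cancel₀ h0.ne', mul_one]

/-- Applied to a distribution, `σ_t` has absolutely summable coefficients, uniformly for `t`
bounded below. -/
lemma exists_summable (h : IsMult N σ) {f : Freq → ℂ} (hf : IsDistribution f) {t₀ : ℝ}
    (ht₀ : 0 < t₀) : ∃ u : Freq → ℝ, Summable u ∧ ∀ t, t₀ ≤ t → ∀ k, ‖(σ t * f) k‖ ≤ u k := by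
  obtain ⟨A, m, hA⟩ := hf
  obtain ⟨C, hC, hd⟩ := (h.mono (Nat.zero_le N)).decay (m + 2)
  set r := min t₀ 1
  have hr : 0 < r := lt_min ht₀ one_pos
  refine ⟨fun k => (C * A / r ^ (m + 2)) * ((1 + xiSq k) ^ 2)⁻¹,
    summable_one_add_xiSq.mul_left _, fun t ht k => ?_⟩
  have h1 := hd t (ht₀.trans_le ht) k
  rw [pow_zero, mul_one] at h1
  have hk := xiSq_nonneg k
  have h0 := one_add_xiSq_pos k
  have hle : r * (1 + xiSq k) ≤ 1 + t * xiSq k := by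
    have : r ≤ t := (min_le_left _ _).trans ht
    have : r ≤ 1 := min_le_right _ _
    nlinarith
  have h2 : ‖σ t k‖ * (r * (1 + xiSq k)) ^ (m + 2) ≤ C :=
    le_trans (by gcongr) h1
  simp only [Pi.mul_apply, norm_mul]
  rw [← div_eq_mul_inv, div_div, le_div_iff₀ (by positivity)]
  calc ‖σ t k‖ * ‖f k‖ * (r ^ (m + 2) * (1 + xiSq k) ^ 2)
      ≤ ‖σ t k‖ * (A * (1 + xiSq k) ^ m) * (r ^ (m + 2) * (1 + xiSq k) ^ 2) := by
        gcongr; exact hA k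
    _ = (‖σ t k‖ * (r * (1 + xiSq k)) ^ (m + 2)) * A := by rw [mul_pow]; ring
    _ ≤ C * A := by
        refine mul_le_mul_of_nonneg_right h2 ?_
        have := (norm_nonneg _).trans (hA k)
        exact nonneg_of_mul_nonneg_left this (by positivity)

lemma summable (h : IsMult N σ) {f : Freq → ℂ} (hf : IsDistribution f) {t : ℝ} (ht : 0 < t) :
    Summable (σ t * f) := by
  obtain ⟨u, hu, hle⟩ := h.exists_summable hf ht
  exact Summable.of_norm_bounded hu (hle t le_rfl)

end IsMult

lemma halfQ_isMult (n : ℕ) : IsMult (2 * n) (halfQ n) := by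
  have := (gauss_isMult 0 n 1).smul ((((2 * n - 1).factorial : ℕ) : ℂ)⁻¹)
  simp only [Pi.zero_apply, add_zero, zero_add] at this
  exact this

lemma gauss_isMult_pair (p q c : ℕ) : IsMult (p + q) (gauss ![p, q] 0 c) := by
  simpa using gauss_isMult ![p, q] 0 c

/-! ### Fourier series on the torus -/

section Fourier

open UnitAddTorus

/-- Mathlib states its results on Fourier series of several variables for the Haar probability
measure on the circle, installed as a local instance; `torusMeasure` is the resulting `volume`. -/
local instance circleMeasureSpace : MeasureSpace UnitAddCircle := ⟨AddCircle.haarAddCircle⟩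

local instance circleIsProbabilityMeasure : IsProbabilityMeasure (volume : Measure UnitAddCircle) :=
  inferInstanceAs (IsProbabilityMeasure AddCircle.haarAddCircle)

lemma norm_mFourier_apply (k : Freq) (x : Torus) : ‖mFourier k x‖ = 1 := by
  simp only [mFourier, ContinuousMap.coe_mk, fourier_apply, norm_prod, Circle.norm_coe,
    Finset.prod_const_one]

/-- An absolutely summable family of Fourier coefficients, as a continuous function. -/
def toCont (F : Freq → ℂ) : C(Torus, ℂ) := ∑' k, F k • mFourier k

lemma hasSum_toCont {F : Freq → ℂ} (hF : Summable F) :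
    HasSum (fun k => F k • mFourier k) (toCont F) := by
  refine Summable.hasSum (Summable.of_norm ?_)
  simpa only [norm_smul, mFourier_norm, mul_one] using hF.norm

lemma hasSum_toFun {F : Freq → ℂ} (hF : Summable F) (x : Torus) :
    HasSum (fun k => F k * mFourier k x) (toFun F x) := by
  refine Summable.hasSum (Summable.of_norm ?_)
  simpa only [norm_mul, norm_mFourier_apply, mul_one] using hF.norm

lemma toCont_apply {F : Freq → ℂ} (hF : Summable F) (x : Torus) : toCont F x = toFun F x := by
  have := (ContinuousMap.evalCLM ℂ x).hasSum (hasSum_toCont hF)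
  exact this.unique (hasSum_toFun hF x)

lemma norm_toFun_le {F : Freq → ℂ} {u : Freq → ℝ} (hu : Summable u) (h : ∀ k, ‖F k‖ ≤ u k)
    (x : Torus) : ‖toFun F x‖ ≤ ∑' k, u k := by
  refine tsum_of_norm_bounded hu.hasSum fun k => ?_
  rw [norm_mul, norm_mFourier_apply, mul_one]
  exact h k

lemma toFun_add {F G : Freq → ℂ} (hF : Summable F) (hG : Summable G) (x : Torus) :
    toFun (F + G) x = toFun F x + toFun G x := by
  refine HasSum.tsum_eq ?_
  simpa [add_mul] using (hasSum_toFun hF x).add (hasSum_toFun hG x)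

lemma toFun_smul (c : ℂ) (F : Freq → ℂ) (x : Torus) :
    toFun (c • F) x = c * toFun F x := by
  simp only [toFun, Pi.smul_apply, smul_eq_mul, mul_assoc, tsum_mul_left]

lemma toFun_neg (F : Freq → ℂ) (x : Torus) : toFun (-F) x = -toFun F x := by
  simpa using toFun_smul (-1) F x

lemma coeff_eq_repr (u : L2T) (k : Freq) : coeff u k = mFourierBasis.repr u k :=
  (mFourierBasis_repr u k).symm

lemma coeff_add (u v : L2T) : coeff (u + v) = coeff u + coeff v := by
  funext k
  simp only [Pi.add_apply, coeff_eq_repr]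
  exact congrFun (congrArg _ (map_add mFourierBasis.repr u v)) k

lemma coeff_smul (c : ℂ) (u : L2T) : coeff (c • u) = c • coeff u := by
  funext k
  simp only [Pi.smul_apply, coeff_eq_repr]
  exact congrFun (congrArg _ (map_smul mFourierBasis.repr c u)) k

lemma coeff_injective : Function.Injective coeff := by
  intro u v h
  apply mFourierBasis.repr.injective
  ext k
  rw [← coeff_eq_repr, ← coeff_eq_repr, h]

lemma exists_coeff_eq {f : Freq → ℂ} (hf : MemL2 f) : ∃ u : L2T, coeff u = f := by
  have hm : Memℓp f 2 := by
    refine memℓp_gen ?_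
    simpa [MemL2] using hf
  refine ⟨mFourierBasis.repr.symm ⟨f, hm⟩, ?_⟩
  funext k
  rw [coeff_eq_repr, LinearIsometryEquiv.apply_symm_apply]

lemma hasSum_norm_sq_coeff (u : L2T) : HasSum (fun k => ‖coeff u k‖ ^ 2) (‖u‖ ^ 2) := by
  have h := lp.hasSum_norm (p := 2) (by norm_num) (mFourierBasis.repr u)
  simp only [ENNReal.toReal_ofNat, Real.rpow_ofNat, LinearIsometryEquiv.norm_map] at h
  exact h.congr_fun fun k => by rw [coeff_eq_repr]

lemma l2Norm_coeff (u : L2T) : l2Norm (coeff u) = ‖u‖ := by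
  rw [l2Norm, (hasSum_norm_sq_coeff u).tsum_eq, Real.sqrt_sq (norm_nonneg _)]

lemma l2Bd_coeff (u : L2T) : L2Bd (coeff u) ‖u‖ := by
  rw [← l2Norm_coeff]
  exact L2Bd.of_memL2 (hasSum_norm_sq_coeff u).summable

lemma mFourierCoeff_toCont {F : Freq → ℂ} (hF : Summable F) (k : Freq) :
    mFourierCoeff (toCont F) k = F k := by
  have h1 := (ContinuousMap.toLp (E := ℂ) 2 (volume : Measure Torus) ℂ).hasSum (hasSum_toCont hF)
  have hm : Memℓp F 2 := by
    refine Memℓp.of_exponent_ge (q := 1) (memℓp_gen ?_) (by norm_num)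
    simpa using hF.norm
  have h2 := mFourierBasis.hasSum_repr_symm ⟨F, hm⟩
  have h3 : ContinuousMap.toLp (E := ℂ) 2 (volume : Measure Torus) ℂ (toCont F) =
      mFourierBasis.repr.symm ⟨F, hm⟩ := by
    refine h1.unique (h2.congr_fun fun k => ?_)
    simp
  rw [← mFourierCoeff_toLp, ← mFourierBasis_repr, h3, LinearIsometryEquiv.apply_symm_apply]

lemma prodCoeff_eq {F G : Freq → ℂ} (hF : Summable F) (hG : Summable G) (k : Freq) :
    prodCoeff F G k = mFourierCoeff (toCont F * toCont G : C(Torus, ℂ)) k := by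
  unfold prodCoeff
  congr 1
  funext x
  rw [ContinuousMap.mul_apply, toCont_apply hF, toCont_apply hG]

/-- Parseval's identity, for the function with absolutely summable coefficients `F`. -/
lemma integral_norm_sq_toCont_le {F : Freq → ℂ} {C : ℝ} (hF : Summable F) (h : L2Bd F C) :
    ∫ x : Torus, ‖toCont F x‖ ^ 2 ≤ C ^ 2 := by
  have h1 := hasSum_sq_mFourierCoeff (ContinuousMap.toLp (E := ℂ) 2 (volume : Measure Torus) ℂ
    (toCont F))
  simp only [mFourierCoeff_toLp, mFourierCoeff_toCont hF] at h1
  have h2 : ∫ x : Torus, ‖ContinuousMap.toLp (E := ℂ) 2 (volume : Measure Torus) ℂ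
      (toCont F) x‖ ^ 2 = ∫ x : Torus, ‖toCont F x‖ ^ 2 := by
    refine integral_congr_ae ?_
    filter_upwards [ContinuousMap.coeFn_toLp (E := ℂ) (p := 2) (𝕜 := ℂ)
      (volume : Measure Torus) (toCont F)] with x hx
    rw [hx]
  rw [← h2]
  exact hasSum_le_of_sum_le h1 h.2

/-- The coefficients of a product are square summable when one factor is in `L²` and the other
one is bounded. -/
lemma l2Bd_prodCoeff {F G : Freq → ℂ} {C D : ℝ} (hF : Summable F) (hG : Summable G)
    (hFC : L2Bd F C) (hD : ∀ x, ‖toFun G x‖ ≤ D) : L2Bd (prodCoeff F G) (C * D) := by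
  have hD0 : 0 ≤ D := (norm_nonneg _).trans (hD 0)
  refine ⟨mul_nonneg hFC.1 hD0, fun S => ?_⟩
  have h1 := hasSum_sq_mFourierCoeff (ContinuousMap.toLp (E := ℂ) 2 (volume : Measure Torus) ℂ
    (toCont F * toCont G))
  simp only [mFourierCoeff_toLp, ← prodCoeff_eq hF hG] at h1
  refine (sum_le_hasSum S (fun _ _ => by positivity) h1).trans ?_
  calc _ = ∫ x : Torus, ‖(toCont F * toCont G) x‖ ^ 2 := by
        refine integral_congr_ae ?_
        filter_upwards [ContinuousMap.coeFn_toLp (E := ℂ) (p := 2) (𝕜 := ℂ)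
          (volume : Measure Torus) (toCont F * toCont G)] with x hx
        rw [hx]
    _ ≤ ∫ x : Torus, D ^ 2 * ‖toCont F x‖ ^ 2 := by
        refine integral_mono (Continuous.integrable_of_hasCompactSupport (by fun_prop)
          (HasCompactSupport.of_compactSpace _))
          (Continuous.integrable_of_hasCompactSupport (by fun_prop)
          (HasCompactSupport.of_compactSpace _)) fun x => ?_
        simp only [ContinuousMap.mul_apply, norm_mul]
        rw [← mul_pow, toCont_apply hG, mul_comm]
        gcongr
        exact hD x
    _ = D ^ 2 * ∫ x : Torus, ‖toCont F x‖ ^ 2 := integral_const_mul _ _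
    _ ≤ D ^ 2 * C ^ 2 := by gcongr; exact integral_norm_sq_toCont_le hF hFC
    _ = (C * D) ^ 2 := by ring

lemma prodCoeff_comm (F G : Freq → ℂ) : prodCoeff F G = prodCoeff G F := by
  funext k
  simp only [prodCoeff, mul_comm]

lemma integrable_of_continuous (h : C(Torus, ℂ)) :
    Integrable (fun x => h x) (volume : Measure Torus) :=
  Continuous.integrable_of_hasCompactSupport (by fun_prop) (HasCompactSupport.of_compactSpace _)

lemma prodCoeff_smul_add (c : ℂ) {F F' G : Freq → ℂ} (hF : Summable F) (hF' : Summable F')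
    (hG : Summable G) :
    prodCoeff (c • F + F') G = c • prodCoeff F G + prodCoeff F' G := by
  funext k
  have hcF : Summable (c • F) := hF.const_smul c
  have hs : Summable (c • F + F') := hcF.add hF'
  simp only [Pi.add_apply, Pi.smul_apply, smul_eq_mul]
  rw [prodCoeff_eq hs hG, prodCoeff_eq hF hG, prodCoeff_eq hF' hG]
  unfold mFourierCoeff
  rw [← integral_const_mul, ← integral_add]
  · congr 1
    funext x
    simp only [ContinuousMap.mul_apply, toCont_apply hs, toCont_apply hF,
      toCont_apply hF', toFun_add hcF hF', toFun_smul, smul_eq_mul]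
    ring
  · exact (integrable_of_continuous (mFourier (-k) * (toCont F * toCont G))).const_mul c
  · exact integrable_of_continuous (mFourier (-k) * (toCont F' * toCont G))

lemma norm_coeff_le_of_toFun_le {F : Freq → ℂ} (hF : Summable F) {D : ℝ}
    (hD : ∀ x, ‖toFun F x‖ ≤ D) (k : Freq) : ‖F k‖ ≤ D := by
  rw [← mFourierCoeff_toCont hF k]
  unfold mFourierCoeff
  refine (norm_integral_le_of_norm_le_const (C := D) (.of_forall fun x => ?_)).trans ?_
  · rw [norm_smul, norm_mFourier_apply, one_mul, toCont_apply hF]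
    exact hD x
  · simp

lemma continuousOn_toFun {N : ℕ} {σ : ℝ → Freq → ℂ} (hσ : IsMult N σ) {f : Freq → ℂ}
    (hf : IsDistribution f) {t₀ : ℝ} (ht₀ : 0 < t₀) (x : Torus) :
    ContinuousOn (fun t => toFun (σ t * f) x) (Ici t₀) := by
  obtain ⟨u, hu, hle⟩ := hσ.exists_summable hf ht₀
  refine continuousOn_tsum (fun k => ?_) hu fun k t ht => ?_
  · exact (((hσ.cont k).mul continuous_const).mul continuous_const).continuousOn
  · rw [norm_mul, norm_mFourier_apply, mul_one]
    exact hle t ht k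

/-- The integrands of paraproducts are continuous in `t`. -/
lemma continuousOn_prodCoeff {N N' : ℕ} {σ τ : ℝ → Freq → ℂ} (hσ : IsMult N σ) (hτ : IsMult N' τ)
    {f g : Freq → ℂ} (hf : IsDistribution f) (hg : IsDistribution g) (k : Freq) :
    ContinuousOn (fun t => prodCoeff (σ t * f) (τ t * g) k) (Ioi 0) := by
  have key : ∀ t₀ : ℝ, 0 < t₀ →
      ContinuousOn (fun t => prodCoeff (σ t * f) (τ t * g) k) (Ici t₀) := by
    intro t₀ ht₀
    obtain ⟨u, hu, hle⟩ := hσ.exists_summable hf ht₀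
    obtain ⟨v, hv, hle'⟩ := hτ.exists_summable hg ht₀
    refine continuousOn_of_dominated (bound := fun _ => (∑' k, u k) * ∑' k, v k)
      (fun t ht => ?_) (fun t ht => ?_) (integrable_const _) (.of_forall fun x => ?_)
    · have h0 : 0 < t := ht₀.trans_le ht
      have := (integrable_of_continuous (mFourier (-k) * (toCont (σ t * f) *
        toCont (τ t * g)))).aestronglyMeasurable
      refine this.congr (.of_forall fun x => ?_)
      simp only [ContinuousMap.mul_apply, toCont_apply (hσ.summable hf h0),
        toCont_apply (hτ.summable hg h0), smul_eq_mul]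
    · refine .of_forall fun x => ?_
      rw [norm_smul, norm_mFourier_apply, one_mul, norm_mul]
      have h1 := norm_toFun_le hu (hle t ht) x
      have h2 := norm_toFun_le hv (hle' t ht) x
      exact mul_le_mul h1 h2 (norm_nonneg _) ((norm_nonneg _).trans h1)
    · exact ((continuousOn_toFun hσ hf ht₀ x).mul
        (continuousOn_toFun hτ hg ht₀ x)).const_smul (mFourier (-k) x)
  intro t ht
  have ht' : (0 : ℝ) < t := ht
  exact ((key (t / 2) (half_pos ht')).continuousAt
    (Ici_mem_nhds (half_lt_self ht'))).continuousWithinAt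

end Fourier

/-! ### Estimates on a single block -/

/-- The standard Gaussian operators with cancellation of order between `1` and `4n` satisfy the
bounds that characterise membership of `g` in `𝓒^γ` with norm at most `K`. -/
structure HighBd (n : ℕ) (γ K : ℝ) (g : Freq → ℂ) : Prop where
  nonneg : 0 ≤ K
  dist : IsDistribution g
  bd : ∀ (I : Fin 2 → ℕ) (j c : ℕ), 1 ≤ I 0 + I 1 + 2 * j → I 0 + I 1 + 2 * j ≤ 4 * n → 1 ≤ c →
    c ≤ 2 * n → ∀ t : ℝ, 0 < t → t ≤ 1 → ∀ x, ‖toFun (gauss I j c t * g) x‖ ≤ K * t ^ (γ / 2)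

/-- As `HighBd`, with the bound also for the operators `P_t` without cancellation. -/
structure FullBd (n : ℕ) (γ K : ℝ) (g : Freq → ℂ) : Prop extends HighBd n γ K g where
  bd_zero : ∀ t : ℝ, 0 < t → t ≤ 1 → ∀ x, ‖toFun (gauss 0 0 (2 * n) t * g) x‖ ≤ K * t ^ (γ / 2)

/-- The operators `σ_t` map distributions in the class `𝒢 γ K` to functions with `L^∞` norm
`O(K t^{γ/2})`. -/
def SupOk (𝒢 : ℝ → ℝ → (Freq → ℂ) → Prop) (σ : ℝ → Freq → ℂ) : Prop :=
  ∃ C : ℝ, 0 ≤ C ∧ ∀ γ K g, 𝒢 γ K g → ∀ t : ℝ, 0 < t → t ≤ 1 → ∀ x,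
    ‖toFun (σ t * g) x‖ ≤ C * K * t ^ (γ / 2)

lemma SupOk.mono {𝒢 𝒢' : ℝ → ℝ → (Freq → ℂ) → Prop} {σ : ℝ → Freq → ℂ} (h : SupOk 𝒢 σ)
    (h𝒢 : ∀ γ K g, 𝒢' γ K g → 𝒢 γ K g) : SupOk 𝒢' σ := by
  obtain ⟨C, hC, h⟩ := h
  exact ⟨C, hC, fun γ K g hg => h γ K g (h𝒢 γ K g hg)⟩

lemma supOk_gauss {n : ℕ} (hn : 1 ≤ n) {p q : ℕ} (h1 : 1 ≤ p + q) (h2 : p + q ≤ 4 * n) :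
    SupOk (HighBd n) (gauss ![p, q] 0 (2 * n)) :=
  ⟨1, zero_le_one, fun γ K g hg t ht ht' x => by
    rw [one_mul]
    exact hg.bd ![p, q] 0 (2 * n) (by simpa using h1) (by simpa using h2) (by omega) le_rfl t ht
      ht' x⟩

lemma supOk_gauss_full {n : ℕ} (hn : 1 ≤ n) {p q : ℕ} (h2 : p + q ≤ 4 * n) :
    SupOk (FullBd n) (gauss ![p, q] 0 (2 * n)) := by
  rcases Nat.eq_zero_or_pos (p + q) with h | h
  · obtain ⟨rfl, rfl⟩ : p = 0 ∧ q = 0 := by omega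
    refine ⟨1, zero_le_one, fun γ K g hg t ht ht' x => ?_⟩
    rw [one_mul, show (![0, 0] : Fin 2 → ℕ) = 0 by ext i; fin_cases i <;> rfl]
    exact hg.bd_zero t ht ht' x
  · exact (supOk_gauss hn h h2).mono fun γ K g hg => hg.toHighBd

lemma supOk_halfQ {n : ℕ} (hn : 1 ≤ n) : SupOk (HighBd n) (halfQ n) := by
  refine ⟨‖(((2 * n - 1).factorial : ℕ) : ℂ)⁻¹‖, norm_nonneg _, fun γ K g hg t ht ht' x => ?_⟩
  have h := hg.bd 0 n 1 (by simp; omega) (by simp; omega) le_rfl (by omega) t ht ht' x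
  have h2 : halfQ n t * g = (((2 * n - 1).factorial : ℕ) : ℂ)⁻¹ • (gauss 0 n 1 t * g) := by
    funext k; simp [halfQ, mul_assoc]
  rw [h2, toFun_smul, norm_mul, mul_assoc]
  exact mul_le_mul_of_nonneg_left h (norm_nonneg _)

/-- The integrand of `block`. -/
def kern (σ₁ σ₂ σ₃ : ℝ → Freq → ℂ) (f g : Freq → ℂ) (t : ℝ) : Freq → ℂ := fun k =>
  (t : ℂ)⁻¹ * (σ₁ t k * prodCoeff (σ₂ t * f) (σ₃ t * g) k)

lemma block_apply (s : ℝ) (σ₁ σ₂ σ₃ : ℝ → Freq → ℂ) (f g : Freq → ℂ) (k : Freq) :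
    block s σ₁ σ₂ σ₃ f g k = ∫ t in (0 : ℝ)..s, kern σ₁ σ₂ σ₃ f g t k := rfl

lemma block_comm (s : ℝ) (σ₁ σ₂ σ₃ : ℝ → Freq → ℂ) (f g : Freq → ℂ) :
    block s σ₁ σ₂ σ₃ f g = block s σ₁ σ₃ σ₂ g f := by
  funext k
  simp only [block, prodCoeff_comm]

lemma intervalIntegrable_rpow_of_le {e s₁ s₂ : ℝ} (h₁ : 0 ≤ s₁) (h₁₂ : s₁ ≤ s₂)
    (he : s₁ = 0 → 0 < e) : IntervalIntegrable (fun t : ℝ => t ^ (e - 1)) volume s₁ s₂ := by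
  rcases h₁.eq_or_lt with rfl | h
  · exact intervalIntegral.intervalIntegrable_rpow' (by linarith [he rfl])
  · refine intervalIntegral.intervalIntegrable_rpow (Or.inr ?_)
    rw [uIcc_of_le h₁₂]
    exact fun h' => absurd h'.1 (not_le.mpr h)

lemma intervalIntegrable_of_le_rpow {h : ℝ → ℂ} (hc : ContinuousOn h (Ioi 0)) {B e s₁ s₂ : ℝ}
    (h₁ : 0 ≤ s₁) (h₁₂ : s₁ ≤ s₂) (he : s₁ = 0 → 0 < e)
    (hle : ∀ t, 0 < t → t ≤ s₂ → ‖h t‖ ≤ B * t ^ (e - 1)) :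
    IntervalIntegrable h volume s₁ s₂ := by
  refine IntervalIntegrable.mono_fun' ((intervalIntegrable_rpow_of_le h₁ h₁₂ he).const_mul B) ?_ ?_
  · rw [uIoc_of_le h₁₂]
    exact (hc.mono fun t ht => h₁.trans_lt ht.1).aestronglyMeasurable measurableSet_Ioc
  · rw [uIoc_of_le h₁₂]
    filter_upwards [ae_restrict_mem measurableSet_Ioc] with t ht
    exact hle t (h₁.trans_lt ht.1) ht.2

section Kern

variable {N₁ N₂ N₃ : ℕ} {σ₁ σ₂ σ₃ : ℝ → Freq → ℂ}

lemma continuousOn_kern (h₁ : IsMult N₁ σ₁) (h₂ : IsMult N₂ σ₂) (h₃ : IsMult N₃ σ₃)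
    {f g : Freq → ℂ} (hf : IsDistribution f) (hg : IsDistribution g) (k : Freq) :
    ContinuousOn (fun t => kern σ₁ σ₂ σ₃ f g t k) (Ioi 0) := by
  refine ContinuousOn.mul ?_ ((h₁.cont k).continuousOn.mul (continuousOn_prodCoeff h₂ h₃ hf hg k))
  refine ContinuousOn.inv₀ (Complex.continuous_ofReal.continuousOn) fun t ht => ?_
  exact_mod_cast (ne_of_gt ht)

lemma kern_smul_add (h₂ : IsMult N₂ σ₂) (h₃ : IsMult N₃ σ₃)
    {f f' g : Freq → ℂ} (hf : IsDistribution f) (hf' : IsDistribution f') (hg : IsDistribution g)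
    (c : ℂ) {t : ℝ} (ht : 0 < t) (k : Freq) :
    kern σ₁ σ₂ σ₃ (c • f + f') g t k = c * kern σ₁ σ₂ σ₃ f g t k + kern σ₁ σ₂ σ₃ f' g t k := by
  unfold kern
  rw [mul_add, mul_smul_comm, prodCoeff_smul_add c (h₂.summable hf ht) (h₂.summable hf' ht)
    (h₃.summable hg ht)]
  simp only [Pi.add_apply, Pi.smul_apply, smul_eq_mul]
  ring

lemma block_smul_add (h₂ : IsMult N₂ σ₂) (h₃ : IsMult N₃ σ₃)
    {f f' g : Freq → ℂ} (hf : IsDistribution f) (hf' : IsDistribution f') (hg : IsDistribution g)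
    (c : ℂ) {s : ℝ} (hs : 0 ≤ s)
    (hi : ∀ k, IntervalIntegrable (fun t => kern σ₁ σ₂ σ₃ f g t k) volume 0 s)
    (hi' : ∀ k, IntervalIntegrable (fun t => kern σ₁ σ₂ σ₃ f' g t k) volume 0 s) :
    block s σ₁ σ₂ σ₃ (c • f + f') g = c • block s σ₁ σ₂ σ₃ f g + block s σ₁ σ₂ σ₃ f' g := by
  funext k
  simp only [Pi.add_apply, Pi.smul_apply, smul_eq_mul, block_apply]
  rw [← intervalIntegral.integral_const_mul, ← intervalIntegral.integral_add
    ((hi k).const_mul c) (hi' k)]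
  refine intervalIntegral.integral_congr_ae (.of_forall fun t ht => ?_)
  rw [uIoc_of_le hs] at ht
  exact kern_smul_add h₂ h₃ hf hf' hg c ht.1 k

end Kern

/-! ### The intertwined paraproducts -/

section KernPara

variable {N₁ N₂ N₃ n : ℕ} {σ₁ σ₂ σ₃ : ℝ → Freq → ℂ}

/-- Hölder, with `σ₂_t f` in `L²` and `σ₃_t g` in `L^∞`. -/
lemma kern_para_bd (h₁ : IsMult N₁ σ₁) (hN₁ : 2 ≤ N₁) (h₂ : IsMult N₂ σ₂) (h₃ : IsMult N₃ σ₃)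
    (hs : SupOk (HighBd n) σ₃) : ∃ C : ℝ, 0 ≤ C ∧ ∀ (f g : Freq → ℂ) (ρ γ σ F K t : ℝ),
      -1 ≤ ρ → ρ ≤ 0 → 0 ≤ σ → σ ≤ 2 → HBd ρ f F → HighBd n γ K g → 0 < t → t ≤ 1 →
      HBd σ (fun k => (xiSq k : ℂ)⁻¹ * kern σ₁ σ₂ σ₃ f g t k)
        (C * (F * K) * t ^ ((2 - σ + ρ + γ) / 2 - 1)) := by
  obtain ⟨C₁, hC₁, h1⟩ := h₁.exists_inv_le hN₁
  obtain ⟨C₂, hC₂, h2⟩ := h₂.exists_le_of_nonpos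
  obtain ⟨C₃, hC₃, h3⟩ := hs
  refine ⟨C₁ * C₂ * C₃, by positivity, fun f g ρ γ σ F K t hρ hρ' hσ hσ' hf hg ht ht' => ?_⟩
  have ha : L2Bd (σ₂ t * f) (C₂ * t ^ (ρ / 2) * F) := by
    refine L2Bd.of_le hf (by positivity) fun k => ?_
    have h0 := one_add_xiSq_pos k
    rw [Pi.mul_apply, norm_mul, norm_mul, Complex.norm_real,
      Real.norm_of_nonneg (Real.rpow_nonneg h0.le _), ← mul_assoc]
    refine mul_le_mul_of_nonneg_right ?_ (norm_nonneg _)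
    simpa [mul_assoc] using h2 ρ t hρ hρ' ht ht' k
  have hb := l2Bd_prodCoeff (h₂.summable hf.isDistribution ht) (h₃.summable hg.dist ht) ha
    (h3 γ K g hg t ht ht')
  have hc : HBd σ (fun k => (xiSq k : ℂ)⁻¹ * kern σ₁ σ₂ σ₃ f g t k)
      (t⁻¹ * (C₁ * t ^ (1 - σ / 2)) * (C₂ * t ^ (ρ / 2) * F * (C₃ * K * t ^ (γ / 2)))) := by
    refine L2Bd.of_le hb (by positivity) fun k => ?_
    have h0 := one_add_xiSq_pos k
    have hk := xiSq_nonneg k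
    simp only [kern, norm_mul, norm_inv, Complex.norm_real]
    rw [Real.norm_of_nonneg (Real.rpow_nonneg h0.le _), Real.norm_of_nonneg hk,
      Real.norm_of_nonneg ht.le]
    calc _ = t⁻¹ * ((1 + xiSq k) ^ (σ / 2) * ((xiSq k)⁻¹ * ‖σ₁ t k‖)) *
          ‖prodCoeff (σ₂ t * f) (σ₃ t * g) k‖ := by ring
      _ ≤ _ := mul_le_mul_of_nonneg_right (mul_le_mul_of_nonneg_left (h1 σ t hσ hσ' ht k)
        (inv_nonneg.mpr ht.le)) (norm_nonneg _)
  refine hc.weaken (le_of_eq ?_)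
  have he : t ^ ((2 - σ + ρ + γ) / 2 - 1) =
      t⁻¹ * (t ^ (1 - σ / 2) * (t ^ (ρ / 2) * t ^ (γ / 2))) := by
    rw [← Real.rpow_neg_one t, ← Real.rpow_add ht, ← Real.rpow_add ht, ← Real.rpow_add ht]
    congr 1; ring
  rw [he]; ring

lemma intervalIntegrable_kern_para (h₁ : IsMult N₁ σ₁) (hN₁ : 2 ≤ N₁) (h₂ : IsMult N₂ σ₂)
    (h₃ : IsMult N₃ σ₃) (hs : SupOk (HighBd n) σ₃) {f g : Freq → ℂ} {γ F K s₁ s₂ : ℝ}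
    (hf : HBd (-1) f F) (hg : HighBd n γ K g) (hγ : -1 < γ) (hs₁ : 0 ≤ s₁) (hs₁₂ : s₁ ≤ s₂)
    (hs₂ : s₂ ≤ 1) (k : Freq) :
    IntervalIntegrable (fun t => kern σ₁ σ₂ σ₃ f g t k) volume s₁ s₂ := by
  obtain ⟨C, hC, hb⟩ := kern_para_bd h₁ hN₁ h₂ h₃ hs
  refine intervalIntegrable_of_le_rpow
    (continuousOn_kern h₁ h₂ h₃ hf.isDistribution hg.dist k)
    (B := xiSq k * (C * (F * K))) (e := (2 - 0 + -1 + γ) / 2) hs₁ hs₁₂ (fun _ => by linarith)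
    fun t ht ht' => ?_
  by_cases hk : k = 0
  · subst hk
    simp [kern, h₁.apply_zero (by omega) ht]
  · have h0 : 0 < xiSq k := by linarith [one_le_xiSq hk]
    have := (hb f g (-1) γ 0 F K t le_rfl (by norm_num) le_rfl (by norm_num) hf hg ht
      (ht'.trans hs₂)).apply_le k
    rw [norm_mul, norm_inv, Complex.norm_real, Real.norm_of_nonneg h0.le, neg_zero, zero_div,
      Real.rpow_zero, mul_one, inv_mul_le_iff₀ h0] at this
    linarith

end KernPara

/-- The hypotheses under which `L⁻¹ (P^{s₂}_f g - P^{s₁}_f g)` is estimated in `H^σ`, for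
`f ∈ H^ρ` and `g ∈ 𝓒^γ`. -/
structure ParaHyp (n : ℕ) (f g : Freq → ℂ) (ρ γ σ F K s₁ s₂ : ℝ) : Prop where
  ρ_ge : -1 ≤ ρ
  ρ_le : ρ ≤ 0
  σ_ge : 0 ≤ σ
  σ_le : σ ≤ 2
  γ_gt : -1 < γ
  f_bd : HBd ρ f F
  g_bd : HighBd n γ K g
  s₁_ge : 0 ≤ s₁
  s_le : s₁ ≤ s₂
  s₂_le : s₂ ≤ 1
  pos : s₁ = 0 → 0 < (2 - σ + ρ + γ) / 2

/-- A truncated bilinear operator `T^s` that is linear in its first argument and for which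
`L⁻¹ (T^{s₂} - T^{s₁})` satisfies the bound of an intertwined paraproduct. -/
structure GoodPara (n : ℕ) (T : ℝ → (Freq → ℂ) → (Freq → ℂ) → Freq → ℂ) : Prop where
  est : ∃ C : ℝ, 0 ≤ C ∧ ∀ (f g : Freq → ℂ) (ρ γ σ F K s₁ s₂ : ℝ), ParaHyp n f g ρ γ σ F K s₁ s₂ →
    HBd σ (fun k => (xiSq k : ℂ)⁻¹ * (T s₂ f g k - T s₁ f g k))
      (C * (F * K * ∫ t in s₁..s₂, t ^ ((2 - σ + ρ + γ) / 2 - 1)))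
  lin : ∀ (f f' g : Freq → ℂ) (γ F F' K s : ℝ) (c : ℂ), HBd (-1) f F → HBd (-1) f' F' → HighBd n γ K g → -1 < γ →
    0 ≤ s → s ≤ 1 → T s (c • f + f') g = c • T s f g + T s f' g
  zero : ∀ f g, T 0 f g = 0

namespace GoodPara

variable {n : ℕ} {T T' : ℝ → (Freq → ℂ) → (Freq → ℂ) → Freq → ℂ}

lemma of_eq_zero : GoodPara n fun _ _ _ => 0 where
  est := ⟨0, le_rfl, fun f g ρ γ σ F K s₁ s₂ _ => by
    simpa using! (HBd.zero (ρ := σ))⟩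
  lin := by simp
  zero := by simp

lemma add (h : GoodPara n T) (h' : GoodPara n T') :
    GoodPara n fun s f g => T s f g + T' s f g where
  est := by
    obtain ⟨C, hC, hb⟩ := h.est
    obtain ⟨C', hC', hb'⟩ := h'.est
    refine ⟨C + C', by positivity, fun f g ρ γ σ F K s₁ s₂ hyp => ?_⟩
    rw [add_mul]
    convert! (hb _ _ _ _ _ _ _ _ _ hyp).add (hb' _ _ _ _ _ _ _ _ _ hyp) using 1
    funext k
    simp only [Pi.add_apply]
    ring
  lin := fun f f' g γ F F' K s c hf hf' hg hγ hs hs' => by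
    simp only [h.lin f f' g γ F F' K s c hf hf' hg hγ hs hs',
      h'.lin f f' g γ F F' K s c hf hf' hg hγ hs hs', smul_add]
    abel
  zero := fun f g => by simp [h.zero, h'.zero]

lemma smul (h : GoodPara n T) (c : ℂ) : GoodPara n fun s f g => c • T s f g where
  est := by
    obtain ⟨C, hC, hb⟩ := h.est
    refine ⟨‖c‖ * C, by positivity, fun f g ρ γ σ F K s₁ s₂ hyp => ?_⟩
    rw [mul_assoc]
    convert! (hb _ _ _ _ _ _ _ _ _ hyp).smul c using 1
    funext k
    simp only [Pi.smul_apply, smul_eq_mul]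
    ring
  lin := fun f f' g γ F F' K s c' hf hf' hg hγ hs hs' => by
    simp only [h.lin f f' g γ F F' K s c' hf hf' hg hγ hs hs', smul_add, smul_comm c c']
  zero := fun f g => by simp [h.zero]

lemma sum {ι : Type*} (S : Finset ι) {T : ι → ℝ → (Freq → ℂ) → (Freq → ℂ) → Freq → ℂ}
    (h : ∀ i ∈ S, GoodPara n (T i)) : GoodPara n fun s f g => ∑ i ∈ S, T i s f g := by
  classical
  induction S using Finset.induction_on with
  | empty => simpa using of_eq_zero
  | insert a S ha ih =>
    simp only [Finset.sum_insert ha]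
    exact (h a (by simp)).add (ih fun i hi => h i (by simp [hi]))

lemma block {N₁ N₂ N₃ : ℕ} {σ₁ σ₂ σ₃ : ℝ → Freq → ℂ} (h₁ : IsMult N₁ σ₁) (hN₁ : 2 ≤ N₁)
    (h₂ : IsMult N₂ σ₂) (h₃ : IsMult N₃ σ₃) (hs : SupOk (HighBd n) σ₃) :
    GoodPara n fun s f g => MagneticLaplacian.block s σ₁ σ₂ σ₃ f g where
  est := by
    obtain ⟨C, hC, hb⟩ := kern_para_bd h₁ hN₁ h₂ h₃ hs
    refine ⟨C, hC, fun f g ρ γ σ F K s₁ s₂ h => ?_⟩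
    have hf := h.f_bd.mono h.ρ_ge
    have hi := fun k => intervalIntegrable_kern_para h₁ hN₁ h₂ h₃ hs hf h.g_bd h.γ_gt h.s₁_ge
      h.s_le h.s₂_le k
    have hi0 := fun k => intervalIntegrable_kern_para h₁ hN₁ h₂ h₃ hs hf h.g_bd h.γ_gt le_rfl
      h.s₁_ge (h.s_le.trans h.s₂_le) k
    have hint : IntervalIntegrable (fun t : ℝ => C * (F * K) * t ^ ((2 - σ + ρ + γ) / 2 - 1))
        volume s₁ s₂ := (intervalIntegrable_rpow_of_le h.s₁_ge h.s_le h.pos).const_mul _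
    have key := L2Bd.integral (h := fun t k => (((1 + xiSq k) ^ (σ / 2) : ℝ) : ℂ) *
      ((xiSq k : ℂ)⁻¹ * kern σ₁ σ₂ σ₃ f g t k)) h.s_le
      (fun k => ((hi k).const_mul _).const_mul _) hint fun t ht =>
      hb f g ρ γ σ F K t h.ρ_ge h.ρ_le h.σ_ge h.σ_le h.f_bd h.g_bd (h.s₁_ge.trans_lt ht.1)
        (ht.2.trans h.s₂_le)
    rw [intervalIntegral.integral_const_mul, mul_assoc] at key
    refine L2Bd.mono key fun k => le_of_eq ?_
    have hblk : MagneticLaplacian.block s₂ σ₁ σ₂ σ₃ f g k -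
        MagneticLaplacian.block s₁ σ₁ σ₂ σ₃ f g k = ∫ t in s₁..s₂, kern σ₁ σ₂ σ₃ f g t k := by
      rw [block_apply, block_apply, sub_eq_iff_eq_add',
        intervalIntegral.integral_add_adjacent_intervals (hi0 k) (hi k)]
    simp only [hblk, intervalIntegral.integral_const_mul]
  lin := fun f f' g γ F F' K s c hf hf' hg hγ h0 h1 => by
    exact block_smul_add h₂ h₃ hf.isDistribution hf'.isDistribution hg.dist c h0
      (intervalIntegrable_kern_para h₁ hN₁ h₂ h₃ hs hf hg hγ le_rfl h0 h1)
      (intervalIntegrable_kern_para h₁ hN₁ h₂ h₃ hs hf' hg hγ le_rfl h0 h1)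
  zero := fun f g => by
    funext k
    simp [block_apply]

end GoodPara

/-- Only the blocks with a nonzero coefficient are estimated: there the outer operator has
cancellation at least `n ≥ 2`, and the operator on `g` has cancellation. -/
lemma goodPara_para {n : ℕ} (hn : 2 ≤ n) : GoodPara n (para n) := by
  unfold para
  refine GoodPara.sum _ fun j hj => GoodPara.sum _ fun p hp => GoodPara.sum _ fun q hq =>
    GoodPara.smul (GoodPara.add ?_ ?_) _
  all_goals
    simp only [Finset.mem_range] at hj hp hq
  · by_cases h : n ≤ p + q
    · exact (GoodPara.block (gauss_isMult_pair p q _) (by omega) (gauss_isMult_pair _ _ _)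
        (halfQ_isMult n) (supOk_halfQ (by omega))).smul _
    · simpa [h] using GoodPara.of_eq_zero
  · by_cases h : p + q ≤ n
    · exact (GoodPara.block (halfQ_isMult n) (by omega) (gauss_isMult_pair p q _)
        (gauss_isMult_pair _ _ _) (supOk_gauss (by omega) (by omega) (by omega))).smul _
    · have h0 : weight n (p + q) = 0 := by
        unfold weight
        rw [if_neg (by omega), if_neg (by omega)]
      simpa [h0] using GoodPara.of_eq_zero

/-! ### Bounds for distributions of negative Hölder regularity -/

lemma holderNorm_bounds {n : ℕ} {γ : ℝ} {g : Freq → ℂ} (hγ : |γ| < 1) (hg : IsDistribution g)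
    {K : ℝ} (hK : 0 ≤ K) (hle : holderNorm (2 * n) γ g ≤ ENNReal.ofReal K) :
    HighBd n γ K g ∧ ∀ x, ‖toFun (gauss 0 0 1 1 * g) x‖ ≤ K := by
  have hlow : supNorm (gauss 0 0 1 1 * g) ≤ ENNReal.ofReal K := le_self_add.trans hle
  refine ⟨⟨hK, hg, fun I j c h1 h2 hc hc' t ht ht' x => ?_⟩, fun x => ?_⟩
  · have h3 : ENNReal.ofReal (t ^ (-γ / 2)) * supNorm (gauss I j c t * g) ≤ ENNReal.ofReal K := by
      refine le_trans ?_ (le_add_self.trans hle)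
      refine le_iSup_of_le I (le_iSup_of_le j (le_iSup_of_le c (le_iSup_of_le ⟨?_, by omega, hc,
        hc'⟩ (le_iSup_of_le t (le_iSup_of_le ⟨ht, ht'⟩ le_rfl)))))
      exact hγ.trans_le (by exact_mod_cast h1)
    have h4 : ENNReal.ofReal (t ^ (-γ / 2) * ‖toFun (gauss I j c t * g) x‖) ≤
        ENNReal.ofReal K := by
      rw [ENNReal.ofReal_mul (by positivity), ofReal_norm]
      refine le_trans ?_ h3
      gcongr
      exact le_iSup (fun x => ‖toFun (gauss I j c t * g) x‖ₑ) x
    rw [ENNReal.ofReal_le_ofReal_iff hK, neg_div, Real.rpow_neg ht.le,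
      inv_mul_le_iff₀ (by positivity)] at h4
    linarith
  · rw [← ENNReal.ofReal_le_ofReal_iff hK, ofReal_norm]
    exact (le_iSup (fun x => ‖toFun (gauss 0 0 1 1 * g) x‖ₑ) x).trans hlow

lemma gauss_zero_apply (j c : ℕ) (t : ℝ) (k : Freq) :
    gauss 0 j c t k = (((t * xiSq k) ^ j * heatP c t k : ℝ) : ℂ) := by
  simp [gauss]

lemma heatP_one (t : ℝ) (k : Freq) : heatP 1 t k = Real.exp (-t * xiSq k) := by
  simp [heatP]

namespace HighBd

variable {n : ℕ} {γ K : ℝ} {g : Freq → ℂ}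

lemma weaken (h : HighBd n γ K g) {K' : ℝ} (hK : K ≤ K') : HighBd n γ K' g :=
  ⟨h.nonneg.trans hK, h.dist, fun I j c h1 h2 hc hc' t ht ht' x =>
    (h.bd I j c h1 h2 hc hc' t ht ht' x).trans (by gcongr)⟩

lemma smul (h : HighBd n γ K g) (a : ℂ) : HighBd n γ (‖a‖ * K) (a • g) where
  nonneg := mul_nonneg (norm_nonneg a) h.nonneg
  dist := by
    obtain ⟨C, N, hC⟩ := h.dist
    refine ⟨‖a‖ * C, N, fun k => ?_⟩
    rw [Pi.smul_apply, norm_smul, mul_assoc]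
    exact mul_le_mul_of_nonneg_left (hC k) (norm_nonneg a)
  bd := fun I j c h1 h2 hc hc' t ht ht' x => by
    rw [mul_smul_comm, toFun_smul, norm_mul, mul_assoc]
    exact mul_le_mul_of_nonneg_left (h.bd I j c h1 h2 hc hc' t ht ht' x) (norm_nonneg a)

/-- The bound on the Fourier coefficients obtained from `tL e^{-tL}` at the time `t = |ξ|⁻²`. -/
lemma norm_apply_le (hn : 1 ≤ n) (h : HighBd n γ K g) (hγ : -2 ≤ γ) {k : Freq} (hk : k ≠ 0) :
    ‖g k‖ ≤ Real.exp 1 * K * xiSq k := by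
  have h1 := one_le_xiSq hk
  have h0 : 0 < xiSq k := by linarith
  have ht : 0 < (xiSq k)⁻¹ := inv_pos.mpr h0
  have hle := norm_coeff_le_of_toFun_le ((gauss_isMult 0 1 1).summable h.dist ht)
    (h.bd 0 1 1 (by simp) (by simp; omega) le_rfl (by omega) _ ht (inv_le_one_of_one_le₀ h1)) k
  rw [Pi.mul_apply, gauss_zero_apply, heatP_one, neg_mul, inv_mul_cancel₀ h0.ne', one_pow, one_mul,
    norm_mul, Complex.norm_real, Real.norm_of_nonneg (Real.exp_pos _).le, Real.exp_neg,
    inv_mul_le_iff₀ (Real.exp_pos _)] at hle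
  refine hle.trans ?_
  rw [mul_assoc]
  have hK := h.nonneg
  gcongr
  rw [Real.inv_rpow h0.le, ← Real.rpow_neg h0.le]
  calc xiSq k ^ (-(γ / 2)) ≤ xiSq k ^ (1 : ℝ) :=
        Real.rpow_le_rpow_of_exponent_le h1 (by linarith)
    _ = _ := Real.rpow_one _

end HighBd

lemma exists_norm_gauss_le (n : ℕ) : ∃ C : ℝ, 0 ≤ C ∧ ∀ (I : Fin 2 → ℕ) (j c : ℕ),
    I 0 + I 1 + 2 * j ≤ 4 * n → c ≤ 2 * n → ∀ t, 0 < t → ∀ k, ‖gauss I j c t k‖ ≤ C := by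
  obtain ⟨C, hC, h⟩ := exists_pow_mul_exp_le (4 * n)
  refine ⟨2 ^ (2 * n) * C, by positivity, fun I j c h1 h2 t ht k => ?_⟩
  have hx : 0 ≤ t * xiSq k := mul_nonneg ht.le (xiSq_nonneg k)
  refine (norm_gauss_le I j c ht k).trans ?_
  have hs : √(t * xiSq k) ≤ 1 + t * xiSq k := by
    rw [Real.sqrt_le_left (by positivity)]; nlinarith
  have h3 : √(t * xiSq k) ^ (I 0 + I 1 + 2 * j) ≤ (1 + t * xiSq k) ^ (4 * n) :=
    (pow_le_pow_left₀ (Real.sqrt_nonneg _) hs _).trans (pow_le_pow_right₀ (by linarith) h1)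
  have h4 : (2 : ℝ) ^ c ≤ 2 ^ (2 * n) := pow_le_pow_right₀ (by norm_num) h2
  calc _ ≤ (1 + t * xiSq k) ^ (4 * n) * (2 ^ (2 * n) * Real.exp (-(t * xiSq k) / 2)) := by gcongr
    _ = 2 ^ (2 * n) * ((1 + t * xiSq k) ^ (4 * n) * Real.exp (-(t * xiSq k) / 2)) := by ring
    _ ≤ _ := by gcongr; exact h _ hx

lemma xiSq_mul_invLap (g : Freq → ℂ) (k : Freq) :
    (xiSq k : ℂ) * invLap g k = -g k + (Real.exp (-xiSq k) : ℂ) * g k := by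
  have h : xiSq k * ∫ t in (0 : ℝ)..1, Real.exp (-t * xiSq k) = 1 - Real.exp (-xiSq k) := by
    have := intervalIntegral.smul_integral_comp_mul_right (a := 0) (b := 1)
      (fun u => Real.exp (-u)) (xiSq k)
    simp only [← neg_mul, smul_eq_mul, zero_mul, one_mul] at this
    rw [this, intervalIntegral.integral_comp_neg fun u => Real.exp u, integral_exp]
    simp
  unfold invLap
  rw [← mul_assoc, mul_neg, ← Complex.ofReal_mul, h]
  push_cast
  ring

/-- `LΔ⁻¹ g = -g + e^{-L} g` satisfies the same bounds as `g`: the smooth function `e^{-L} g` is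
estimated through the absolute sum of its Fourier coefficients. -/
lemma exists_highBd_invLap {n : ℕ} (hn : 1 ≤ n) : ∃ C : ℝ, 0 ≤ C ∧ ∀ (γ K : ℝ) (g : Freq → ℂ),
    -2 ≤ γ → γ ≤ 0 → HighBd n γ K g →
      HighBd n γ (C * K) fun k => (xiSq k : ℂ) * invLap g k := by
  obtain ⟨C, hC, hgauss⟩ := exists_norm_gauss_le n
  obtain ⟨D, hD, hexp⟩ := exists_pow_mul_exp_le 3
  set Z := ∑' k : Freq, ((1 + xiSq k) ^ 2)⁻¹ with hZ
  have hZ0 : 0 ≤ Z := tsum_nonneg fun k => by positivity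
  refine ⟨1 + C * Real.exp 1 * D * Z, by positivity, fun γ K g hγ hγ' hg => ?_⟩
  have hK := hg.nonneg
  have heq : (fun k => (xiSq k : ℂ) * invLap g k) =
      -g + fun k => (Real.exp (-xiSq k) : ℂ) * g k := by
    funext k
    simpa using xiSq_mul_invLap g k
  rw [heq]
  have hdist : ∀ f : Freq → ℂ, (∀ k, ‖f k‖ ≤ 2 * ‖g k‖) → IsDistribution f := by
    intro f hf
    obtain ⟨A, N, hA⟩ := hg.dist
    refine ⟨2 * A, N, fun k => (hf k).trans ?_⟩
    linarith [hA k]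
  have hexp1 : ∀ k, ‖(Real.exp (-xiSq k) : ℂ) * g k‖ ≤ ‖g k‖ := fun k => by
    rw [norm_mul, Complex.norm_real, Real.norm_of_nonneg (Real.exp_pos _).le]
    refine mul_le_of_le_one_left (norm_nonneg _) (Real.exp_le_one_iff.mpr ?_)
    linarith [xiSq_nonneg k]
  have hd1 : IsDistribution (-g) := hdist _ fun k => by
    rw [Pi.neg_apply, norm_neg]; linarith [norm_nonneg (g k)]
  have hd2 : IsDistribution fun k => (Real.exp (-xiSq k) : ℂ) * g k := hdist _ fun k => by
    linarith [hexp1 k, norm_nonneg (g k)]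
  refine ⟨by positivity, hdist _ fun k => ?_, fun I j c h1 h2 hc hc' t ht ht' x => ?_⟩
  · refine (norm_add_le _ _).trans ?_
    rw [Pi.neg_apply, norm_neg]
    linarith [hexp1 k]
  have hm := gauss_isMult I j c
  rw [mul_add, toFun_add (hm.summable hd1 ht) (hm.summable hd2 ht), mul_neg, toFun_neg]
  refine (norm_add_le _ _).trans ?_
  rw [norm_neg]
  have hsm : ‖toFun (gauss I j c t * fun k => (Real.exp (-xiSq k) : ℂ) * g k) x‖ ≤
      C * Real.exp 1 * D * Z * K := by
    have : C * Real.exp 1 * D * Z * K =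
        ∑' k : Freq, C * Real.exp 1 * D * K * ((1 + xiSq k) ^ 2)⁻¹ := by
      rw [tsum_mul_left, ← hZ]; ring
    rw [this]
    refine norm_toFun_le (summable_one_add_xiSq.mul_left _) (fun k => ?_) x
    have h0 := one_add_xiSq_pos k
    by_cases hk : k = 0
    · subst hk
      rw [Pi.mul_apply, hm.apply_zero h1 ht, zero_mul, norm_zero]
      positivity
    · have h3 := hgauss I j c h2 hc' t ht k
      have h4 := hg.norm_apply_le hn hγ hk
      have hk0 := xiSq_nonneg k
      have h5 : (1 + xiSq k) ^ 3 * Real.exp (-xiSq k) ≤ D := by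
        refine le_trans ?_ (hexp _ hk0)
        gcongr
        linarith
      rw [Pi.mul_apply, norm_mul, norm_mul, Complex.norm_real,
        Real.norm_of_nonneg (Real.exp_pos _).le, ← div_eq_mul_inv, le_div_iff₀ (by positivity)]
      calc _ ≤ C * (Real.exp (-xiSq k) * (Real.exp 1 * K * (1 + xiSq k))) * (1 + xiSq k) ^ 2 := by
            gcongr
            exact h4.trans (by gcongr; linarith)
        _ = C * Real.exp 1 * K * ((1 + xiSq k) ^ 3 * Real.exp (-xiSq k)) := by ring
        _ ≤ C * Real.exp 1 * K * D := by gcongr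
        _ = _ := by ring
  have hpow : 1 ≤ t ^ (γ / 2) := Real.one_le_rpow_of_pos_of_le_one_of_nonpos ht ht' (by linarith)
  refine (add_le_add (hg.bd I j c h1 h2 hc hc' t ht ht' x)
    (hsm.trans (le_mul_of_one_le_right (by positivity) hpow))).trans (le_of_eq ?_)
  ring

/-- `-t ∂_t P_t^{(c)} = (tL)^c e^{-tL} / (c-1)!`. -/
lemma hasDerivAt_heatP (c : ℕ) (t : ℝ) (k : Freq) :
    HasDerivAt (fun t => heatP (c + 1) t k)
      (-(xiSq k * (t * xiSq k) ^ c / (c.factorial : ℝ) * Real.exp (-t * xiSq k))) t := by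
  have he : HasDerivAt (fun t => Real.exp (-t * xiSq k)) (-xiSq k * Real.exp (-t * xiSq k)) t := by
    have := (((hasDerivAt_id t).neg).mul_const (xiSq k)).exp
    simpa [mul_comm] using this
  induction c with
  | zero =>
    simp only [heatP_one, zero_add]
    simpa using he
  | succ c ih =>
    have h2 : HasDerivAt (fun t => (t * xiSq k) ^ (c + 1) / ((c + 1).factorial : ℝ))
        (xiSq k * (t * xiSq k) ^ c / (c.factorial : ℝ)) t := by
      have := (((hasDerivAt_id t).mul_const (xiSq k)).pow (c + 1)).div_const
        ((c + 1).factorial : ℝ)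
      convert! this using 1
      have h3 : (c.factorial : ℝ) ≠ 0 := by positivity
      have h4 : ((c : ℝ) + 1) ≠ 0 := by positivity
      rw [Nat.factorial_succ]
      push_cast
      simp only [id]
      field_simp
    have h3 := ih.add (h2.mul he)
    have h5 : (fun t => heatP (c + 1 + 1) t k) = fun t => heatP (c + 1) t k +
        (t * xiSq k) ^ (c + 1) / ((c + 1).factorial : ℝ) * Real.exp (-t * xiSq k) := by
      funext t
      simp only [heatP, Finset.sum_range_succ _ (c + 1), add_mul]
    rw [h5]
    convert! h3 using 1
    ring

lemma HighBd.norm_toFun_gauss_one_le {n : ℕ} {γ K : ℝ} {g : Freq → ℂ} (hg : HighBd n γ K g)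
    (hlow : ∀ x, ‖toFun (gauss 0 0 1 1 * g) x‖ ≤ K) {c : ℕ} (hc : c ≤ 2 * n) (x : Torus) :
    ‖toFun (gauss 0 0 c 1 * g) x‖ ≤ c * K := by
  induction c with
  | zero =>
    have : gauss 0 0 0 1 * g = 0 := by
      funext k; simp [gauss_zero_apply, heatP]
    rw [this]
    simp [toFun]
  | succ c ih =>
    have heq : gauss 0 0 (c + 1) 1 * g =
        gauss 0 0 c 1 * g + ((c.factorial : ℂ)⁻¹) • (gauss 0 c 1 1 * g) := by
      funext k
      simp only [Pi.mul_apply, Pi.add_apply, Pi.smul_apply, smul_eq_mul, gauss_zero_apply, heatP,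
        Finset.sum_range_succ _ c]
      push_cast
      simp
      ring
    have hb : ‖toFun (gauss 0 c 1 1 * g) x‖ ≤ K := by
      rcases Nat.eq_zero_or_pos c with rfl | h
      · exact hlow x
      · simpa using hg.bd 0 c 1 (by simp; omega) (by simp; omega) le_rfl (by omega) 1 one_pos
          le_rfl x
    have hs := (gauss_isMult 0 0 c).summable hg.dist one_pos
    have hs' : Summable ((c.factorial : ℂ)⁻¹ • (gauss 0 c 1 1 * g)) :=
      ((gauss_isMult 0 c 1).summable hg.dist one_pos).const_smul ((c.factorial : ℂ)⁻¹)
    rw [heq, toFun_add hs hs', toFun_smul]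
    refine (norm_add_le _ _).trans ?_
    rw [norm_mul, norm_inv, Complex.norm_natCast]
    have hf : ((c.factorial : ℝ))⁻¹ ≤ 1 :=
      inv_le_one_of_one_le₀ (by exact_mod_cast Nat.one_le_iff_ne_zero.mpr c.factorial_ne_zero)
    have h1 := ih (by omega)
    have h2 : ((c.factorial : ℝ))⁻¹ * ‖toFun (gauss 0 c 1 1 * g) x‖ ≤ 1 * K := by gcongr
    push_cast
    linarith

lemma hasDerivAt_toFun_gauss {n : ℕ} (hn : 1 ≤ n) {g : Freq → ℂ} (hg : IsDistribution g)
    (x : Torus) {t : ℝ} (ht : 0 < t) :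
    HasDerivAt (fun t => toFun (gauss 0 0 (2 * n) t * g) x)
      (-((t : ℂ)⁻¹ * ((((2 * n - 1).factorial : ℕ) : ℂ)⁻¹ *
        toFun (gauss 0 (2 * n) 1 t * g) x))) t := by
  set a : ℂ := (((2 * n - 1).factorial : ℕ) : ℂ)⁻¹
  have hm := gauss_isMult 0 (2 * n) 1
  obtain ⟨u, hu, hle⟩ := hm.exists_summable hg (half_pos ht)
  have h1 : ∀ y : ℝ, t / 2 < y → ∀ k, HasDerivAt
      (fun t => (gauss 0 0 (2 * n) t * g) k * UnitAddTorus.mFourier k x)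
      (-((y : ℂ)⁻¹ * (a * ((gauss 0 (2 * n) 1 y * g) k * UnitAddTorus.mFourier k x)))) y := by
    intro y hy k
    have hy0 : y ≠ 0 := by linarith
    have h := (hasDerivAt_heatP (2 * n - 1) y k).ofReal_comp
    rw [Nat.sub_add_cancel (by omega)] at h
    have h2 := (h.mul_const (g k)).mul_const (UnitAddTorus.mFourier k x)
    convert! h2 using 1
    · funext r
      simp [gauss_zero_apply]
    · obtain ⟨m, rfl⟩ : ∃ m, n = m + 1 := ⟨n - 1, by omega⟩
      simp only [Pi.mul_apply, gauss_zero_apply, heatP_one, a]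
      push_cast
      have : (y : ℂ) ≠ 0 := by exact_mod_cast hy0
      rw [show 2 * (m + 1) = 2 * (m + 1) - 1 + 1 by omega, pow_succ]
      field_simp
      simp
      ring
  have h2 := hasDerivAt_tsum_of_isPreconnected (t := Ioi (t / 2)) (y₀ := t) (y := t)
    (u := fun k => (t / 2)⁻¹ * (‖a‖ * u k)) ((hu.mul_left _).mul_left _) isOpen_Ioi
    isPreconnected_Ioi (fun k y hy => h1 y hy k) (fun k y hy => ?_) (half_lt_self ht)
    (hasSum_toFun ((gauss_isMult 0 0 (2 * n)).summable hg ht) x).summable (half_lt_self ht)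
  · simpa only [tsum_neg, tsum_mul_left] using! h2
  · have hy' : t / 2 < y := hy
    have hy0 : 0 < y := by linarith
    rw [norm_neg, norm_mul, norm_mul, norm_mul, norm_mFourier_apply, mul_one, norm_inv,
      Complex.norm_real, Real.norm_of_nonneg hy0.le]
    have := hle y hy'.le k
    gcongr

/-- The operators `P_t` without cancellation, obtained by integrating `-r ∂_r P_r` over
`r ∈ (t, 1)`. -/
lemma HighBd.fullBd {n : ℕ} (hn : 1 ≤ n) {γ K : ℝ} {g : Freq → ℂ} (hγ : γ < 0)
    (hg : HighBd n γ K g) (hlow : ∀ x, ‖toFun (gauss 0 0 1 1 * g) x‖ ≤ K) :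
    FullBd n γ ((1 + 2 * n + 2 / (-γ)) * K) g := by
  have hK := hg.nonneg
  have hγ' : 0 < 2 / (-γ) := div_pos two_pos (by linarith)
  refine ⟨hg.weaken (le_mul_of_one_le_left hK (by linarith [(Nat.cast_nonneg n : (0 : ℝ) ≤ n)])),
    fun t ht ht' x => ?_⟩
  have hd := fun r (hr : 0 < r) => hasDerivAt_toFun_gauss hn hg.dist x hr
  have hcont : ContinuousOn (fun r : ℝ => -((r : ℂ)⁻¹ * ((((2 * n - 1).factorial : ℕ) : ℂ)⁻¹ *
        toFun (gauss 0 (2 * n) 1 r * g) x))) (Icc t 1) := by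
    refine (ContinuousOn.mul ?_ (continuousOn_const.mul ?_)).neg
    · refine ContinuousOn.inv₀ Complex.continuous_ofReal.continuousOn fun r hr => ?_
      exact_mod_cast (ht.trans_le hr.1).ne'
    · exact (continuousOn_toFun (gauss_isMult 0 (2 * n) 1) hg.dist ht x).mono fun r hr => hr.1
  have hftc := intervalIntegral.integral_eq_sub_of_hasDerivAt (a := t) (b := 1)
    (fun r hr => hd r (by rw [uIcc_of_le ht'] at hr; exact ht.trans_le hr.1))
    (by rw [← uIcc_of_le ht'] at hcont; exact hcont.intervalIntegrable)
  have hint : ‖∫ r in t..1, -((r : ℂ)⁻¹ * ((((2 * n - 1).factorial : ℕ) : ℂ)⁻¹ *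
        toFun (gauss 0 (2 * n) 1 r * g) x))‖ ≤ ∫ r in t..1, K * r ^ (γ / 2 - 1) := by
    refine intervalIntegral.norm_integral_le_of_norm_le ht' (.of_forall fun r hr => ?_)
      ((intervalIntegrable_rpow_of_le ht.le ht' fun h => absurd h ht.ne').const_mul K)
    have hr0 : 0 < r := ht.trans hr.1
    have h1 := hg.bd 0 (2 * n) 1 (by simp; omega) (by simp; omega) le_rfl (by omega) r hr0 hr.2 x
    have hf : (((2 * n - 1).factorial : ℝ))⁻¹ ≤ 1 := inv_le_one_of_one_le₀
      (by exact_mod_cast Nat.one_le_iff_ne_zero.mpr (Nat.factorial_ne_zero _))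
    rw [norm_neg, norm_mul, norm_mul, norm_inv, norm_inv, Complex.norm_natCast,
      Complex.norm_real, Real.norm_of_nonneg hr0.le, Real.rpow_sub_one hr0.ne']
    calc _ ≤ r⁻¹ * (1 * (K * r ^ (γ / 2))) := by gcongr
      _ = _ := by rw [div_eq_mul_inv]; ring
  rw [hftc, intervalIntegral.integral_const_mul, integral_rpow (Or.inr ⟨by linarith, by
    rw [uIcc_of_le ht']; exact fun h => absurd h.1 (not_le.mpr ht)⟩)] at hint
  have h1 := hg.norm_toFun_gauss_one_le hlow le_rfl x
  have hpow : 1 ≤ t ^ (γ / 2) := Real.one_le_rpow_of_pos_of_le_one_of_nonpos ht ht' (by linarith)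
  have h2 : K * ((1 ^ (γ / 2 - 1 + 1) - t ^ (γ / 2 - 1 + 1)) / (γ / 2 - 1 + 1)) ≤
      2 / (-γ) * K * t ^ (γ / 2) := by
    rw [sub_add_cancel, Real.one_rpow,
      show (1 - t ^ (γ / 2)) / (γ / 2) = 2 / (-γ) * (t ^ (γ / 2) - 1) by field_simp; ring]
    have : 0 ≤ K * (2 / (-γ)) := by positivity
    nlinarith
  have h3 : ‖toFun (gauss 0 0 (2 * n) t * g) x‖ ≤ ‖toFun (gauss 0 0 (2 * n) 1 * g) x‖ +
      ‖toFun (gauss 0 0 (2 * n) 1 * g) x - toFun (gauss 0 0 (2 * n) t * g) x‖ := by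
    have := norm_sub_norm_le (toFun (gauss 0 0 (2 * n) t * g) x)
      (toFun (gauss 0 0 (2 * n) 1 * g) x)
    rw [norm_sub_rev] at this
    linarith
  have h4 : 0 ≤ (1 + 2 * n : ℝ) * K := by positivity
  push_cast at h1
  nlinarith [mul_le_mul_of_nonneg_left hpow h4]

/-! ### The remainder terms -/

/-- The hypotheses under which the remainder terms are estimated in `L²`, for `f ∈ H^ρ` and
`g ∈ 𝓒^γ` with `ρ + γ > 0`. -/
structure RemHyp (n : ℕ) (f g : Freq → ℂ) (ρ γ F K : ℝ) : Prop where
  ρ_ge : 0 ≤ ρ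
  ρ_le : ρ ≤ 2
  pos : 0 < ρ + γ
  f_bd : HBd ρ f F
  g_bd : FullBd n γ K g

/-- A bilinear operator that is linear in its first argument and satisfies the bound in `L²` of a
remainder term. -/
structure GoodRem (n : ℕ) (T : (Freq → ℂ) → (Freq → ℂ) → Freq → ℂ) : Prop where
  est : ∃ C : ℝ, 0 ≤ C ∧ ∀ (f g : Freq → ℂ) (ρ γ F K : ℝ), RemHyp n f g ρ γ F K →
    L2Bd (T f g) (C * (F * K * (1 + 2 / (ρ + γ))))
  lin : ∀ (f f' g : Freq → ℂ) (ρ γ F F' K : ℝ) (c : ℂ), RemHyp n f g ρ γ F K →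
    RemHyp n f' g ρ γ F' K → T (c • f + f') g = c • T f g + T f' g

section KernRem

variable {N₁ N₂ N₃ n : ℕ} {σ₁ σ₂ σ₃ : ℝ → Freq → ℂ}

lemma l2Bd_mult (h₂ : IsMult N₂ σ₂) (hN₂ : 2 ≤ N₂) : ∃ C : ℝ, 0 ≤ C ∧ ∀ (f : Freq → ℂ) (ρ F t : ℝ),
    0 ≤ ρ → ρ ≤ 2 → HBd ρ f F → 0 < t → L2Bd (σ₂ t * f) (C * t ^ (ρ / 2) * F) := by
  obtain ⟨C₂, hC₂, h2⟩ := h₂.exists_le_of_nonneg hN₂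
  refine ⟨C₂, hC₂, fun f ρ F t hρ hρ' hf ht => ?_⟩
  refine L2Bd.of_le hf (by positivity) fun k => ?_
  have h0 := one_add_xiSq_pos k
  rw [Pi.mul_apply, norm_mul, norm_mul, Complex.norm_real,
    Real.norm_of_nonneg (Real.rpow_nonneg h0.le _), ← mul_assoc]
  refine mul_le_mul_of_nonneg_right ?_ (norm_nonneg _)
  simpa [mul_assoc] using h2 ρ t hρ hρ' ht k

lemma kern_rem_bd (h₁ : IsMult N₁ σ₁) (h₂ : IsMult N₂ σ₂) (hN₂ : 2 ≤ N₂) (h₃ : IsMult N₃ σ₃)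
    (hs : SupOk (FullBd n) σ₃) : ∃ C : ℝ, 0 ≤ C ∧ ∀ (f g : Freq → ℂ) (ρ γ F K t : ℝ),
      RemHyp n f g ρ γ F K → 0 < t → t ≤ 1 →
      L2Bd (kern σ₁ σ₂ σ₃ f g t) (C * (F * K) * t ^ ((ρ + γ) / 2 - 1)) := by
  obtain ⟨C₁, hC₁, h1⟩ := h₁.exists_le
  obtain ⟨C₂, hC₂, h2⟩ := l2Bd_mult h₂ hN₂
  obtain ⟨C₃, hC₃, h3⟩ := hs
  refine ⟨C₁ * C₂ * C₃, by positivity, fun f g ρ γ F K t h ht ht' => ?_⟩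
  have hb := l2Bd_prodCoeff (h₂.summable h.f_bd.isDistribution ht) (h₃.summable h.g_bd.dist ht)
    (h2 f ρ F t h.ρ_ge h.ρ_le h.f_bd ht) (h3 γ K g h.g_bd t ht ht')
  have hc : L2Bd (kern σ₁ σ₂ σ₃ f g t)
      (t⁻¹ * C₁ * (C₂ * t ^ (ρ / 2) * F * (C₃ * K * t ^ (γ / 2)))) := by
    refine L2Bd.of_le hb (by positivity) fun k => ?_
    simp only [kern, norm_mul, norm_inv, Complex.norm_real]
    rw [Real.norm_of_nonneg ht.le, mul_assoc]
    have := h1 t ht k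
    gcongr
  refine hc.weaken (le_of_eq ?_)
  have he : t ^ ((ρ + γ) / 2 - 1) = t⁻¹ * (t ^ (ρ / 2) * t ^ (γ / 2)) := by
    rw [← Real.rpow_neg_one t, ← Real.rpow_add ht, ← Real.rpow_add ht]
    congr 1; ring
  rw [he]; ring

lemma intervalIntegrable_kern_rem (h₁ : IsMult N₁ σ₁) (h₂ : IsMult N₂ σ₂) (hN₂ : 2 ≤ N₂)
    (h₃ : IsMult N₃ σ₃) (hs : SupOk (FullBd n) σ₃) {f g : Freq → ℂ} {ρ γ F K : ℝ}
    (h : RemHyp n f g ρ γ F K) (k : Freq) :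
    IntervalIntegrable (fun t => kern σ₁ σ₂ σ₃ f g t k) volume 0 1 := by
  obtain ⟨C, hC, hb⟩ := kern_rem_bd h₁ h₂ hN₂ h₃ hs
  exact intervalIntegrable_of_le_rpow
    (continuousOn_kern h₁ h₂ h₃ h.f_bd.isDistribution h.g_bd.dist k)
    le_rfl zero_le_one (fun _ => half_pos h.pos)
    fun t ht ht' => (hb f g ρ γ F K t h ht ht').apply_le k

end KernRem

namespace GoodRem

variable {n : ℕ} {T T' : (Freq → ℂ) → (Freq → ℂ) → Freq → ℂ}

lemma of_eq_zero : GoodRem n fun _ _ => 0 where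
  est := ⟨0, le_rfl, fun f g ρ γ F K _ => by simpa using L2Bd.zero⟩
  lin := by simp

lemma add (h : GoodRem n T) (h' : GoodRem n T') : GoodRem n fun f g => T f g + T' f g where
  est := by
    obtain ⟨C, hC, hb⟩ := h.est
    obtain ⟨C', hC', hb'⟩ := h'.est
    refine ⟨C + C', by positivity, fun f g ρ γ F K hyp => ?_⟩
    rw [add_mul]
    exact (hb _ _ _ _ _ _ hyp).add (hb' _ _ _ _ _ _ hyp)
  lin := fun f f' g ρ γ F F' K c hf hf' => by
    simp only [h.lin f f' g ρ γ F F' K c hf hf', h'.lin f f' g ρ γ F F' K c hf hf', smul_add]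
    abel

lemma smul (h : GoodRem n T) (c : ℂ) : GoodRem n fun f g => c • T f g where
  est := by
    obtain ⟨C, hC, hb⟩ := h.est
    refine ⟨‖c‖ * C, by positivity, fun f g ρ γ F K hyp => ?_⟩
    rw [mul_assoc]
    exact (hb _ _ _ _ _ _ hyp).smul c
  lin := fun f f' g ρ γ F F' K c' hf hf' => by
    simp only [h.lin f f' g ρ γ F F' K c' hf hf', smul_add, smul_comm c c']

lemma sum {ι : Type*} (S : Finset ι) {T : ι → (Freq → ℂ) → (Freq → ℂ) → Freq → ℂ}
    (h : ∀ i ∈ S, GoodRem n (T i)) : GoodRem n fun f g => ∑ i ∈ S, T i f g := by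
  classical
  induction S using Finset.induction_on with
  | empty => simpa using of_eq_zero
  | insert a S ha ih =>
    simp only [Finset.sum_insert ha]
    exact (h a (by simp)).add (ih fun i hi => h i (by simp [hi]))

lemma block {N₁ N₂ N₃ : ℕ} {σ₁ σ₂ σ₃ : ℝ → Freq → ℂ} (h₁ : IsMult N₁ σ₁) (h₂ : IsMult N₂ σ₂)
    (hN₂ : 2 ≤ N₂) (h₃ : IsMult N₃ σ₃) (hs : SupOk (FullBd n) σ₃) :
    GoodRem n fun f g => MagneticLaplacian.block 1 σ₁ σ₂ σ₃ f g where
  est := by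
    obtain ⟨C, hC, hb⟩ := kern_rem_bd h₁ h₂ hN₂ h₃ hs
    refine ⟨C, hC, fun f g ρ γ F K h => ?_⟩
    have hpos := half_pos h.pos
    have key := L2Bd.integral zero_le_one (intervalIntegrable_kern_rem h₁ h₂ hN₂ h₃ hs h)
      ((intervalIntegrable_rpow_of_le le_rfl zero_le_one fun _ => hpos).const_mul (C * (F * K)))
      fun t ht => hb f g ρ γ F K t h ht.1 ht.2
    have hFK : 0 ≤ F * K := mul_nonneg h.f_bd.nonneg h.g_bd.nonneg
    refine L2Bd.weaken key ?_
    rw [intervalIntegral.integral_const_mul, integral_rpow (Or.inl (by linarith)), sub_add_cancel,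
      Real.one_rpow, Real.zero_rpow hpos.ne', sub_zero, one_div_div, mul_assoc]
    gcongr
    linarith
  lin := fun f f' g ρ γ F F' K c hf hf' =>
    block_smul_add h₂ h₃ hf.f_bd.isDistribution hf'.f_bd.isDistribution hf.g_bd.dist c zero_le_one
      (intervalIntegrable_kern_rem h₁ h₂ hN₂ h₃ hs hf)
      (intervalIntegrable_kern_rem h₁ h₂ hN₂ h₃ hs hf')

lemma block_swap {N₁ N₂ N₃ : ℕ} {σ₁ σ₂ σ₃ : ℝ → Freq → ℂ} (h₁ : IsMult N₁ σ₁) (h₂ : IsMult N₂ σ₂)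
    (hs : SupOk (FullBd n) σ₂) (h₃ : IsMult N₃ σ₃) (hN₃ : 2 ≤ N₃) :
    GoodRem n fun f g => MagneticLaplacian.block 1 σ₁ σ₂ σ₃ g f := by
  simp only [block_comm 1 σ₁ σ₂ σ₃]
  exact block h₁ h₃ hN₃ h₂ hs

end GoodRem

/-- The operator on `f` has cancellation at least `n ≥ 2`. -/
lemma goodRem_para {n : ℕ} (hn : 2 ≤ n) : GoodRem n fun f g => para n 1 g f := by
  unfold para
  refine GoodRem.sum _ fun j hj => GoodRem.sum _ fun p hp => GoodRem.sum _ fun q hq =>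
    GoodRem.smul (GoodRem.add (GoodRem.smul ?_ _) ?_) _
  all_goals
    simp only [Finset.mem_range] at hj hp hq
  · exact GoodRem.block_swap (gauss_isMult_pair p q _) (gauss_isMult_pair _ _ _)
      (supOk_gauss_full (by omega) (by omega)) (halfQ_isMult n) (by omega)
  · by_cases h : p + q ≤ n
    · exact (GoodRem.block_swap (halfQ_isMult n) (gauss_isMult_pair p q _)
        (supOk_gauss_full (by omega) (by omega)) (gauss_isMult_pair _ _ _) (by omega)).smul _
    · have h0 : weight n (p + q) = 0 := by
        unfold weight
        rw [if_neg (by omega), if_neg (by omega)]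
      simpa [h0] using GoodRem.of_eq_zero

/-- The low-frequency term `P_1(P_1 f · P_1 g)` of the resonant product. -/
lemma goodRem_low (n : ℕ) : GoodRem n fun f g =>
    gauss 0 0 (2 * n) 1 * prodCoeff (gauss 0 0 (2 * n) 1 * f) (gauss 0 0 (2 * n) 1 * g) where
  est := by
    have hm := gauss_isMult 0 0 (2 * n)
    obtain ⟨C, hC, hb⟩ := hm.exists_le
    refine ⟨C * C, by positivity, fun f g ρ γ F K h => ?_⟩
    have hF := h.f_bd.nonneg
    have hK := h.g_bd.nonneg
    have h1 : L2Bd (gauss 0 0 (2 * n) 1 * f) (C * F) := by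
      refine L2Bd.of_le (HBd.zero_iff.mp (h.f_bd.mono h.ρ_ge)) hC fun k => ?_
      rw [Pi.mul_apply, norm_mul]
      have := hb 1 one_pos k
      gcongr
    have h2 := l2Bd_prodCoeff (hm.summable h.f_bd.isDistribution one_pos)
      (hm.summable h.g_bd.dist one_pos) h1 (D := K)
      fun x => by simpa using h.g_bd.bd_zero 1 one_pos le_rfl x
    have h3 : L2Bd (gauss 0 0 (2 * n) 1 * prodCoeff (gauss 0 0 (2 * n) 1 * f)
        (gauss 0 0 (2 * n) 1 * g)) (C * (C * F * K)) := by
      refine L2Bd.of_le h2 hC fun k => ?_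
      rw [Pi.mul_apply, norm_mul]
      have := hb 1 one_pos k
      gcongr
    refine h3.weaken ?_
    have : 0 ≤ 2 / (ρ + γ) := div_nonneg two_pos.le h.pos.le
    calc C * (C * F * K) = C * C * (F * K * 1) := by ring
      _ ≤ _ := by gcongr; linarith
  lin := fun f f' g ρ γ F F' K c hf hf' => by
    have hm := gauss_isMult 0 0 (2 * n)
    rw [mul_add, mul_smul_comm, prodCoeff_smul_add c
      (hm.summable hf.f_bd.isDistribution one_pos) (hm.summable hf'.f_bd.isDistribution one_pos)
      (hm.summable hf.g_bd.dist one_pos), mul_add, mul_smul_comm]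

lemma goodRem_reso {n : ℕ} (hn : 2 ≤ n) : GoodRem n (reso n) := by
  unfold reso
  refine GoodRem.add (GoodRem.sum _ fun j hj => GoodRem.sum _ fun p hp => GoodRem.sum _ fun q hq =>
    ?_) (goodRem_low n)
  simp only [Finset.mem_range] at hj hp hq
  by_cases h : p + q < n
  · exact GoodRem.smul (GoodRem.add
      (GoodRem.block (gauss_isMult_pair p q _) (gauss_isMult_pair _ _ _) (by omega)
        (halfQ_isMult n) ((supOk_halfQ (by omega)).mono fun γ K g hg => hg.toHighBd))
      (GoodRem.block (gauss_isMult_pair p q _) (halfQ_isMult n) (by omega)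
        (gauss_isMult_pair _ _ _) (supOk_gauss_full (by omega) (by omega)))) _
  · simpa [h] using GoodRem.of_eq_zero

/-! ### The potential and the two parts of the operator -/

/-- The potential `(2iA, A²)` satisfies the bounds of `𝓒^{α-1} × 𝓒^{2α-2}`, with norms
controlled by `N`. -/
structure PotBd (n : ℕ) (α N : ℝ) (A : EnhancedPotential) : Prop where
  α_gt : 2 / 3 < α
  α_lt : α < 1
  nonneg : 0 ≤ N
  pot : ∀ j, HighBd n (α - 1) (2 * N) (A.twoI j)
  pot_low : ∀ j x, ‖toFun (gauss 0 0 1 1 * A.twoI j) x‖ ≤ 2 * N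
  sq : HighBd n (2 * α - 2) N A.sq
  sq_low : ∀ x, ‖toFun (gauss 0 0 1 1 * A.sq) x‖ ≤ N

lemma potBd_of_xNorm {n : ℕ} {α : ℝ} (h1 : 2 / 3 < α) (h2 : α < 1) {A : EnhancedPotential}
    (hA : A.xNorm n α ≠ ⊤) : PotBd n α (A.xNorm n α).toReal A := by
  have hN : 0 ≤ (A.xNorm n α).toReal := ENNReal.toReal_nonneg
  have hp := fun j => holderNorm_bounds (n := n) (γ := α - 1) (g := A.pot j)
    (by rw [abs_lt]; constructor <;> linarith) (A.pot_dist j) hN (by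
      rw [ENNReal.ofReal_toReal hA]
      exact (Finset.single_le_sum (f := fun j => holderNorm (2 * n) (α - 1) (A.pot j))
        (fun _ _ => zero_le) (Finset.mem_univ j)).trans le_self_add)
  have hs := holderNorm_bounds (n := n) (γ := 2 * α - 2) (g := A.sq)
    (by rw [abs_lt]; constructor <;> linarith) A.sq_dist hN (by
      rw [ENNReal.ofReal_toReal hA]
      exact le_add_self)
  have h2I : ‖(2 * Complex.I : ℂ)‖ = 2 := by simp
  refine ⟨h1, h2, hN, fun j => ?_, fun j x => ?_, hs.1, hs.2⟩
  · simpa [h2I] using! (hp j).1.smul (2 * Complex.I)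
  · unfold EnhancedPotential.twoI
    rw [mul_smul_comm, toFun_smul, norm_mul, h2I]
    exact mul_le_mul_of_nonneg_left ((hp j).2 x) two_pos.le

/-- The singular part `P̃ˢ_v X₁ + P̃ˢ_{∇v} X₂` of `v`, so that `Φˢ(v) = v - pert v`. -/
def pert (n : ℕ) (A : EnhancedPotential) (s : ℝ) (v : Freq → ℂ) : Freq → ℂ :=
  tpara n s v A.X₁ + ∑ j, tpara n s (partialD j v) (A.X₂ j)

/-- The part `P_{2iA} ∇v + Π(∇v, 2iA) + P_{A²} v + Π(v, A²)` of `H`. -/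
def remPart (n : ℕ) (A : EnhancedPotential) (v : Freq → ℂ) : Freq → ℂ :=
  (∑ j, (para n 1 (A.twoI j) (partialD j v) + reso n (partialD j v) (A.twoI j))) +
    para n 1 A.sq v + reso n v A.sq

lemma Phi_eq (n : ℕ) (A : EnhancedPotential) (s : ℝ) (u : L2T) :
    Phi n A s u = coeff u - pert n A s (coeff u) := by
  rw [Phi, pert, sub_add_eq_sub_sub]

lemma remainder_eq (n : ℕ) (A : EnhancedPotential) (u : L2T) :
    remainder n A u = remPart n A (coeff u) := rfl

lemma partialD_smul_add (j : Fin 2) (c : ℂ) (v v' : Freq → ℂ) :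
    partialD j (c • v + v') = c • partialD j v + partialD j v' := by
  funext k
  simp only [partialD, Pi.add_apply, Pi.smul_apply, smul_eq_mul]
  ring

section Pert

variable {n : ℕ}

lemma pert_apply_zero (A : EnhancedPotential) (s : ℝ) (v : Freq → ℂ) : pert n A s v 0 = 0 := by
  simp [pert, tpara]

/-- The bound of the singular part in `H^σ`. The exponents of `t` come from the regularities
`0` of `v` and `2α - 2` of `A²`, and `ρ` of `∇v` and `α - 1` of `A`. -/
lemma exists_pert_bd (hn : 2 ≤ n) : ∃ C : ℝ, 0 ≤ C ∧ ∀ (α N : ℝ) (A : EnhancedPotential),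
    PotBd n α N A → ∀ (v : Freq → ℂ) (ρ σ F₀ F₁ s₁ s₂ : ℝ), -1 ≤ ρ → ρ ≤ 0 → 0 ≤ σ → σ ≤ 2 →
    HBd 0 v F₀ → HBd (ρ + 1) v F₁ → 0 ≤ s₁ → s₁ ≤ s₂ → s₂ ≤ 1 →
    (s₁ = 0 → 0 < (2 * α - σ) / 2 ∧ 0 < (1 + ρ + α - σ) / 2) →
    HBd σ (pert n A s₂ v - pert n A s₁ v)
      (C * N * (F₀ * (∫ t in s₁..s₂, t ^ ((2 * α - σ) / 2 - 1)) +
        F₁ * ∫ t in s₁..s₂, t ^ ((1 + ρ + α - σ) / 2 - 1))) := by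
  obtain ⟨C, hC, hest⟩ := (goodPara_para hn).est
  obtain ⟨D, hD, hinv⟩ := exists_highBd_invLap (n := n) (by omega)
  refine ⟨4 * C * D, by positivity, fun α N A hA v ρ σ F₀ F₁ s₁ s₂ hρ hρ' hσ hσ' hv hv' hs₁ hs₁₂
    hs₂ hpos => ?_⟩
  have h1 := hA.α_gt
  have h2 := hA.α_lt
  have hN := hA.nonneg
  have hsq := hest v _ 0 (2 * α - 2) σ F₀ (D * N) s₁ s₂ ⟨by norm_num, le_rfl, hσ, hσ',
    by linarith, hv, hinv _ _ _ (by linarith) (by linarith) hA.sq, hs₁, hs₁₂, hs₂,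
    fun h => by linarith [(hpos h).1]⟩
  have hpot := fun j => hest (partialD j v) _ ρ (α - 1) σ F₁ (D * (2 * N)) s₁ s₂ ⟨hρ, hρ', hσ, hσ',
    by linarith, by simpa using hv'.partialD j, hinv _ _ _ (by linarith) (by linarith) (hA.pot j),
    hs₁, hs₁₂, hs₂, fun h => by linarith [(hpos h).2]⟩
  rw [show (2 - σ + 0 + (2 * α - 2)) / 2 = (2 * α - σ) / 2 by ring] at hsq
  rw [show (2 - σ + ρ + (α - 1)) / 2 = (1 + ρ + α - σ) / 2 by ring] at hpot
  set I₀ := ∫ t in s₁..s₂, t ^ ((2 * α - σ) / 2 - 1)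
  set I₁ := ∫ t in s₁..s₂, t ^ ((1 + ρ + α - σ) / 2 - 1)
  have hI : 0 ≤ I₀ := intervalIntegral.integral_nonneg hs₁₂ fun t ht =>
    Real.rpow_nonneg (hs₁.trans ht.1) _
  have hF₀ := hv.nonneg
  have key := hsq.add (HBd.sum Finset.univ fun j _ => hpot j)
  refine HBd.weaken (F := C * (F₀ * (D * N) * I₀) + ∑ _j : Fin 2, C * (F₁ * (D * (2 * N)) * I₁))
    ?_ ?_
  · convert! key using 1
    funext k
    simp only [pert, tpara, Pi.sub_apply, Pi.add_apply, Fin.sum_univ_two,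
      EnhancedPotential.X₁, EnhancedPotential.X₂]
    ring
  · rw [Fin.sum_univ_two]
    have : 0 ≤ C * D * N * (F₀ * I₀) := by positivity
    linarith

lemma pert_zero_left (hn : 2 ≤ n) (A : EnhancedPotential) (v : Freq → ℂ) : pert n A 0 v = 0 := by
  funext k
  simp [pert, tpara, (goodPara_para hn).zero]

lemma pert_smul_add (hn : 2 ≤ n) {α N : ℝ} {A : EnhancedPotential} (hA : PotBd n α N A)
    {v v' : Freq → ℂ} {F F' : ℝ} (hv : HBd 0 v F) (hv' : HBd 0 v' F') (c : ℂ) {s : ℝ}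
    (hs : 0 ≤ s) (hs' : s ≤ 1) :
    pert n A s (c • v + v') = c • pert n A s v + pert n A s v' := by
  obtain ⟨D, hD, hinv⟩ := exists_highBd_invLap (n := n) (by omega)
  have h1 := hA.α_gt
  have h2 := hA.α_lt
  have hlin := (goodPara_para hn).lin
  have hsq := hlin v v' _ (2 * α - 2) F F' _ s c (hv.mono (by norm_num)) (hv'.mono (by norm_num))
    (hinv _ _ _ (by linarith) (by linarith) hA.sq) (by linarith) hs hs'
  have hpot := fun j => hlin (partialD j v) (partialD j v') _ (α - 1) F F' _ s c
    (by simpa using hv.partialD j) (by simpa using hv'.partialD j)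
    (hinv _ _ _ (by linarith) (by linarith) (hA.pot j)) (by linarith) hs hs'
  funext k
  simp only [pert, tpara, Pi.add_apply, Pi.smul_apply, smul_eq_mul, Fin.sum_univ_two,
    partialD_smul_add, EnhancedPotential.X₁, EnhancedPotential.X₂, hsq, hpot]
  ring

lemma integral_rpow_zero {e s : ℝ} (he : 0 < e) : ∫ t in (0 : ℝ)..s, t ^ (e - 1) = s ^ e / e := by
  rw [integral_rpow (Or.inl (by linarith)), sub_add_cancel, Real.zero_rpow he.ne', sub_zero]

lemma integral_rpow_one_le {e s : ℝ} (he : e < 0) (hs : 0 < s) (hs' : s ≤ 1) :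
    ∫ t in s..1, t ^ (e - 1) ≤ s ^ e / (-e) := by
  rw [integral_rpow (Or.inr ⟨by linarith, by
    rw [uIcc_of_le hs']; exact fun h => absurd h.1 (not_le.mpr hs)⟩), sub_add_cancel, Real.one_rpow,
    ← neg_div_neg_eq]
  have : 0 < -e := by linarith
  gcongr
  linarith

/-- The truncated singular part from time `0`. -/
lemma exists_pert_bd_zero (hn : 2 ≤ n) : ∃ C : ℝ, 0 ≤ C ∧ ∀ (α N : ℝ) (A : EnhancedPotential),
    PotBd n α N A → ∀ (v : Freq → ℂ) (ρ σ F₀ F₁ s : ℝ), -1 ≤ ρ → ρ ≤ 0 → 0 ≤ σ → σ ≤ 2 →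
    HBd 0 v F₀ → HBd (ρ + 1) v F₁ → 0 ≤ s → s ≤ 1 →
    0 < (2 * α - σ) / 2 → 0 < (1 + ρ + α - σ) / 2 →
    HBd σ (pert n A s v)
      (C * N * (F₀ * (s ^ ((2 * α - σ) / 2) / ((2 * α - σ) / 2)) +
        F₁ * (s ^ ((1 + ρ + α - σ) / 2) / ((1 + ρ + α - σ) / 2)))) := by
  obtain ⟨C, hC, h⟩ := exists_pert_bd hn
  refine ⟨C, hC, fun α N A hA v ρ σ F₀ F₁ s hρ hρ' hσ hσ' hv hv' hs hs' h1 h2 => ?_⟩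
  have := h α N A hA v ρ σ F₀ F₁ 0 s hρ hρ' hσ hσ' hv hv' le_rfl hs hs' fun _ => ⟨h1, h2⟩
  rwa [pert_zero_left hn, sub_zero, integral_rpow_zero h1, integral_rpow_zero h2] at this

/-- The part of the singular part removed by the truncation belongs to `H²`. -/
lemma exists_pert_sub_bd (hn : 2 ≤ n) {α : ℝ} (hα : 2 / 3 < α) (hα' : α < 1) :
    ∃ C : ℝ, 0 ≤ C ∧ ∀ (N : ℝ) (A : EnhancedPotential),
    PotBd n α N A → ∀ (v : Freq → ℂ) (F s : ℝ), HBd 0 v F → 0 < s → s ≤ 1 →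
    HBd 2 (pert n A 1 v - pert n A s v) (C * N * s ^ ((α - 2) / 2) * F) := by
  obtain ⟨C, hC, h⟩ := exists_pert_bd hn
  have h1α : 0 < 1 - α := by linarith
  refine ⟨C * (1 / (1 - α) + 2), by positivity, fun N A hA v F s hv hs hs' => ?_⟩
  have := h α N A hA v (-1) 2 F F s 1 le_rfl (by norm_num) (by norm_num) le_rfl hv
    (by simpa using hv) hs.le hs' le_rfl fun h => absurd h hs.ne'
  refine this.weaken ?_
  have h1 := integral_rpow_one_le (e := (2 * α - 2) / 2) (by linarith) hs hs'
  have h2 := integral_rpow_one_le (e := (1 + -1 + α - 2) / 2) (by linarith) hs hs'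
  have hF := hv.nonneg
  have hN := hA.nonneg
  have h3 : s ^ ((2 * α - 2) / 2) / (-((2 * α - 2) / 2)) ≤ s ^ ((α - 2) / 2) * (1 / (1 - α)) := by
    rw [show -((2 * α - 2) / 2) = 1 - α by ring, div_eq_mul_one_div]
    refine mul_le_mul_of_nonneg_right ?_ (by positivity)
    exact Real.rpow_le_rpow_of_exponent_ge hs hs' (by linarith)
  have h4 : s ^ ((1 + -1 + α - 2) / 2) / (-((1 + -1 + α - 2) / 2)) ≤ s ^ ((α - 2) / 2) * 2 := by
    rw [show (1 + -1 + α - 2) / 2 = (α - 2) / 2 by ring, div_le_iff₀ (by linarith)]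
    nlinarith [Real.rpow_pos_of_pos hs ((α - 2) / 2)]
  calc _ ≤ C * N * (F * (s ^ ((α - 2) / 2) * (1 / (1 - α))) + F * (s ^ ((α - 2) / 2) * 2)) := by
        have := h1.trans h3
        have := h2.trans h4
        gcongr
    _ = _ := by ring

end Pert

section Rem

variable {n : ℕ} {α : ℝ}

lemma PotBd.remHyp_pot (hn : 1 ≤ n) {N : ℝ} {A : EnhancedPotential} (hA : PotBd n α N A)
    {v : Freq → ℂ} {F : ℝ} (hv : HBd (betaOf α) v F) (j : Fin 2) :
    RemHyp n (partialD j v) (A.twoI j) (betaOf α - 1) (α - 1) F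
      ((1 + 2 * n + 2 / (-(α - 1))) * (2 * N)) := by
  have h1 := hA.α_gt
  have h2 := hA.α_lt
  refine ⟨?_, ?_, ?_, hv.partialD j, (hA.pot j).fullBd hn (by linarith) (hA.pot_low j)⟩ <;>
    unfold betaOf <;> linarith

lemma PotBd.remHyp_sq (hn : 1 ≤ n) {N : ℝ} {A : EnhancedPotential} (hA : PotBd n α N A)
    {v : Freq → ℂ} {F : ℝ} (hv : HBd (betaOf α) v F) :
    RemHyp n v A.sq (betaOf α) (2 * α - 2) F ((1 + 2 * n + 2 / (-(2 * α - 2))) * N) := by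
  have h1 := hA.α_gt
  have h2 := hA.α_lt
  refine ⟨?_, ?_, ?_, hv, hA.sq.fullBd hn (by linarith) hA.sq_low⟩ <;>
    unfold betaOf <;> linarith

/-- The constant depends on `α` through `β + α - 2 > 0` and `β + 2α - 2 > 0`. -/
lemma exists_remPart_bd (hn : 2 ≤ n) (hα : 2 / 3 < α) (hα' : α < 1) :
    ∃ C : ℝ, 0 ≤ C ∧ ∀ (N : ℝ) (A : EnhancedPotential), PotBd n α N A →
    ∀ (v : Freq → ℂ) (F : ℝ), HBd (betaOf α) v F → L2Bd (remPart n A v) (C * N * F) := by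
  obtain ⟨C₁, hC₁, h1⟩ := (goodRem_para hn).est
  obtain ⟨C₂, hC₂, h2⟩ := (goodRem_reso hn).est
  set B₁ := (1 + 2 * n + 2 / (-(α - 1))) * 2 * (1 + 2 / (betaOf α - 1 + (α - 1))) with hB₁
  set B₂ := (1 + 2 * n + 2 / (-(2 * α - 2))) * (1 + 2 / (betaOf α + (2 * α - 2))) with hB₂
  have hB₁0 : 0 ≤ B₁ := by
    have : 0 < -(α - 1) := by linarith
    have : 0 < betaOf α - 1 + (α - 1) := by unfold betaOf; linarith
    positivity
  have hB₂0 : 0 ≤ B₂ := by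
    have : 0 < -(2 * α - 2) := by linarith
    have : 0 < betaOf α + (2 * α - 2) := by unfold betaOf; linarith
    positivity
  refine ⟨(C₁ + C₂) * (2 * B₁ + B₂), by positivity, fun N A hA v F hv => ?_⟩
  have hp := fun j => hA.remHyp_pot (by omega) hv j
  have hs := hA.remHyp_sq (by omega) hv
  have key := ((L2Bd.sum Finset.univ fun j _ =>
    (h1 _ _ _ _ _ _ (hp j)).add (h2 _ _ _ _ _ _ (hp j))).add (h1 _ _ _ _ _ _ hs)).add
      (h2 _ _ _ _ _ _ hs)
  refine L2Bd.weaken key (le_of_eq ?_)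
  rw [Fin.sum_univ_two, hB₁, hB₂]
  ring

lemma remPart_smul_add (hn : 2 ≤ n) {N : ℝ} {A : EnhancedPotential} (hA : PotBd n α N A)
    {v v' : Freq → ℂ} {F F' : ℝ} (hv : HBd (betaOf α) v F) (hv' : HBd (betaOf α) v' F') (c : ℂ) :
    remPart n A (c • v + v') = c • remPart n A v + remPart n A v' := by
  have hp := fun j => hA.remHyp_pot (by omega) hv j
  have hs := hA.remHyp_sq (by omega) hv
  have hp' := fun j => hA.remHyp_pot (by omega) hv' j
  have hs' := hA.remHyp_sq (by omega) hv'
  have h1 := fun j => (goodRem_para hn).lin _ _ _ _ _ _ _ _ c (hp j) (hp' j)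
  have h2 := fun j => (goodRem_reso hn).lin _ _ _ _ _ _ _ _ c (hp j) (hp' j)
  have h3 := (goodRem_para hn).lin _ _ _ _ _ _ _ _ c hs hs'
  have h4 := (goodRem_reso hn).lin _ _ _ _ _ _ _ _ c hs hs'
  simp only [remPart, Fin.sum_univ_two, partialD_smul_add, h1, h2, h3, h4, smul_add]
  abel

end Rem

/-! ### Regularity of the domain and comparison with the Laplacian -/

/-- The norm of the Sobolev space `H^ρ`. -/
def hNorm (ρ : ℝ) (f : Freq → ℂ) : ℝ :=
  l2Norm fun k => (((1 + xiSq k) ^ (ρ / 2) : ℝ) : ℂ) * f k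

lemma HBd.hNorm_le {ρ F : ℝ} {f : Freq → ℂ} (h : HBd ρ f F) : hNorm ρ f ≤ F := L2Bd.l2Norm_le h

lemma HBd.self {ρ F : ℝ} {f : Freq → ℂ} (h : HBd ρ f F) : HBd ρ f (hNorm ρ f) :=
  L2Bd.of_memL2 (L2Bd.memL2 h)

lemma sub_lap_eq (f : Freq → ℂ) :
    f - lap f = fun k => (((1 + xiSq k) ^ ((2 : ℝ) / 2) : ℝ) : ℂ) * f k := by
  funext k
  rw [div_self two_ne_zero, Real.rpow_one]
  simp only [lap, Pi.sub_apply]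
  push_cast
  ring

lemma memH2_iff {f : Freq → ℂ} : MemH2 f ↔ ∃ F, HBd 2 f F := by
  unfold MemH2
  rw [sub_lap_eq]
  exact ⟨fun h => ⟨_, L2Bd.of_memL2 h⟩, fun ⟨F, h⟩ => L2Bd.memL2 h⟩

lemma h2Norm_eq (f : Freq → ℂ) : h2Norm f = hNorm 2 f := by
  rw [h2Norm, hNorm, sub_lap_eq]

lemma HBd.lap {f : Freq → ℂ} {F : ℝ} (h : HBd 2 f F) : L2Bd (lap f) F := by
  refine L2Bd.mono h fun k => ?_
  have hk := xiSq_nonneg k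
  rw [div_self two_ne_zero, Real.rpow_one]
  simp only [MagneticLaplacian.lap, norm_mul, norm_neg, Complex.norm_real]
  rw [Real.norm_of_nonneg hk, Real.norm_of_nonneg (by linarith)]
  gcongr
  linarith

lemma lap_add (f g : Freq → ℂ) : lap (f + g) = lap f + lap g := by
  funext k; simp [lap, mul_add]

lemma lap_sub (f g : Freq → ℂ) : lap (f - g) = lap f - lap g := by
  funext k; simp [lap]; ring

lemma lap_smul (c : ℂ) (f : Freq → ℂ) : lap (c • f) = c • lap f := by
  funext k; simp [lap]; ring

variable {n : ℕ}

/-- A function `v ∈ L²` with `Φ(v) ∈ H²` belongs to `H^β`: two steps of regularity, from `L²` to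
`H^{β/2}` and on to `H^β`. -/
lemma exists_hBd_betaOf (hn : 2 ≤ n) {α N : ℝ} {A : EnhancedPotential} (hA : PotBd n α N A)
    {v : Freq → ℂ} {F G : ℝ} (hv : HBd 0 v F) (hG : HBd 2 (v - pert n A 1 v) G) :
    ∃ F', HBd (betaOf α) v F' := by
  obtain ⟨C, hC, h⟩ := exists_pert_bd_zero hn
  have h1 := hA.α_gt
  have h2 := hA.α_lt
  have hβ : betaOf α = 2 / 3 + α := by unfold betaOf; ring
  have step : ∀ σ F', σ ≤ 2 → HBd σ (pert n A 1 v) F' → HBd σ v (G + F') := by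
    intro σ F' hσ h'
    simpa using (hG.mono hσ).add h'
  have ha := step (betaOf α / 2) _ (by linarith) (h α N A hA v (-1) (betaOf α / 2) F F 1 le_rfl
    (by norm_num) (by linarith) (by linarith) hv (by simpa using hv) zero_le_one le_rfl
    (by linarith) (by linarith))
  exact ⟨_, step (betaOf α) _ (by linarith) (h α N A hA v (betaOf α / 2 - 1) (betaOf α) F _ 1
    (by linarith) (by linarith) (by linarith) (by linarith) hv (by simpa using ha) zero_le_one
    le_rfl (by linarith) (by linarith))⟩

/-- The singular part is a contraction of `H^β` for small `s`. -/
lemma exists_pert_bd_betaOf (hn : 2 ≤ n) : ∃ m : ℝ, 0 ≤ m ∧ ∀ (α N : ℝ) (A : EnhancedPotential),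
    PotBd n α N A → ∀ (v : Freq → ℂ) (F s : ℝ), HBd (betaOf α) v F → 0 < s → s ≤ 1 →
    HBd (betaOf α) (pert n A s v)
      (m * (s ^ ((2 * α - betaOf α) / 4) / betaStar α (betaOf α)) * N * F) := by
  obtain ⟨C, hC, h⟩ := exists_pert_bd_zero hn
  refine ⟨4 * C, by positivity, fun α N A hA v F s hv hs hs' => ?_⟩
  have h1 := hA.α_gt
  have h2 := hA.α_lt
  have hN := hA.nonneg
  have hF := hv.nonneg
  have hβ : betaOf α = 2 / 3 + α := by unfold betaOf; ring
  have hstar : betaStar α (betaOf α) = 2 * α - betaOf α := by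
    unfold betaStar; rw [if_neg (by linarith)]
  have key := h α N A hA v 0 (betaOf α) F F s (by norm_num) le_rfl (by linarith) (by linarith)
    (hv.mono (by linarith)) (hv.mono (by linarith)) hs.le hs' (by linarith) (by linarith)
  refine key.weaken ?_
  rw [hstar]
  set d := 2 * α - betaOf α with hd
  have hd0 : 0 < d := by linarith
  have hd1 : d ≤ 1 / 3 := by linarith
  have e1 : s ^ (d / 2) / (d / 2) ≤ 2 * (s ^ (d / 4) / d) := by
    rw [show s ^ (d / 2) / (d / 2) = 2 * (s ^ (d / 2) / d) by field_simp]
    have := Real.rpow_le_rpow_of_exponent_ge hs hs' (show d / 4 ≤ d / 2 by linarith)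
    gcongr
  have e2 : s ^ ((1 + 0 + α - betaOf α) / 2) / ((1 + 0 + α - betaOf α) / 2) ≤
      2 * (s ^ (d / 4) / d) := by
    have h6 : (1 + 0 + α - betaOf α) / 2 = 1 / 6 := by rw [hβ]; ring
    rw [h6, div_le_iff₀ (by norm_num)]
    have h3 := Real.rpow_le_rpow_of_exponent_ge hs hs' (show d / 4 ≤ 1 / 6 by linarith)
    have h4 : s ^ (d / 4) * 3 ≤ s ^ (d / 4) / d := by
      rw [le_div_iff₀ hd0]
      nlinarith [Real.rpow_pos_of_pos hs (d / 4)]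
    linarith
  calc _ ≤ C * N * (F * (2 * (s ^ (d / 4) / d)) + F * (2 * (s ^ (d / 4) / d))) := by gcongr
    _ = _ := by ring

lemma exists_pert_bd_l2 (hn : 2 ≤ n) : ∃ C : ℝ, 0 ≤ C ∧ ∀ (α N : ℝ) (A : EnhancedPotential),
    PotBd n α N A → ∀ (v : Freq → ℂ) (F s : ℝ), HBd 0 v F → 0 < s → s ≤ 1 →
    HBd 0 (pert n A s v) (C * s ^ (α / 2) * N * F) := by
  obtain ⟨C, hC, h⟩ := exists_pert_bd_zero hn
  refine ⟨5 * C, by positivity, fun α N A hA v F s hv hs hs' => ?_⟩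
  have h1 := hA.α_gt
  have h2 := hA.α_lt
  have hN := hA.nonneg
  have hF := hv.nonneg
  have key := h α N A hA v (-1) 0 F F s le_rfl (by norm_num) le_rfl (by norm_num)
    hv (by simpa using hv) hs.le hs' (by linarith) (by linarith)
  refine key.weaken ?_
  have hp := Real.rpow_pos_of_pos hs (α / 2)
  have e1 : s ^ ((2 * α - 0) / 2) / ((2 * α - 0) / 2) ≤ 2 * s ^ (α / 2) := by
    rw [div_le_iff₀ (by linarith)]
    have := Real.rpow_le_rpow_of_exponent_ge hs hs' (show α / 2 ≤ (2 * α - 0) / 2 by linarith)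
    nlinarith
  have e2 : s ^ ((1 + -1 + α - 0) / 2) / ((1 + -1 + α - 0) / 2) ≤ 3 * s ^ (α / 2) := by
    rw [show (1 + -1 + α - 0) / 2 = α / 2 by ring, div_le_iff₀ (by linarith)]
    nlinarith
  calc _ ≤ C * N * (F * (2 * s ^ (α / 2)) + F * (3 * s ^ (α / 2))) := by gcongr
    _ = _ := by ring

/-- Young's inequality `K y^{β/2} ≤ δ y + K^{2/(2-β)} δ^{-β/(2-β)}`. -/
lemma mul_rpow_le_young {K y δ β : ℝ} (hK : 0 ≤ K) (hy : 0 < y) (hδ : 0 < δ) (hβ : 0 < β)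
    (hβ' : β < 2) :
    K * y ^ (β / 2) ≤ δ * y + K ^ (2 / (2 - β)) * δ ^ (-(β / (2 - β))) := by
  have h2 : 0 < 2 - β := by linarith
  by_cases h : K * y ^ (β / 2) ≤ δ * y
  · have : 0 ≤ K ^ (2 / (2 - β)) * δ ^ (-(β / (2 - β))) := by positivity
    linarith
  · push Not at h
    have hK0 : 0 < K := by
      rcases hK.eq_or_lt with rfl | h'
      · rw [zero_mul] at h
        exact absurd h (by positivity : 0 ≤ δ * y).not_gt
      · exact h'
    have h3 : y ^ (1 - β / 2) ≤ K / δ := by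
      rw [le_div_iff₀ hδ, Real.rpow_sub hy, Real.rpow_one, div_mul_eq_mul_div,
        div_le_iff₀ (by positivity)]
      linarith
    have h4 : y ^ (β / 2) ≤ (K / δ) ^ (β / (2 - β)) := by
      calc y ^ (β / 2) = (y ^ (1 - β / 2)) ^ (β / (2 - β)) := by
            rw [← Real.rpow_mul hy.le]; congr 1; field_simp
        _ ≤ _ := Real.rpow_le_rpow (by positivity) h3 (by positivity)
    have h5 : K * (K / δ) ^ (β / (2 - β)) = K ^ (2 / (2 - β)) * δ ^ (-(β / (2 - β))) := by
      rw [Real.div_rpow hK hδ.le, Real.rpow_neg hδ.le,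
        show 2 / (2 - β) = 1 + β / (2 - β) by field_simp; ring, Real.rpow_add hK0, Real.rpow_one]
      ring
    have : K * y ^ (β / 2) ≤ K * (K / δ) ^ (β / (2 - β)) := by gcongr
    have : 0 ≤ δ * y := by positivity
    linarith

/-- Interpolation of `H^β` between `L²` and `H²`, in which the zero mode is kept apart so that only
`Δw` appears with the small constant `δ`. -/
lemma mul_hNorm_le {K δ β W G : ℝ} {w : Freq → ℂ} (hK : 0 ≤ K) (hδ : 0 < δ) (hβ : 0 < β)
    (hβ' : β < 2) (hG : HBd 2 w G) (hW : L2Bd w W) :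
    K * hNorm β w ≤ K * ‖w 0‖ + δ * l2Norm (lap w) +
      (2 * K) ^ (2 / (2 - β)) * δ ^ (-(β / (2 - β))) * W := by
  set Y := (2 * K) ^ (2 / (2 - β)) * δ ^ (-(β / (2 - β))) with hY
  have hY0 : 0 ≤ Y := by positivity
  have hD : 0 ≤ l2Norm (lap w) := Real.sqrt_nonneg _
  have hR : 0 ≤ K * ‖w 0‖ + δ * l2Norm (lap w) + Y * W := by
    have := hW.nonneg
    positivity
  rcases hK.eq_or_lt with rfl | hK0
  · simpa using hR
  have h0 : L2Bd (fun k => if k = 0 then w 0 else 0) ‖w 0‖ := by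
    refine ⟨norm_nonneg _, fun S => ?_⟩
    have : ∀ k ∈ S, ‖(if k = 0 then w 0 else 0 : ℂ)‖ ^ 2 = if k = 0 then ‖w 0‖ ^ 2 else 0 := by
      intro k _
      split_ifs <;> simp
    rw [Finset.sum_congr rfl this, Finset.sum_ite_eq']
    split_ifs
    · exact le_rfl
    · positivity
  have hn : ∀ {f : Freq → ℂ} {C : ℝ}, L2Bd f C → L2Bd (fun k => (‖f k‖ : ℂ)) C := fun h =>
    h.mono fun k => by simp
  have hsum : L2Bd (fun k => ((K * ‖(if k = 0 then w 0 else 0 : ℂ)‖ + δ * ‖lap w k‖ +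
      Y * ‖w k‖ : ℝ) : ℂ)) (K * ‖w 0‖ + δ * l2Norm (lap w) + Y * W) := by
    have := (((hn h0).smul (K : ℂ)).add ((hn (L2Bd.of_memL2 hG.lap.memL2)).smul (δ : ℂ))).add
      ((hn hW).smul (Y : ℂ))
    simp only [Complex.norm_real, Real.norm_of_nonneg hK, Real.norm_of_nonneg hδ.le,
      Real.norm_of_nonneg hY0] at this
    convert! this using 1
    funext k
    simp only [Pi.add_apply, Pi.smul_apply, smul_eq_mul]
    push_cast
    ring
  have hB : HBd β w (K⁻¹ * (K * ‖w 0‖ + δ * l2Norm (lap w) + Y * W)) := by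
    refine L2Bd.of_le hsum (by positivity) fun k => ?_
    rw [inv_mul_eq_div, le_div_iff₀ hK0]
    have hk := xiSq_nonneg k
    have hk0 := one_add_xiSq_pos k
    rw [Complex.norm_real, Real.norm_of_nonneg (by positivity), norm_mul, Complex.norm_real,
      Real.norm_of_nonneg (Real.rpow_nonneg hk0.le _)]
    by_cases hk' : k = 0
    · subst hk'
      simp only [xiSq_zero, add_zero, Real.one_rpow, one_mul, if_true]
      have : 0 ≤ δ * ‖lap w 0‖ + Y * ‖w 0‖ := by positivity
      linarith
    · have hk1 := one_le_xiSq hk'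
      have hk2 : 0 < xiSq k := by linarith
      have h3 : (1 + xiSq k) ^ (β / 2) ≤ 2 * xiSq k ^ (β / 2) := by
        calc (1 + xiSq k) ^ (β / 2) ≤ (2 * xiSq k) ^ (β / 2) :=
              Real.rpow_le_rpow (by positivity) (by linarith) (by linarith)
          _ = 2 ^ (β / 2) * xiSq k ^ (β / 2) := Real.mul_rpow (by norm_num) hk
          _ ≤ 2 ^ (1 : ℝ) * xiSq k ^ (β / 2) := by
              gcongr
              · norm_num
              · linarith
          _ = _ := by rw [Real.rpow_one]
      have hy := mul_rpow_le_young (K := 2 * K) (by positivity) hk2 hδ hβ hβ'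
      have hl : ‖lap w k‖ = xiSq k * ‖w k‖ := by
        rw [lap, norm_mul, norm_neg, Complex.norm_real, Real.norm_of_nonneg hk]
      rw [if_neg hk', norm_zero, mul_zero, zero_add, hl]
      calc _ ≤ 2 * xiSq k ^ (β / 2) * ‖w k‖ * K := by gcongr
        _ = (2 * K * xiSq k ^ (β / 2)) * ‖w k‖ := by ring
        _ ≤ (δ * xiSq k + Y) * ‖w k‖ := by gcongr
        _ = _ := by ring
  have := mul_le_mul_of_nonneg_left hB.hNorm_le hK
  rwa [mul_inv_cancel_left₀ hK0.ne'] at this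

/-- The operator `v ↦ -ΔΦ(v) + R(v)` on Fourier coefficients. -/
def opSeq (n : ℕ) (A : EnhancedPotential) (v : Freq → ℂ) : Freq → ℂ :=
  -lap (v - pert n A 1 v) + remPart n A v

/-- For `s` below the threshold, `‖v‖_{H^β}` is at most twice `‖Φˢ(v)‖_{H^β}`. -/
lemma hNorm_le_two_mul {β θ : ℝ} {v p : Freq → ℂ} {F G : ℝ} (hv : HBd β v F)
    (hp : HBd β p (θ * hNorm β v)) (hw : HBd β (v - p) G) (hθ : θ ≤ 1 / 2) :
    hNorm β v ≤ 2 * hNorm β (v - p) := by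
  have h1 : HBd β v (hNorm β (v - p) + θ * hNorm β v) := by
    simpa using hw.self.add hp
  have h2 := h1.hNorm_le
  have h3 : 0 ≤ hNorm β v := hv.self.nonneg
  nlinarith

/-- The explicit constants in the comparison of the operator with `-ΔΦˢ`. The summand `C₀ N F`
leaves room for the `L²` norm of `Φˢ(v)`, which is part of its norm in `H²`. -/
lemma error_le_mDeltaSq {C₀ C₁ C₂ κ m α δ s N F : ℝ} (hC₀ : 0 ≤ C₀) (hC₁ : 0 ≤ C₁) (hC₂ : 0 ≤ C₂)
    (hκ : κ = 1 + C₁ + 2 * C₂ + C₀ + (4 * C₂) ^ (2 / (2 - betaOf α)) * (1 + C₀)) (hα : α < 1)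
    (hN : 0 ≤ N) (hF : 0 ≤ F) (hs : 0 < s) (hs' : s ≤ 1) (hδ : 0 < δ)
    (hθ : 0 ≤ m * (s ^ ((2 * α - betaOf α) / 4) / betaStar α (betaOf α)) * N)
    (hθ' : m * (s ^ ((2 * α - betaOf α) / 4) / betaStar α (betaOf α)) * N < 1) :
    C₁ * N * s ^ ((α - 2) / 2) * F + 2 * C₂ * N * F + C₀ * N * F +
      (2 * (2 * C₂ * N)) ^ (2 / (2 - betaOf α)) * δ ^ (-(betaOf α / (2 - betaOf α))) *
        (F * (1 + C₀ * s ^ (α / 2) * N)) ≤ mDeltaSq m κ α δ s N * F := by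
  have hβ2 : 0 < 2 - betaOf α := by unfold betaOf; linarith
  unfold mDeltaSq
  have hS1 : 1 ≤ s ^ ((α - 2) / 2) :=
    Real.one_le_rpow_of_pos_of_le_one_of_nonpos hs hs' (by linarith)
  have hr0 : 0 < s ^ (α / 2) := Real.rpow_pos_of_pos hs _
  have hp0 : 0 < 2 / (2 - betaOf α) := by positivity
  have hd : 0 ≤ δ ^ (-(betaOf α / (2 - betaOf α))) := by positivity
  generalize δ ^ (-(betaOf α / (2 - betaOf α))) = d at *
  generalize s ^ ((α - 2) / 2) = S at *
  generalize s ^ (α / 2) = r at *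
  generalize m * (s ^ ((2 * α - betaOf α) / 4) / betaStar α (betaOf α)) * N = θ at *
  generalize 2 / (2 - betaOf α) = p at *
  have hY : 0 ≤ (4 * C₂) ^ p := by positivity
  have hN' : N ≤ N / (1 - θ) := by
    rw [le_div_iff₀ (by linarith)]
    nlinarith
  have h6 : (2 * (2 * C₂ * N)) ^ p ≤ (4 * C₂) ^ p * (N / (1 - θ)) ^ p := by
    rw [show 2 * (2 * C₂ * N) = 4 * C₂ * N by ring, Real.mul_rpow (by positivity) hN]
    gcongr
  have h9 : 0 ≤ (N / (1 - θ)) ^ p := Real.rpow_nonneg (div_nonneg hN (by linarith)) _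
  generalize (N / (1 - θ)) ^ p = Z at *
  generalize (4 * C₂) ^ p = Y at *
  have hYC : 0 ≤ Y * (1 + C₀) := by positivity
  have hκ0 : 0 ≤ κ := by rw [hκ]; linarith
  have h7 : Y * (1 + C₀ * r * N) ≤ κ * (1 + r * N) := by
    have hrN : 0 ≤ r * N := by positivity
    have : 1 + C₀ * r * N ≤ (1 + C₀) * (1 + r * N) := by nlinarith
    calc Y * (1 + C₀ * r * N) ≤ Y * ((1 + C₀) * (1 + r * N)) := by gcongr
      _ = (Y * (1 + C₀)) * (1 + r * N) := by ring
      _ ≤ κ * (1 + r * N) := by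
        refine mul_le_mul_of_nonneg_right ?_ (by positivity)
        rw [hκ]
        linarith
  have h8 : C₁ * S + 2 * C₂ + C₀ ≤ κ * S := by
    have : (C₁ + 2 * C₂ + C₀) * S ≤ κ * S := by
      refine mul_le_mul_of_nonneg_right ?_ (by linarith)
      rw [hκ]
      linarith
    nlinarith
  calc _ = (C₁ * S + 2 * C₂ + C₀) * (N * F) + (2 * (2 * C₂ * N)) ^ p * (d *
        (F * (1 + C₀ * r * N))) := by ring
    _ ≤ (κ * S) * (N * F) + (Y * Z) * (d * (F * (1 + C₀ * r * N))) := by gcongr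
    _ = (κ * S) * (N * F) + Z * d * F * (Y * (1 + C₀ * r * N)) := by ring
    _ ≤ (κ * S) * (N * F) + Z * d * F * (κ * (1 + r * N)) := by gcongr
    _ = _ := by ring

/-- The comparison of the operator with `-ΔΦˢ`. Taking `m` to be at least twice the contraction
constant of the singular part keeps `‖v‖_{H^β} ≤ 2 ‖Φˢ(v)‖_{H^β}` for every `s` below the
threshold, so that the constants do not degenerate there. -/
lemma exists_opSeq_bounds (hn : 2 ≤ n) : ∃ m : ℝ, 0 < m ∧ ∀ α : ℝ, 2 / 3 < α → α < 1 →
    ∃ κ : ℝ, 0 < κ ∧ ∀ (N : ℝ) (A : EnhancedPotential), PotBd n α N A → ∀ s : ℝ, 0 < s → s < 1 →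
    m * (s ^ ((2 * α - betaOf α) / 4) / betaStar α (betaOf α)) * N < 1 →
    ∀ (v : Freq → ℂ) (F G : ℝ), HBd 0 v F → HBd 2 (v - pert n A s v) G →
      MemL2 (opSeq n A v) → ∀ δ : ℝ, 0 < δ →
      l2Norm (opSeq n A v) ≤ (1 + δ) * l2Norm (lap (v - pert n A s v)) +
        mDeltaSq m κ α δ s N * F ∧
      (1 - δ) * l2Norm (lap (v - pert n A s v)) ≤ l2Norm (opSeq n A v) +
        mDeltaSq m κ α δ s N * F ∧
      (1 - δ) * hNorm 2 (v - pert n A s v) ≤ l2Norm (opSeq n A v) +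
        (κ + mDeltaSq m κ α δ s N) * F := by
  obtain ⟨m₀, hm₀, hcontr⟩ := exists_pert_bd_betaOf hn
  obtain ⟨C₀, hC₀, hl2⟩ := exists_pert_bd_l2 hn
  refine ⟨2 * m₀ + 1, by positivity, fun α hα hα' => ?_⟩
  obtain ⟨C₁, hC₁, hsub⟩ := exists_pert_sub_bd hn hα hα'
  obtain ⟨C₂, hC₂, hrem⟩ := exists_remPart_bd hn hα hα'
  have hβ : betaOf α = 2 / 3 + α := by unfold betaOf; ring
  set β := betaOf α with hβdef
  have hβ2 : 0 < 2 - β := by linarith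
  set κ := 1 + C₁ + 2 * C₂ + C₀ + (4 * C₂) ^ (2 / (2 - β)) * (1 + C₀) with hκ
  have hY : 0 ≤ (4 * C₂) ^ (2 / (2 - β)) := by positivity
  refine ⟨κ, by positivity, fun N A hA s hs hs' hθ v F G hv hG hop δ hδ => ?_⟩
  have hN := hA.nonneg
  have hF := hv.nonneg
  set θ := (2 * m₀ + 1) * (s ^ ((2 * α - β) / 4) / betaStar α β) * N with hθdef
  have hstar : betaStar α β = 2 * α - β := by
    unfold betaStar; rw [if_neg (by linarith)]
  have hX : 0 ≤ s ^ ((2 * α - β) / 4) / betaStar α β := by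
    rw [hstar]
    have : 0 < 2 * α - β := by linarith
    positivity
  have hθ0 : 0 ≤ θ := by positivity
  set S := s ^ ((α - 2) / 2) with hS
  have hS1 : 1 ≤ S := Real.one_le_rpow_of_pos_of_le_one_of_nonpos hs hs'.le (by linarith)
  set r := s ^ (α / 2) with hr
  have hr0 : 0 < r := Real.rpow_pos_of_pos hs _
  have hr1 : r ≤ 1 := Real.rpow_le_one hs.le hs'.le (by linarith)
  set w := v - pert n A s v with hw
  have hvw : HBd 2 (v - pert n A 1 v) (G + C₁ * N * S * F) := by
    have := hG.sub (hsub N A hA v F s hv hs hs'.le)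
    convert! this using 1
    rw [hw]; abel
  obtain ⟨F', hvβ⟩ := exists_hBd_betaOf hn hA hv hvw
  have hvβ' := hvβ.self
  have hwβ : HBd β w (hNorm β w) := (hG.mono (by linarith)).self
  have h2 : hNorm β v ≤ 2 * hNorm β w := by
    refine hNorm_le_two_mul hvβ (hcontr α N A hA v _ s hvβ' hs hs'.le) hwβ ?_
    have : 2 * (m₀ * (s ^ ((2 * α - β) / 4) / betaStar α β) * N) ≤ θ := by
      rw [hθdef]
      have : 0 ≤ (s ^ ((2 * α - β) / 4) / betaStar α β) * N := by positivity
      linarith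
    linarith
  have hW : L2Bd w (F * (1 + C₀ * r * N)) := by
    have := hv.sub (hl2 α N A hA v F s hv hs hs'.le)
    exact (HBd.zero_iff.mp this).weaken (le_of_eq (by ring))
  have hw0 : ‖w 0‖ ≤ F := by
    rw [hw, Pi.sub_apply, pert_apply_zero, sub_zero]
    exact (HBd.zero_iff.mp hv).apply_le 0
  have hyoung := mul_hNorm_le (K := 2 * C₂ * N) (β := β) (by positivity) hδ (by linarith) (by linarith)
    hG hW
  set D := l2Norm (lap w) with hD
  have hlap : L2Bd (lap w) D := L2Bd.of_memL2 hG.lap.memL2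
  have hop' : L2Bd (opSeq n A v) (l2Norm (opSeq n A v)) := L2Bd.of_memL2 hop
  set M := mDeltaSq (2 * m₀ + 1) κ α δ s N with hM
  set p := 2 / (2 - β) with hp
  have hp0 : 0 < p := by positivity
  have h5 := error_le_mDeltaSq (m := 2 * m₀ + 1) (δ := δ) hC₀ hC₁ hC₂ hκ hα' hN hF hs hs'.le hδ hθ0
    hθ
  rw [← hβdef, ← hp, ← hM, ← hS, ← hr] at h5
  -- The error `opSeq v + Δw` is the sum of `Δ(pert¹ v - pertˢ v)` and the remainder.
  have herr : L2Bd (opSeq n A v + lap w) (δ * D + (M - C₀ * N) * F) := by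
    have h3 := (hsub N A hA v F s hv hs hs'.le).lap.add (hrem N A hA v _ hvβ')
    have heq : opSeq n A v + lap w = lap (pert n A 1 v - pert n A s v) + remPart n A v := by
      rw [opSeq, hw, lap_sub, lap_sub, lap_sub]; abel
    rw [heq]
    refine h3.weaken ?_
    have h4 : C₂ * N * hNorm β v ≤ 2 * C₂ * N * hNorm β w := by
      calc _ ≤ C₂ * N * (2 * hNorm β w) := by gcongr
        _ = _ := by ring
    have h10 : 2 * C₂ * N * ‖w 0‖ ≤ 2 * C₂ * N * F := by gcongr
    linarith
  have h11 : l2Norm (opSeq n A v) ≤ δ * D + (M - C₀ * N) * F + D := by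
    refine L2Bd.l2Norm_le ?_
    simpa using herr.sub hlap
  have h12 : D ≤ δ * D + (M - C₀ * N) * F + l2Norm (opSeq n A v) := by
    refine L2Bd.l2Norm_le ?_
    simpa using herr.sub hop'
  have hCN : 0 ≤ C₀ * N * F := by positivity
  refine ⟨by linarith, by linarith, ?_⟩
  have hw2 : hNorm 2 w ≤ D + F * (1 + C₀ * r * N) := by
    have h13 : HBd 2 w (D + F * (1 + C₀ * r * N)) := by
      have := hlap.neg.add hW
      refine this.mono fun k => le_of_eq ?_
      rw [← congrFun (sub_lap_eq w) k]
      simp [sub_eq_add_neg, add_comm]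
    exact h13.hNorm_le
  have hwn : 0 ≤ hNorm 2 w := hG.self.nonneg
  have hκ1 : F ≤ κ * F := by
    refine le_mul_of_one_le_left hF ?_
    have : 0 ≤ (4 * C₂) ^ p * (1 + C₀) := by positivity
    rw [hκ]
    linarith
  rcases le_total δ 1 with h | h
  · have h13 : C₀ * r * N * F ≤ C₀ * N * F := by
      have : C₀ * r * N * F = C₀ * N * F * r := by ring
      rw [this]
      exact mul_le_of_le_one_right hCN hr1
    have h14 : (1 - δ) * hNorm 2 w ≤ (1 - δ) * (D + F * (1 + C₀ * r * N)) :=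
      mul_le_mul_of_nonneg_left hw2 (by linarith)
    have h15 : 0 ≤ δ * (F * (1 + C₀ * r * N)) := by positivity
    linarith
  · have h16 : (1 - δ) * hNorm 2 w ≤ 0 := mul_nonpos_of_nonpos_of_nonneg (by linarith) hwn
    have h17 : 0 ≤ M * F := le_trans (by positivity) h5
    have h18 := hop'.nonneg
    linarith

variable {α N : ℝ} {A : EnhancedPotential}

/-! ### The operator and its domain -/

lemma hBd_coeff (u : L2T) : HBd 0 (coeff u) ‖u‖ := HBd.zero_iff.mpr (l2Bd_coeff u)

lemma coeff_smul_add (c : ℂ) (u v : L2T) : coeff (c • u + v) = c • coeff u + coeff v := by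
  rw [coeff_add, coeff_smul]

lemma Phi_smul_add (hn : 2 ≤ n) (hA : PotBd n α N A) {s : ℝ} (hs : 0 ≤ s) (hs' : s ≤ 1) (c : ℂ)
    (u v : L2T) : Phi n A s (c • u + v) = c • Phi n A s u + Phi n A s v := by
  simp only [Phi_eq, coeff_smul_add]
  rw [pert_smul_add hn hA (hBd_coeff u) (hBd_coeff v) c hs hs', smul_sub]
  abel

lemma memH2_smul_add {f g : Freq → ℂ} (c : ℂ) (hf : MemH2 f) (hg : MemH2 g) :
    MemH2 (c • f + g) := by
  obtain ⟨F, hF⟩ := memH2_iff.mp hf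
  obtain ⟨G, hG⟩ := memH2_iff.mp hg
  exact memH2_iff.mpr ⟨_, (hF.smul c).add hG⟩

/-- Membership in the domain may be tested with any truncation. -/
lemma memH2_Phi_iff (hn : 2 ≤ n) (hA : PotBd n α N A) {s : ℝ} (hs : 0 < s) (hs' : s ≤ 1) (u : L2T) :
    MemH2 (Phi n A s u) ↔ MemH2 (Phi n A 1 u) := by
  obtain ⟨C, hC, h⟩ := exists_pert_sub_bd hn hA.α_gt hA.α_lt
  have h1 := h N A hA (coeff u) _ s (hBd_coeff u) hs hs'
  simp only [memH2_iff, Phi_eq]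
  constructor
  · rintro ⟨F, hF⟩
    have := hF.sub h1
    rw [sub_sub, add_comm, sub_add_cancel] at this
    exact ⟨_, this⟩
  · rintro ⟨F, hF⟩
    have := hF.add h1
    rw [sub_add_sub_cancel] at this
    exact ⟨_, this⟩

/-- The domain of the operator, as a subspace of `L²`. -/
def domainSubmodule (hn : 2 ≤ n) (hA : PotBd n α N A) : Submodule ℂ L2T where
  carrier := domain n A
  add_mem' {u v} hu hv := by
    have h := memH2_smul_add 1 hu hv
    rw [← Phi_smul_add hn hA zero_le_one le_rfl, one_smul] at h
    exact h
  zero_mem' := by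
    have h0 : coeff (0 : L2T) = 0 := by simpa using coeff_smul 0 (0 : L2T)
    have h1 : HBd 2 (Phi n A 1 (0 : L2T)) 0 := by
      have := Phi_smul_add hn hA zero_le_one le_rfl (-1) (0 : L2T) 0
      rw [smul_zero, add_zero, neg_one_smul, neg_add_cancel] at this
      rw [this]
      exact HBd.zero
    exact memH2_iff.mpr ⟨_, h1⟩
  smul_mem' c u hu := by
    have h := memH2_smul_add (c - 1) hu hu
    rw [← Phi_smul_add hn hA zero_le_one le_rfl, sub_smul, one_smul, sub_add_cancel] at h
    exact h

lemma exists_hBd_coeff (hn : 2 ≤ n) (hA : PotBd n α N A) {u : L2T} (hu : u ∈ domain n A) :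
    ∃ F, HBd (betaOf α) (coeff u) F := by
  obtain ⟨G, hG⟩ := memH2_iff.mp hu
  rw [Phi_eq] at hG
  exact exists_hBd_betaOf hn hA (hBd_coeff u) hG

lemma memL2_opSeq (hn : 2 ≤ n) (hA : PotBd n α N A) {u : L2T} (hu : u ∈ domain n A) :
    MemL2 (opSeq n A (coeff u)) := by
  obtain ⟨G, hG⟩ := memH2_iff.mp hu
  rw [Phi_eq] at hG
  obtain ⟨F, hF⟩ := exists_hBd_coeff hn hA hu
  obtain ⟨C, hC, h⟩ := exists_remPart_bd hn hA.α_gt hA.α_lt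
  exact (hG.lap.neg.add (h N A hA _ _ hF)).memL2

lemma opSeq_smul_add (hn : 2 ≤ n) (hA : PotBd n α N A) {u v : L2T} (hu : u ∈ domain n A)
    (hv : v ∈ domain n A) (c : ℂ) :
    opSeq n A (coeff (c • u + v)) = c • opSeq n A (coeff u) + opSeq n A (coeff v) := by
  obtain ⟨F, hF⟩ := exists_hBd_coeff hn hA hu
  obtain ⟨G, hG⟩ := exists_hBd_coeff hn hA hv
  simp only [opSeq, ← Phi_eq, Phi_smul_add hn hA zero_le_one le_rfl]
  rw [coeff_smul_add, remPart_smul_add hn hA hF hG, lap_add, lap_smul, smul_add, smul_neg]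
  abel

lemma exists_isMagneticLaplacian (hn : 2 ≤ n) (hA : PotBd n α N A) :
    ∃ H : L2T →ₗ.[ℂ] L2T, IsMagneticLaplacian n A H := by
  have hex : ∀ u : domainSubmodule hn hA, ∃ h : L2T, coeff h = opSeq n A (coeff (u : L2T)) :=
    fun u => exists_coeff_eq (memL2_opSeq hn hA u.2)
  choose T hT using hex
  have hlin : ∀ (c : ℂ) (u v : domainSubmodule hn hA), T (c • u + v) = c • T u + T v := by
    intro c u v
    apply coeff_injective
    rw [coeff_smul_add, hT, hT, hT]
    exact opSeq_smul_add hn hA u.2 v.2 c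
  have hzero : T 0 = 0 := by
    have := hlin (-1) 0 0
    rwa [smul_zero, add_zero, neg_one_smul, neg_add_cancel] at this
  refine ⟨⟨domainSubmodule hn hA,
    { toFun := T
      map_add' := fun u v => by simpa using hlin 1 u v
      map_smul' := fun c u => by simpa [hzero] using hlin c u 0 }⟩, rfl, fun u => ?_⟩
  refine (hT u).trans ?_
  rw [opSeq, ← Phi_eq, remainder_eq]

lemma coeff_apply_eq {H : L2T →ₗ.[ℂ] L2T} (hH : IsMagneticLaplacian n A H) (u : H.domain) :
    coeff (H u) = opSeq n A (coeff (u : L2T)) := by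
  rw [hH.2 u, opSeq, Phi_eq, remainder_eq]

/-- Fatou's lemma for `ℓ²` bounds. -/
lemma l2Bd_of_tendsto {f : ℕ → Freq → ℂ} {g : Freq → ℂ} {C : ℝ}
    (hf : ∀ k, Filter.Tendsto (fun i => f i k) Filter.atTop (nhds (g k)))
    (hC : ∀ᶠ i in Filter.atTop, L2Bd (f i) C) : L2Bd g C := by
  obtain ⟨i, hi⟩ := hC.exists
  refine ⟨hi.nonneg, fun S => ?_⟩
  refine le_of_tendsto (tendsto_finsetSum S fun k _ => ((hf k).norm.pow 2)) ?_
  filter_upwards [hC] with i hi using hi.2 S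

/-- A realisation of the operator is closed as soon as its graph norm is equivalent to the norm
`‖u‖ + ‖Φˢ(u)‖_{𝓗²}` for some `s`: along a sequence that converges in the graph norm `Φˢ(u)`
converges in `𝓗²`, and the limit is identified through the continuity of `Φˢ` in `L²`. -/
lemma isClosed_of_bounds (hn : 2 ≤ n) (hA : PotBd n α N A) {H : L2T →ₗ.[ℂ] L2T}
    (hH : IsMagneticLaplacian n A H) {s C : ℝ} (hs : 0 < s) (hs' : s ≤ 1)
    (h1 : ∀ u : H.domain, hNorm 2 (Phi n A s (u : L2T)) ≤ C * (‖H u‖ + ‖(u : L2T)‖))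
    (h2 : ∀ u : H.domain, ‖H u‖ ≤ C * (hNorm 2 (Phi n A s (u : L2T)) + ‖(u : L2T)‖)) :
    H.IsClosed := by
  have hC : 0 ≤ |C| := abs_nonneg C
  replace h1 : ∀ u : H.domain, hNorm 2 (Phi n A s (u : L2T)) ≤ |C| * (‖H u‖ + ‖(u : L2T)‖) :=
    fun u => (h1 u).trans (mul_le_mul_of_nonneg_right (le_abs_self C) (by positivity))
  have hnn : ∀ f, 0 ≤ hNorm 2 f := fun f => Real.sqrt_nonneg _
  replace h2 : ∀ u : H.domain, ‖H u‖ ≤ |C| * (hNorm 2 (Phi n A s (u : L2T)) + ‖(u : L2T)‖) :=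
    fun u => (h2 u).trans (mul_le_mul_of_nonneg_right (le_abs_self C)
      (add_nonneg (hnn _) (norm_nonneg _)))
  generalize |C| = C at *
  have hmem : ∀ u : L2T, u ∈ H.domain ↔ MemH2 (Phi n A s u) := fun u => by
    rw [memH2_Phi_iff hn hA hs hs']
    exact Set.ext_iff.mp hH.1 u
  have hsub : ∀ u v : L2T, Phi n A s (u - v) = Phi n A s u - Phi n A s v := fun u v => by
    have := Phi_smul_add hn hA hs.le hs' (-1) v u
    rw [neg_one_smul, neg_one_smul, neg_add_eq_sub, neg_add_eq_sub] at this
    exact this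
  obtain ⟨B, hB, hl2⟩ := exists_pert_bd_l2 hn
  have hcont : ∀ u k, ‖Phi n A s u k‖ ≤ (1 + B * s ^ (α / 2) * N) * ‖u‖ := fun u k => by
    have := ((hBd_coeff u).sub (hl2 α N A hA (coeff u) _ s (hBd_coeff u) hs hs')).apply_le k
    rw [← Phi_eq] at this
    simp only [neg_zero, zero_div, Real.rpow_zero, mul_one] at this
    linarith
  refine IsSeqClosed.isClosed fun x p hx hp => ?_
  have hx' : ∀ i, ∃ u : H.domain, (u : L2T) = (x i).1 ∧ H u = (x i).2 := fun i =>
    LinearPMap.mem_graph_iff _ |>.mp (hx i)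
  choose u hu1 hu2 using hx'
  have ht1 : Filter.Tendsto (fun i => (u i : L2T)) Filter.atTop (nhds p.1) := by
    simpa only [hu1] using! (continuous_fst.tendsto p).comp hp
  have ht2 : Filter.Tendsto (fun i => H (u i)) Filter.atTop (nhds p.2) := by
    simpa only [hu2] using! (continuous_snd.tendsto p).comp hp
  have hlim : ∀ k, Filter.Tendsto (fun i => Phi n A s (u i : L2T) k) Filter.atTop
      (nhds (Phi n A s p.1 k)) := by
    intro k
    rw [tendsto_iff_norm_sub_tendsto_zero]
    have h0 := (tendsto_iff_norm_sub_tendsto_zero.mp ht1).const_mul (1 + B * s ^ (α / 2) * N)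
    rw [mul_zero] at h0
    refine squeeze_zero (fun i => norm_nonneg _) (fun i => ?_) h0
    rw [← Pi.sub_apply, ← hsub]
    exact hcont _ k
  have hcauchy : ∀ ε > 0, ∃ i₀, ∀ i ≥ i₀, HBd 2 (Phi n A s (u i : L2T) - Phi n A s p.1)
      (C * (ε + ε)) := by
    intro ε hε
    obtain ⟨a, ha⟩ := Metric.cauchySeq_iff.mp ht2.cauchySeq ε hε
    obtain ⟨b, hb⟩ := Metric.cauchySeq_iff.mp ht1.cauchySeq ε hε
    refine ⟨max a b, fun i hi => ?_⟩
    refine l2Bd_of_tendsto (f := fun j k => (((1 + xiSq k) ^ ((2 : ℝ) / 2) : ℝ) : ℂ) *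
      (Phi n A s (u i : L2T) - Phi n A s (u j : L2T)) k)
      (fun k => (tendsto_const_nhds.sub (hlim k)).const_mul _) ?_
    filter_upwards [Filter.eventually_ge_atTop (max a b)] with j hj
    obtain ⟨G, hG⟩ := memH2_iff.mp ((hmem _).mp (u i - u j).2)
    have h3 := hG.self.weaken (h1 (u i - u j))
    rw [Submodule.coe_sub, hsub, LinearPMap.map_sub] at h3
    refine HBd.weaken h3 ?_
    have h4 := ha i ((le_max_left _ _).trans hi) j ((le_max_left _ _).trans hj)
    have h5 := hb i ((le_max_right _ _).trans hi) j ((le_max_right _ _).trans hj)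
    rw [dist_eq_norm] at h4 h5
    gcongr
  have hp1 : p.1 ∈ H.domain := by
    obtain ⟨i₀, hi₀⟩ := hcauchy 1 one_pos
    obtain ⟨G, hG⟩ := memH2_iff.mp ((hmem _).mp (u i₀).2)
    have hsum := hG.sub (hi₀ i₀ le_rfl)
    rw [sub_sub_cancel] at hsum
    exact (hmem _).mpr (memH2_iff.mpr ⟨_, hsum⟩)
  refine (LinearPMap.mem_graph_iff _).mpr ⟨⟨p.1, hp1⟩, rfl, ?_⟩
  refine tendsto_nhds_unique ?_ ht2
  rw [tendsto_iff_norm_sub_tendsto_zero]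
  have h0 : Filter.Tendsto (fun i => C * (hNorm 2 (Phi n A s (u i : L2T) - Phi n A s p.1) +
      ‖(u i : L2T) - p.1‖)) Filter.atTop (nhds (C * (0 + 0))) := by
    refine ((?_ : Filter.Tendsto _ _ _).add (tendsto_iff_norm_sub_tendsto_zero.mp ht1)).const_mul C
    rw [Metric.tendsto_atTop]
    intro ε hε
    obtain ⟨i₀, hi₀⟩ := hcauchy (ε / (2 * C + 1) / 2) (by positivity)
    refine ⟨i₀, fun i hi => ?_⟩
    rw [dist_zero_right, Real.norm_of_nonneg (hnn _)]
    refine (hi₀ i hi).hNorm_le.trans_lt ?_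
    rw [add_halves, mul_div_assoc', div_lt_iff₀ (by positivity)]
    nlinarith
  rw [add_zero, mul_zero] at h0
  refine squeeze_zero (fun i => norm_nonneg _) (fun i => ?_) h0
  have := h2 (u i - ⟨p.1, hp1⟩)
  rwa [LinearPMap.map_sub, Submodule.coe_sub, hsub] at this

/-- The condition `s < s_β(A)` in real numbers. -/
lemma lt_one_of_lt_sThreshold {m s : ℝ} (hm : 0 < m) (hs : 0 < s) (h1 : 2 / 3 < α)
    (hA : A.xNorm n α ≠ ⊤) (h : ENNReal.ofReal s < sThreshold n m α (betaOf α) A) :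
    m * (s ^ ((2 * α - betaOf α) / 4) / betaStar α (betaOf α)) * (A.xNorm n α).toReal < 1 := by
  have hβ : betaOf α = 2 / 3 + α := by unfold betaOf; ring
  have hstar : betaStar α (betaOf α) = 2 * α - betaOf α := by
    unfold betaStar; rw [if_neg (by linarith)]
  set d := 2 * α - betaOf α with hd
  have hd0 : 0 < d := by linarith
  unfold sThreshold at h
  rw [hstar] at h ⊢
  set X := A.xNorm n α with hX
  rcases eq_or_ne X 0 with h0 | h0
  · rw [h0]; simp
  have hX0 : 0 < X.toReal := ENNReal.toReal_pos h0 hA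
  rw [← ENNReal.ofReal_toReal hA, ← ENNReal.ofReal_mul hm.le,
    ← ENNReal.ofReal_div_of_pos (by positivity),
    ENNReal.ofReal_rpow_of_pos (by positivity), ENNReal.ofReal_lt_ofReal_iff (by positivity)] at h
  have h2 : s ^ (d / 4) < d / (m * X.toReal) := by
    calc s ^ (d / 4) < ((d / (m * X.toReal)) ^ (4 / d)) ^ (d / 4) :=
          Real.rpow_lt_rpow hs.le h (by positivity)
      _ = d / (m * X.toReal) := by
          rw [← Real.rpow_mul (by positivity), show 4 / d * (d / 4) = 1 by field_simp,
            Real.rpow_one]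
  rw [lt_div_iff₀ (by positivity)] at h2
  rw [mul_div_assoc', div_mul_eq_mul_div, div_lt_one hd0]
  linarith

lemma exists_mul_lt_one (m : ℝ) (h1 : 2 / 3 < α) (N : ℝ) : ∃ s : ℝ, 0 < s ∧ s < 1 ∧
    m * (s ^ ((2 * α - betaOf α) / 4) / betaStar α (betaOf α)) * N < 1 := by
  have hd0 : 0 < (2 * α - betaOf α) / 4 := by unfold betaOf; linarith
  have hc : Filter.Tendsto (fun s : ℝ => m * (s ^ ((2 * α - betaOf α) / 4) /
      betaStar α (betaOf α)) * N) (nhdsWithin 0 (Ioi 0)) (nhds 0) := by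
    have h := (Real.continuousAt_rpow_const 0 _ (Or.inr hd0.le)).tendsto
    rw [Real.zero_rpow hd0.ne'] at h
    have := ((h.div_const (betaStar α (betaOf α))).const_mul m).mul_const N
    simp only [zero_div, mul_zero, zero_mul] at this
    exact this.mono_left nhdsWithin_le_nhds
  have h2 := (hc.eventually_lt_const one_pos).and (Ioo_mem_nhdsGT (one_pos : (0 : ℝ) < 1))
  obtain ⟨s, hs⟩ := h2.exists
  exact ⟨s, hs.2.1, hs.2.2, hs.1⟩

lemma sqrt_le_mul_sqrt {a x y p q : ℝ} (ha : 0 ≤ a) (hx : 0 ≤ x) (hp : 0 ≤ p)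
    (hq : 0 ≤ q) (h : x ≤ p * y + q * a) :
    √(a ^ 2 + x ^ 2) ≤ (1 + p + q) * √(a ^ 2 + y ^ 2) := by
  have h1 : a ≤ √(a ^ 2 + y ^ 2) := Real.le_sqrt_of_sq_le (by nlinarith)
  have h2 : y ≤ √(a ^ 2 + y ^ 2) := Real.le_sqrt_of_sq_le (by nlinarith)
  have h3 : √(a ^ 2 + x ^ 2) ≤ a + x := by
    rw [Real.sqrt_le_left (by positivity)]; nlinarith
  have h4 := mul_le_mul_of_nonneg_left h1 hq
  have h5 := mul_le_mul_of_nonneg_left h2 hp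
  linarith

end MagneticLaplacian
end

theorem mainTheorem6 (n : ℕ) (hn : 2 ≤ n) :
    ∃ m : ℝ, 0 < m ∧ ∀ α : ℝ, 2 / 3 < α → α < 1 → ∃ κ : ℝ, 0 < κ ∧
      ∀ A : MagneticLaplacian.EnhancedPotential, A.xNorm n α ≠ ⊤ →
        ∃ H : MagneticLaplacian.L2T →ₗ.[ℂ] MagneticLaplacian.L2T,
          MagneticLaplacian.IsMagneticLaplacian n A H ∧ H.IsClosed ∧
          ∀ s : ℝ, 0 < s → s < 1 →
            ENNReal.ofReal s <
              MagneticLaplacian.sThreshold n m α (MagneticLaplacian.betaOf α) A →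
            (∀ u : H.domain, MagneticLaplacian.MemH2 (MagneticLaplacian.Phi n A s u)) ∧
            (∀ δ : ℝ, 0 < δ → ∀ u : H.domain,
              (1 - δ) * MagneticLaplacian.l2Norm
                    (MagneticLaplacian.lap (MagneticLaplacian.Phi n A s u)) ≤
                  ‖H u‖ + MagneticLaplacian.mDeltaSq m κ α δ s (A.xNorm n α).toReal *
                    ‖(u : MagneticLaplacian.L2T)‖ ∧
              ‖H u‖ ≤ (1 + δ) * MagneticLaplacian.l2Norm
                    (MagneticLaplacian.lap (MagneticLaplacian.Phi n A s u)) +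
                  MagneticLaplacian.mDeltaSq m κ α δ s (A.xNorm n α).toReal *
                    ‖(u : MagneticLaplacian.L2T)‖ ∧
              (1 - δ) * MagneticLaplacian.h2Norm (MagneticLaplacian.Phi n A s u) ≤
                  ‖H u‖ + (κ + MagneticLaplacian.mDeltaSq m κ α δ s (A.xNorm n α).toReal) *
                    ‖(u : MagneticLaplacian.L2T)‖ ∧
              ‖H u‖ ≤ (1 + δ) * MagneticLaplacian.h2Norm (MagneticLaplacian.Phi n A s u) +
                  MagneticLaplacian.mDeltaSq m κ α δ s (A.xNorm n α).toReal *
                    ‖(u : MagneticLaplacian.L2T)‖) ∧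
            ∃ C : ℝ, 0 < C ∧ ∀ u : H.domain,
              MagneticLaplacian.domainNorm n A s u ≤ C * MagneticLaplacian.graphNorm H u ∧
              MagneticLaplacian.graphNorm H u ≤ C * MagneticLaplacian.domainNorm n A s u := by
  obtain ⟨m, hm, hmain⟩ := MagneticLaplacian.exists_opSeq_bounds hn
  refine ⟨m, hm, fun α hα hα' => ?_⟩
  obtain ⟨κ, hκ, hmain⟩ := hmain α hα hα'
  refine ⟨κ, hκ, fun A hxA => ?_⟩
  have hA := MagneticLaplacian.potBd_of_xNorm hα hα' hxA
  set N := (A.xNorm n α).toReal with hN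
  obtain ⟨H, hH⟩ := MagneticLaplacian.exists_isMagneticLaplacian hn hA
  have hmem : ∀ s : ℝ, 0 < s → s < 1 → ∀ u : H.domain,
      MagneticLaplacian.MemH2 (MagneticLaplacian.Phi n A s u) := fun s hs hs' u =>
    (MagneticLaplacian.memH2_Phi_iff hn hA hs hs'.le _).mpr ((Set.ext_iff.mp hH.1 u).mp u.2)
  have hbd : ∀ s : ℝ, 0 < s → s < 1 →
      m * (s ^ ((2 * α - MagneticLaplacian.betaOf α) / 4) /
        MagneticLaplacian.betaStar α (MagneticLaplacian.betaOf α)) * N < 1 →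
      ∀ δ : ℝ, 0 < δ → ∀ u : H.domain,
        (1 - δ) * MagneticLaplacian.l2Norm
              (MagneticLaplacian.lap (MagneticLaplacian.Phi n A s u)) ≤
            ‖H u‖ + MagneticLaplacian.mDeltaSq m κ α δ s N * ‖(u : MagneticLaplacian.L2T)‖ ∧
        ‖H u‖ ≤ (1 + δ) * MagneticLaplacian.l2Norm
              (MagneticLaplacian.lap (MagneticLaplacian.Phi n A s u)) +
            MagneticLaplacian.mDeltaSq m κ α δ s N * ‖(u : MagneticLaplacian.L2T)‖ ∧
        (1 - δ) * MagneticLaplacian.h2Norm (MagneticLaplacian.Phi n A s u) ≤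
            ‖H u‖ + (κ + MagneticLaplacian.mDeltaSq m κ α δ s N) *
              ‖(u : MagneticLaplacian.L2T)‖ ∧
        ‖H u‖ ≤ (1 + δ) * MagneticLaplacian.h2Norm (MagneticLaplacian.Phi n A s u) +
            MagneticLaplacian.mDeltaSq m κ α δ s N * ‖(u : MagneticLaplacian.L2T)‖ := by
    intro s hs hs' hθ δ hδ u
    obtain ⟨G, hG⟩ := MagneticLaplacian.memH2_iff.mp (hmem s hs hs' u)
    have hlap := hG.self.lap.l2Norm_le
    rw [MagneticLaplacian.h2Norm_eq]
    rw [MagneticLaplacian.Phi_eq] at hG hlap ⊢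
    have hop := MagneticLaplacian.memL2_opSeq hn hA ((Set.ext_iff.mp hH.1 u).mp u.2)
    obtain ⟨h1, h2, h3⟩ := hmain N A hA s hs hs' hθ _ _ G (MagneticLaplacian.hBd_coeff u) hG
      hop δ hδ
    rw [← MagneticLaplacian.coeff_apply_eq hH, MagneticLaplacian.l2Norm_coeff] at h1 h2 h3
    refine ⟨h2, h1, h3, h1.trans ?_⟩
    gcongr
  -- The bounds with `δ = 1 / 2`, for the closedness and for the equivalence of norms.
  have hhalf : ∀ s : ℝ, 0 < s → s < 1 →
      m * (s ^ ((2 * α - MagneticLaplacian.betaOf α) / 4) /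
        MagneticLaplacian.betaStar α (MagneticLaplacian.betaOf α)) * N < 1 →
      ∃ c : ℝ, 0 ≤ c ∧ ∀ u : H.domain,
        MagneticLaplacian.h2Norm (MagneticLaplacian.Phi n A s u) ≤
          2 * ‖H u‖ + c * ‖(u : MagneticLaplacian.L2T)‖ ∧
        ‖H u‖ ≤ 2 * MagneticLaplacian.h2Norm (MagneticLaplacian.Phi n A s u) +
          c * ‖(u : MagneticLaplacian.L2T)‖ := by
    intro s hs hs' hθ
    set M := MagneticLaplacian.mDeltaSq m κ α (1 / 2) s N
    refine ⟨2 * (κ + |M|), by positivity, fun u => ?_⟩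
    obtain ⟨-, -, h3, h4⟩ := hbd s hs hs' hθ (1 / 2) (by norm_num) u
    have h5 : 0 ≤ MagneticLaplacian.h2Norm (MagneticLaplacian.Phi n A s u) := Real.sqrt_nonneg _
    have h6 : M * ‖(u : MagneticLaplacian.L2T)‖ ≤ |M| * ‖(u : MagneticLaplacian.L2T)‖ := by
      gcongr
      exact le_abs_self M
    have h7 : 0 ≤ |M| * ‖(u : MagneticLaplacian.L2T)‖ := by positivity
    have h8 : 0 ≤ κ * ‖(u : MagneticLaplacian.L2T)‖ := by positivity
    constructor <;> linarith
  refine ⟨H, hH, ?_, fun s hs hs' hlt => ?_⟩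
  · obtain ⟨s, hs, hs', hθ⟩ := MagneticLaplacian.exists_mul_lt_one m hα N
    obtain ⟨c, hc, h⟩ := hhalf s hs hs' hθ
    simp only [MagneticLaplacian.h2Norm_eq] at h
    have hnn : ∀ f, 0 ≤ MagneticLaplacian.hNorm 2 f := fun f => Real.sqrt_nonneg _
    refine MagneticLaplacian.isClosed_of_bounds hn hA hH hs hs'.le (C := 2 + c) (fun u => ?_)
      fun u => ?_
    · have h1 : 0 ≤ c * ‖H u‖ := by positivity
      linarith [(h u).1, norm_nonneg (u : MagneticLaplacian.L2T)]
    · have h1 := mul_nonneg hc (hnn (MagneticLaplacian.Phi n A s u))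
      linarith [(h u).2, norm_nonneg (u : MagneticLaplacian.L2T)]
  · have hθ := MagneticLaplacian.lt_one_of_lt_sThreshold hm hs hα hxA hlt
    obtain ⟨c, hc, h⟩ := hhalf s hs hs' hθ
    exact ⟨hmem s hs hs', hbd s hs hs' hθ, 1 + 2 + c, by positivity, fun u =>
      ⟨MagneticLaplacian.sqrt_le_mul_sqrt (norm_nonneg _) (Real.sqrt_nonneg _) two_pos.le hc (h u).1,
        MagneticLaplacian.sqrt_le_mul_sqrt (norm_nonneg _) (norm_nonneg _) two_pos.le hc (h u).2⟩⟩
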